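/- Let $W$ be a vector space over $\mathbb C$ and let $\mathcal E^o(W)=\mathrm{Hom}(W,W((x^{-1})))$, with $1_W$ the identity operator, viewed as a constant series. Here $W((x_1^{-1},\dots,x_r^{-1}))$ denotes the space of series in $x_1^{\pm1},\dots,x_r^{\pm1}$ with coefficients in $W$ in which the powers of each variable are bounded above. A subset $S\subseteq\mathcal E^o(W)$ is *quasi-local* if for all $a(x),b(x)\in S$ there is a nonzero polynomial $p(x_1,x_2)\in\mathbb C[x_1,x_2]$ with $p(x_1,x_2)a(x_1)b(x_2)=p(x_1,x_2)b(x_2)a(x_1)$, and *local* if $p$ can always be taken of the form $(x_1-x_2)^k$, $k\in\mathbb N$. It is *quasi-compatible* if for every finite sequence $a_1(x),\dots,a_r(x)$ in $S$ there is a nonzero polynomial $p(x_1,x_2)$ with $$\Big(\prod_{1\le i<j\le r}p(x_i,x_j)\Big)a_1(x_1)\cdots a_r(x_r)\in\mathrm{Hom}\big(W,W((x_1^{-1},\dots,x_r^{-1}))\big).$$ If $p\neq0$ and $p(x_1,x_2)a(x_1)b(x_2)\in\mathrm{Hom}(W,W((x_1^{-1},x_2^{-1})))$, set $$Y_{\mathcal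 E^o}(a(x),x_0)b(x)=\iota_{x,\infty;x_0,0}\big(1/p(x_0+x,x)\big)\,\big(p(x_1,x)a(x_1)b(x)\big)\big|_{x_1=x+x_0}=\sum_{n\in\mathbb Z}a(x)_nb(x)\,x_0^{-n-1}\in\mathcal E^o(W)((x_0)),$$ where $\iota_{x,\infty;x_0,0}$ is the expansion in $\mathbb C((x^{-1}))((x_0))$; this does not depend on $p$. A quasi-compatible subspace is *closed* if it contains $a(x)_nb(x)$ for all its members $a(x),b(x)$ and all $n\in\mathbb Z$. A *nonlocal vertex algebra* is a complex vector space $V$ with a vector $\mathbf 1$ and a linear map $Y:V\to\mathrm{Hom}(V,V((x)))$ such that, for all $u,v,w\in V$, $Y(\mathbf 1,x)v=v$, $Y(v,x)\mathbf 1\in V[[x]]$ has constant term $v$, and $(x_0+x_2)^lY(u,x_0+x_2)Y(v,x_2)w=(x_0+x_2)^lY(Y(u,x_0)v,x_2)w$ for some $l\in\mathbb N$. It is a *vertex algebra* if moreover for all $u,v\in V$ there is $k\in\mathbb N$ with $(x_1-x_2)^kY(u,x_1)Y(v,x_2)=(x_1-x_2)^kY(v,x_2)Y(u,x_1)$. A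 (left) *quasi $V$-module-at-infinity* is a vector space $W$ with a linear map $Y_W:V\to\mathcal E^o(W)$ such that $Y_W(\mathbf 1,x)=1_W$ and for all $u,v\in V$ there is a nonzero polynomial $p(x_1,x_2)$ with $p(x_1,x_2)Y_W(u,x_1)Y_W(v,x_2)\in\mathrm{Hom}(W,W((x_1^{-1},x_2^{-1})))$ and $$p(x_0+x_2,x_2)Y_W(Y(u,x_0)v,x_2)=\big(p(x_1,x_2)Y_W(u,x_1)Y_W(v,x_2)\big)\big|_{x_1=x_2+x_0};$$ it is a (left) *$V$-module-at-infinity* if for all $u,v$ the polynomial $p$ can be taken of the form $(x_1-x_2)^k$, $k\in\mathbb N$. **Theorem.** Let $U$ be a quasi-local subset of $\mathcal E^o(W)$. Then $U$ is quasi-compatible; there is a smallest closed quasi-compatible subspace $\langle U\rangle$ of $\mathcal E^o(W)$ containing $U$ and $1_W$; $(\langle U\rangle,Y_{\mathcal E^o},1_W)$ is a nonlocal vertex algebra and is in fact a vertex algebra; and $W$ is a (left) quasi $\langle U\rangle$-module-at-infinity with $Y_W(a(x),x_0)=a(x_0)$ for $a(x)\in\langle U\rangle$. If $U$ is local, then $W$,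 with the same $Y_W$, is a (left) $\langle U\rangle$-module-at-infinity. -/

import Mathlib

/-! ## Formal series

`C((x⁻¹))` is realised as the Hahn series over `ℤᵒᵈ`: a subset of `ℤᵒᵈ` is well-ordered iff it is
bounded above in `ℤ`, so the elements are exactly the series `∑ cₙ xⁿ` with finitely many positive
powers of `x`. In the same way `Hom (W, W((x⁻¹)))` is `HVertexOperator ℤᵒᵈ ℂ W W`, and
`C((x⁻¹))((x₀))` is the field of Laurent series in `x₀` over `C((x⁻¹))`. -/

namespace VertexAtInfinity

/-- The field `C((x⁻¹))`. -/
abbrev LaurentInf : Type := HahnSeries ℤᵒᵈ ℂ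

/-- The field `C((x⁻¹))((x₀))`. -/
abbrev LaurentInfZero : Type := HahnSeries ℤ LaurentInf

/-- `𝓔ᵒ(W) = Hom (W, W((x⁻¹)))`. -/
abbrev FieldInf (W : Type*) [AddCommGroup W] [Module ℂ W] : Type _ := HVertexOperator ℤᵒᵈ ℂ W W

/-- `𝓔ᵒ(W)((x₀))`, a vector space over `C((x⁻¹))((x₀))`. -/
abbrev FieldInfLaurent (W : Type*) [AddCommGroup W] [Module ℂ W] : Type _ :=
  HahnModule ℤ LaurentInf (FieldInf W)

/-- Formal series `∑ A(n₁,…,n_r) x₁^{n₁} ⋯ x_r^{n_r}`, infinite in all directions, with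
coefficients in `M`. -/
abbrev FormalSeries (r : ℕ) (M : Type*) : Type _ := (Fin r → ℤ) → M

/-- The product of a polynomial with a formal series. -/
noncomputable def polyMul {r : ℕ} {M : Type*} [AddCommGroup M] [Module ℂ M]
    (p : MvPolynomial (Fin r) ℂ) (A : FormalSeries r M) : FormalSeries r M :=
  fun n => ∑ m ∈ p.support, p.coeff m • A (fun i => n i - (m i : ℤ))

section Fields

variable {W : Type*} [AddCommGroup W] [Module ℂ W]

/-- The coefficient of `x ^ n` in `a(x) ∈ 𝓔ᵒ(W)`, an endomorphism of `W`. -/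
noncomputable def coeffAt (a : FieldInf W) (n : ℤ) : Module.End ℂ W :=
  HVertexOperator.coeff a (OrderDual.toDual n)

/-- The identity operator `1_W`, as the constant series in `𝓔ᵒ(W)`. -/
noncomputable def oneField (W : Type*) [AddCommGroup W] [Module ℂ W] : FieldInf W :=
  HVertexOperator.of_coeff (fun n => if n = OrderDual.toDual (0 : ℤ) then LinearMap.id else 0)
    fun w => ((Set.finite_singleton (OrderDual.toDual (0 : ℤ))).subset fun n hn => by
      by_contra h
      have h' : n ≠ OrderDual.toDual (0 : ℤ) := h
      exact hn (by beta_reduce; rw [if_neg h']; rfl)).isPWO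

/-- `A(x₁,…,x_r) ∈ Hom (W, W((x₁⁻¹,…,x_r⁻¹)))`: for every `w`, the powers of each of the
variables that occur in `A(x₁,…,x_r) w` are bounded above. -/
def IsTruncated {r : ℕ} (A : FormalSeries r (Module.End ℂ W)) : Prop :=
  ∀ w : W, ∃ N : ℤ, ∀ n : Fin r → ℤ, (∃ i, N < n i) → A n w = 0

/-- The series `a₁(x₁) a₂(x₂) ⋯ a_r(x_r)`. -/
noncomputable def seqProd {r : ℕ} (a : Fin r → FieldInf W) : FormalSeries r (Module.End ℂ W) :=
  fun n => (List.ofFn fun i => coeffAt (a i) (n i)).prod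

/-- The series `a(x₁) b(x₂)`. -/
noncomputable def pairProd (a b : FieldInf W) : FormalSeries 2 (Module.End ℂ W) :=
  fun n => coeffAt a (n 0) * coeffAt b (n 1)

/-- The series `b(x₂) a(x₁)`. -/
noncomputable def pairProdSwap (a b : FieldInf W) : FormalSeries 2 (Module.End ℂ W) :=
  fun n => coeffAt b (n 1) * coeffAt a (n 0)

/-- The sequence `a₁(x), …, a_r(x)` is quasi-compatible: for some nonzero polynomial `p(x₁,x₂)`,
`(∏_{i<j} p(x_i,x_j)) a₁(x₁) ⋯ a_r(x_r)` lies in `Hom (W, W((x₁⁻¹,…,x_r⁻¹)))`. -/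
def IsQuasiCompatibleSeq {r : ℕ} (a : Fin r → FieldInf W) : Prop :=
  ∃ p : MvPolynomial (Fin 2) ℂ, p ≠ 0 ∧
    IsTruncated (polyMul
      (∏ ij : Fin r × Fin r with ij.1 < ij.2, MvPolynomial.rename ![ij.1, ij.2] p) (seqProd a))

/-- Every finite sequence in `S` is quasi-compatible. -/
def IsQuasiCompatible (S : Set (FieldInf W)) : Prop :=
  ∀ (r : ℕ) (a : Fin r → FieldInf W), (∀ i, a i ∈ S) → IsQuasiCompatibleSeq a

/-- `S` is quasi-local: `p(x₁,x₂) a(x₁) b(x₂) = p(x₁,x₂) b(x₂) a(x₁)` for some nonzero `p`. -/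
def IsQuasiLocal (S : Set (FieldInf W)) : Prop :=
  ∀ a ∈ S, ∀ b ∈ S, ∃ p : MvPolynomial (Fin 2) ℂ, p ≠ 0 ∧
    polyMul p (pairProd a b) = polyMul p (pairProdSwap a b)

/-- `S` is local: `(x₁ - x₂)ᵏ a(x₁) b(x₂) = (x₁ - x₂)ᵏ b(x₂) a(x₁)` for some `k`. -/
def IsLocal (S : Set (FieldInf W)) : Prop :=
  ∀ a ∈ S, ∀ b ∈ S, ∃ k : ℕ,
    polyMul ((MvPolynomial.X 0 - MvPolynomial.X 1) ^ k) (pairProd a b) =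
      polyMul ((MvPolynomial.X 0 - MvPolynomial.X 1) ^ k) (pairProdSwap a b)

/-! ### The substitution `x₁ = x + x₀` -/

/-- For a truncated series, the terms on one antidiagonal are finite in number. -/
theorem IsTruncated.finite_antidiagonal {A : FormalSeries 2 (Module.End ℂ W)}
    (hA : IsTruncated A) (t : ℤ) (c : ℤ → ℤ) (w : W) :
    (Function.support fun m : ℤ => c m • A ![m, t - m] w).Finite := by
  obtain ⟨N, hN⟩ := hA w
  refine (Set.finite_Icc (t - N) N).subset fun m hm => ?_
  by_contra h
  refine hm ?_
  have hz : A ![m, t - m] w = 0 := by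
    apply hN
    by_cases h1 : N < m
    · exact ⟨0, by simpa using h1⟩
    · refine ⟨1, ?_⟩
      simp only [Set.mem_Icc, not_and_or, not_le] at h
      simp
      omega
  simp [hz]

/-- The coefficient of `xˢ x₀ⁱ` in `A(x + x₀, x)`. As `(x + x₀)ᵐ = ∑ᵢ (m choose i) xᵐ⁻ⁱ x₀ⁱ`, it is
`∑ₘ (m choose i) A(m, s + i - m)`, a finite sum on every vector. -/
noncomputable def substCoeff (A : FormalSeries 2 (Module.End ℂ W)) (hA : IsTruncated A)
    (i : ℕ) (s : ℤ) : Module.End ℂ W where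
  toFun w := ∑ᶠ m : ℤ, (Ring.choose m i : ℤ) • A ![m, s + i - m] w
  map_add' u v := by
    rw [← finsum_add_distrib (hA.finite_antidiagonal _ _ u) (hA.finite_antidiagonal _ _ v)]
    simp
  map_smul' c v := by
    rw [RingHom.id_apply, smul_finsum' c (hA.finite_antidiagonal _ _ v)]
    simp only [map_smul]
    exact finsum_congr fun m => smul_comm _ _ _

/-- The coefficient of `x₀ⁱ` in `A(x + x₀, x)`, an element of `𝓔ᵒ(W)`. -/
noncomputable def substField (A : FormalSeries 2 (Module.End ℂ W)) (hA : IsTruncated A)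
    (i : ℕ) : FieldInf W :=
  HVertexOperator.of_coeff (fun s => substCoeff A hA i (OrderDual.ofDual s)) fun w => by
    obtain ⟨N, hN⟩ := hA w
    have hb : BddAbove (OrderDual.toDual ⁻¹'
        (Function.support fun s => substCoeff A hA i (OrderDual.ofDual s) w)) := by
      refine ⟨2 * N - i, fun s hs => ?_⟩
      by_contra h
      refine hs ?_
      change ∑ᶠ m : ℤ, (Ring.choose m i : ℤ) • A ![m, s + i - m] w = 0
      refine finsum_eq_zero_of_forall_eq_zero fun m => ?_
      have hz : A ![m, s + i - m] w = 0 := by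
        apply hN
        by_cases h1 : N < m
        · exact ⟨0, by simpa using h1⟩
        · refine ⟨1, ?_⟩
          simp
          omega
      simp [hz]
    exact (BddBelow.isWF hb.dual).isPWO

/-- `A(x₁, x)|_{x₁ = x + x₀} ∈ 𝓔ᵒ(W)[[x₀]] ⊆ 𝓔ᵒ(W)((x₀))`, for
`A(x₁,x₂) ∈ Hom (W, W((x₁⁻¹,x₂⁻¹)))`. -/
noncomputable def substAdd (A : FormalSeries 2 (Module.End ℂ W)) (hA : IsTruncated A) :
    FieldInfLaurent W :=
  HahnModule.of LaurentInf
    { coeff := fun k : ℤ => if 0 ≤ k then substField A hA k.toNat else 0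
      isPWO_support' := by
        have hb : BddBelow (Function.support
            fun k : ℤ => if 0 ≤ k then substField A hA k.toNat else 0) := by
          refine ⟨0, fun k hk => ?_⟩
          by_contra h
          exact hk (by simp [h])
        exact hb.isWF.isPWO }

/-! ### The vertex operator map of `𝓔ᵒ(W)` -/

/-- The series `x ∈ C((x⁻¹))`. -/
noncomputable def xInf : LaurentInf := HahnSeries.single (OrderDual.toDual (1 : ℤ)) 1

/-- `p(x + x₀, x)`, as an element of the field `C((x⁻¹))((x₀))`. Its inverse in this field is the
expansion `ι_{x,∞;x₀,0}(1 / p(x₀ + x, x))`. -/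
noncomputable def shiftPoly (p : MvPolynomial (Fin 2) ℂ) : LaurentInfZero :=
  MvPolynomial.eval₂ ((HahnSeries.C : LaurentInf →+* LaurentInfZero).comp HahnSeries.C)
    ![HahnSeries.C xInf + HahnSeries.single (1 : ℤ) 1, HahnSeries.C xInf] p

open Classical in
/-- `Y_{𝓔ᵒ}(a(x), x₀) b(x) = ι_{x,∞;x₀,0}(1 / p(x₀ + x, x)) (p(x₁,x) a(x₁) b(x))|_{x₁ = x + x₀}`,
where `p` is a nonzero polynomial with `p(x₁,x₂) a(x₁) b(x₂) ∈ Hom (W, W((x₁⁻¹,x₂⁻¹)))`. The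
right-hand side does not depend on `p`, so any choice will do; the value is `0` if `(a, b)` is not
quasi-compatible. -/
noncomputable def fieldY (a b : FieldInf W) : FieldInfLaurent W :=
  if h : ∃ p : MvPolynomial (Fin 2) ℂ, p ≠ 0 ∧ IsTruncated (polyMul p (pairProd a b)) then
    (shiftPoly h.choose)⁻¹ • substAdd (polyMul h.choose (pairProd a b)) h.choose_spec.2
  else 0

/-- `a(x)ₙ b(x)`, the coefficient of `x₀ ^ (-n-1)` in `Y_{𝓔ᵒ}(a(x), x₀) b(x)`. -/
noncomputable def fieldMode (a : FieldInf W) (n : ℤ) (b : FieldInf W) : FieldInf W :=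
  ((HahnModule.of LaurentInf).symm (fieldY a b)).coeff (-n - 1)

/-- `K` is a closed quasi-compatible subspace of `𝓔ᵒ(W)`. -/
def IsClosedQuasiCompatible (K : Submodule ℂ (FieldInf W)) : Prop :=
  IsQuasiCompatible (K : Set (FieldInf W)) ∧ ∀ a ∈ K, ∀ b ∈ K, ∀ n : ℤ, fieldMode a n b ∈ K

/-- `K = ⟨U⟩`: it is the smallest closed quasi-compatible subspace of `𝓔ᵒ(W)` that contains `U`
and `1_W`. -/
def IsGeneratedBy (K : Submodule ℂ (FieldInf W)) (U : Set (FieldInf W)) : Prop :=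
  IsLeast {L : Submodule ℂ (FieldInf W) |
    IsClosedQuasiCompatible L ∧ U ⊆ (L : Set (FieldInf W)) ∧ oneField W ∈ L} K

end Fields

/-! ## Nonlocal vertex algebras -/

/-- A nonlocal vertex algebra structure on `V`. The series `Y(u, x) v` lies in `V((x))`;
`HVertexOperator.coeff (Y u) n` is the coefficient of `x ^ n` in `Y(u, x)`, that is, the mode
`u_{-n-1}`. The last axiom is weak associativity
`(x₀ + x₂)ˡ Y(u, x₀ + x₂) Y(v, x₂) w = (x₀ + x₂)ˡ Y(Y(u, x₀) v, x₂) w`, where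
`(x₀ + x₂)ᵐ = ∑ᵢ (m choose i) x₀ᵐ⁻ⁱ x₂ⁱ` (`i ≥ 0`); in the series below the variables are
`x₀, x₂` in this order, and the sum over `i` is finite. -/
structure NonlocalVertexAlgebra (V : Type*) [AddCommGroup V] [Module ℂ V] where
  /-- The vertex operator map `v ↦ Y(v, x)`. -/
  Y : V →ₗ[ℂ] VertexOperator ℂ V
  /-- The vacuum vector. -/
  one : V
  vacuum : ∀ (n : ℤ) (v : V), HVertexOperator.coeff (Y one) n v = if n = 0 then v else 0
  creation_neg : ∀ (v : V) (n : ℤ), n < 0 → HVertexOperator.coeff (Y v) n one = 0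
  creation_zero : ∀ v : V, HVertexOperator.coeff (Y v) 0 one = v
  weak_assoc : ∀ u v w : V, ∃ l : ℕ,
    polyMul ((MvPolynomial.X 0 + MvPolynomial.X 1) ^ l)
        (fun n : Fin 2 → ℤ => ∑ᶠ i : ℕ, (Ring.choose (n 0 + i) i : ℤ) •
          HVertexOperator.coeff (Y u) (n 0 + i) (HVertexOperator.coeff (Y v) (n 1 - i) w)) =
      polyMul ((MvPolynomial.X 0 + MvPolynomial.X 1) ^ l)
        (fun n : Fin 2 → ℤ =>
          HVertexOperator.coeff (Y (HVertexOperator.coeff (Y u) (n 0) v)) (n 1) w)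

/-- A nonlocal vertex algebra is a vertex algebra if any two of its vertex operators are mutually
local: `(x₁ - x₂)ᵏ Y(u, x₁) Y(v, x₂) = (x₁ - x₂)ᵏ Y(v, x₂) Y(u, x₁)` for some `k`. -/
def NonlocalVertexAlgebra.IsVertexAlgebra {V : Type*} [AddCommGroup V] [Module ℂ V]
    (N : NonlocalVertexAlgebra V) : Prop :=
  ∀ u v : V, ∃ k : ℕ,
    polyMul ((MvPolynomial.X 0 - MvPolynomial.X 1) ^ k)
        (fun n : Fin 2 → ℤ =>
          (HVertexOperator.coeff (N.Y u) (n 0) * HVertexOperator.coeff (N.Y v) (n 1) :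
            Module.End ℂ V)) =
      polyMul ((MvPolynomial.X 0 - MvPolynomial.X 1) ^ k)
        (fun n : Fin 2 → ℤ =>
          (HVertexOperator.coeff (N.Y v) (n 1) * HVertexOperator.coeff (N.Y u) (n 0) :
            Module.End ℂ V))

section Modules

variable {V : Type*} [AddCommGroup V] [Module ℂ V] {W : Type*} [AddCommGroup W] [Module ℂ W]

/-- `Y_W(Y(u, x₀) v, x) ∈ 𝓔ᵒ(W)((x₀))`. -/
noncomputable def applyModuleMap (N : NonlocalVertexAlgebra V) (YW : V →ₗ[ℂ] FieldInf W) (u v : V) :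
    FieldInfLaurent W :=
  HahnModule.of LaurentInf (((HahnModule.of ℂ).symm (N.Y u v)).map YW)

/-- `p(x₁,x₂) Y_W(u, x₁) Y_W(v, x₂) ∈ Hom (W, W((x₁⁻¹,x₂⁻¹)))` and
`p(x₀ + x₂, x₂) Y_W(Y(u, x₀) v, x₂) = (p(x₁,x₂) Y_W(u, x₁) Y_W(v, x₂))|_{x₁ = x₂ + x₀}`. -/
def AssocAtInfinity (N : NonlocalVertexAlgebra V) (YW : V →ₗ[ℂ] FieldInf W) (u v : V)
    (p : MvPolynomial (Fin 2) ℂ) : Prop :=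
  ∃ h : IsTruncated (polyMul p (pairProd (YW u) (YW v))),
    shiftPoly p • applyModuleMap N YW u v = substAdd (polyMul p (pairProd (YW u) (YW v))) h

/-- `(W, Y_W)` is a (left) quasi module-at-infinity for the nonlocal vertex algebra `V`. -/
def IsQuasiModuleAtInfinity (N : NonlocalVertexAlgebra V) (YW : V →ₗ[ℂ] FieldInf W) : Prop :=
  YW N.one = oneField W ∧
    ∀ u v : V, ∃ p : MvPolynomial (Fin 2) ℂ, p ≠ 0 ∧ AssocAtInfinity N YW u v p

/-- `(W, Y_W)` is a (left) module-at-infinity for `V`: the polynomial can be taken to be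
`(x₁ - x₂)ᵏ`. -/
def IsModuleAtInfinity (N : NonlocalVertexAlgebra V) (YW : V →ₗ[ℂ] FieldInf W) : Prop :=
  IsQuasiModuleAtInfinity N YW ∧
    ∀ u v : V, ∃ k : ℕ,
      AssocAtInfinity N YW u v ((MvPolynomial.X 0 - MvPolynomial.X 1) ^ k)

end Modules

end VertexAtInfinity

open VertexAtInfinity

/-! Quasi-locality forces truncation. If p(xᵢ,xⱼ) makes each pair aᵢ(xᵢ), aⱼ(xⱼ) commute, then after
multiplication by all these polynomials any aₖ(xₖ) may be moved to the right end of the product,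
where it acts directly on the vector and so bounds the powers of xₖ (`isTruncated_polyMul_seqProd`).
This gives quasi-compatibility.

The series Y(a,x₀)b is characterised by p(x+x₀,x) Z = (p(x₁,x) a(x₁) b(x)) at x₁ = x+x₀. Since
p(x+x₀,x) is a nonzero element of a field (`shiftPoly_ne_zero`), Z is unique and does not depend on
p. The predicate `IsExpansion` records this relation, and linear relations between products of
fields pass through it to relations between the modes.

The analogue of Dong's lemma is `exists_pow_mul_locality`: the modes of a and b are local with c
through a polynomial pᴺq, where p and q serve for a and b. As pᴺq stays in any multiplicative set
containing p and q, one argument treats nonzero polynomials and powers of x₁-x₂ together. The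
closure of U and 1_W under modes is therefore quasi-local (local, if U is), hence quasi-compatible,
and it lies in every competitor.

For the vertex algebra axioms, choose Q, a product of three two-variable polynomials, such that
Q(x₁,x₂,x₃) a(x₁) b(x₂) c(x₃) is a truncated series G. Multiplied by the substituted Q, both
Y(a,x₁)Y(b,x₂)c and Y(Y(a,x₀)b,x₂)c become honest substitutions in G, and these can be compared by
binomial identities. Write each factor of Q as (x₁-x₂)ᵏ h with h(x,x) ≠ 0. After substitution the h
become invertible at the origin of the formal variables, and all but one of the differences become
monomials. Both kinds of factor cancel, even between series in different iterated Laurent spaces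
(`polyMul_cancel`). The difference that survives is (x₁-x₂)ᵏ for locality and (x₀+x₂)ˡ for weak
associativity. So a merely quasi-local U still yields a genuine vertex algebra.

The module relation is the characterisation of Y(a,x₀)b, read with the polynomial that makes a and b
commute; for local U it is a power of x₁-x₂. -/

namespace VertexAtInfinity

open MvPolynomial (X C)

/-! ### Polynomials acting on formal series -/

section PolyMul

variable {r s : ℕ} {M N : Type*} [AddCommGroup M] [Module ℂ M] [AddCommGroup N] [Module ℂ N]

theorem polyMul_eq_sum {p : MvPolynomial (Fin r) ℂ} {t : Finset (Fin r →₀ ℕ)} (ht : p.support ⊆ t)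
    (A : FormalSeries r M) (n : Fin r → ℤ) :
    polyMul p A n = ∑ m ∈ t, p.coeff m • A (fun i => n i - (m i : ℤ)) := by
  refine Finset.sum_subset ht fun m _ hm => ?_
  rw [MvPolynomial.notMem_support_iff.1 hm, zero_smul]

theorem polyMul_add_left (p q : MvPolynomial (Fin r) ℂ) (A : FormalSeries r M) :
    polyMul (p + q) A = polyMul p A + polyMul q A := by
  classical
  funext n
  rw [Pi.add_apply, polyMul_eq_sum (t := p.support ∪ q.support) MvPolynomial.support_add,
    polyMul_eq_sum (t := p.support ∪ q.support) Finset.subset_union_left,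
    polyMul_eq_sum (t := p.support ∪ q.support) Finset.subset_union_right,
    ← Finset.sum_add_distrib]
  exact Finset.sum_congr rfl fun m _ => by rw [MvPolynomial.coeff_add, add_smul]

theorem polyMul_monomial (m : Fin r →₀ ℕ) (c : ℂ) (A : FormalSeries r M) (n : Fin r → ℤ) :
    polyMul (MvPolynomial.monomial m c) A n = c • A (fun i => n i - (m i : ℤ)) := by
  classical
  rw [polyMul_eq_sum (t := {m}) MvPolynomial.support_monomial_subset, Finset.sum_singleton,
    MvPolynomial.coeff_monomial, if_pos rfl]

theorem polyMul_add (p : MvPolynomial (Fin r) ℂ) (A B : FormalSeries r M) :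
    polyMul p (A + B) = polyMul p A + polyMul p B := by
  funext n
  simp [polyMul, Finset.sum_add_distrib]

theorem polyMul_smul (p : MvPolynomial (Fin r) ℂ) (c : ℂ) (A : FormalSeries r M) :
    polyMul p (c • A) = c • polyMul p A := by
  funext n
  simp [polyMul, Finset.smul_sum, smul_comm c]

@[simp]
theorem polyMul_zero (p : MvPolynomial (Fin r) ℂ) : polyMul p (0 : FormalSeries r M) = 0 := by
  funext n
  simp [polyMul]

theorem polyMul_neg (p : MvPolynomial (Fin r) ℂ) (A : FormalSeries r M) :
    polyMul p (-A) = -polyMul p A := by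
  funext n
  simp [polyMul]

theorem polyMul_sub (p : MvPolynomial (Fin r) ℂ) (A B : FormalSeries r M) :
    polyMul p (A - B) = polyMul p A - polyMul p B := by
  rw [sub_eq_add_neg, polyMul_add, polyMul_neg, ← sub_eq_add_neg]

theorem polyMul_smul_left (c : ℂ) (p : MvPolynomial (Fin r) ℂ) (A : FormalSeries r M) :
    polyMul (c • p) A = c • polyMul p A := by
  funext n
  rw [polyMul_eq_sum (t := p.support) MvPolynomial.support_smul]
  simp [polyMul, Finset.smul_sum, mul_smul]

theorem polyMul_C (c : ℂ) (A : FormalSeries r M) : polyMul (C c) A = c • A := by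
  funext n
  rw [MvPolynomial.C_apply, polyMul_monomial]
  simp

@[simp]
theorem polyMul_one (A : FormalSeries r M) : polyMul 1 A = A := by
  rw [← MvPolynomial.C_1, polyMul_C, one_smul]

theorem polyMul_X (i : Fin r) (A : FormalSeries r M) (n : Fin r → ℤ) :
    polyMul (X i) A n = A (n - Pi.single i 1) := by
  rw [MvPolynomial.X, polyMul_monomial, one_smul]
  congr 1
  funext j
  by_cases h : j = i
  · subst h; simp
  · simp [h]

theorem polyMul_mul (p q : MvPolynomial (Fin r) ℂ) (A : FormalSeries r M) :
    polyMul (p * q) A = polyMul p (polyMul q A) := by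
  induction p using MvPolynomial.induction_on' with
  | add p₁ p₂ h₁ h₂ => rw [add_mul, polyMul_add_left, polyMul_add_left, h₁, h₂]
  | monomial m c =>
    induction q using MvPolynomial.induction_on' with
    | add q₁ q₂ h₁ h₂ => rw [mul_add, polyMul_add_left, polyMul_add_left, polyMul_add, h₁, h₂]
    | monomial m' c' =>
      funext n
      rw [MvPolynomial.monomial_mul, polyMul_monomial, polyMul_monomial, polyMul_monomial, mul_smul]
      congr 3
      funext i
      simp
      ring

/-- The action of polynomials on formal series, as a homomorphism of algebras. -/
noncomputable def polyMulHom (r : ℕ) (M : Type*) [AddCommGroup M] [Module ℂ M] :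
    MvPolynomial (Fin r) ℂ →ₐ[ℂ] Module.End ℂ (FormalSeries r M) :=
  AlgHom.ofLinearMap
    { toFun := fun p =>
        { toFun := polyMul p
          map_add' := polyMul_add p
          map_smul' := polyMul_smul p }
      map_add' := fun p q => LinearMap.ext (polyMul_add_left p q)
      map_smul' := fun c p => LinearMap.ext (polyMul_smul_left c p) }
    (LinearMap.ext polyMul_one) fun p q => LinearMap.ext (polyMul_mul p q)

theorem polyMulHom_apply (p : MvPolynomial (Fin r) ℂ) (A : FormalSeries r M) :
    polyMulHom r M p A = polyMul p A := rfl

theorem polyMul_sub_left (p q : MvPolynomial (Fin r) ℂ) (A : FormalSeries r M) :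
    polyMul (p - q) A = polyMul p A - polyMul q A := by
  simp only [← polyMulHom_apply, map_sub, LinearMap.sub_apply]

theorem polyMul_neg_left (p : MvPolynomial (Fin r) ℂ) (A : FormalSeries r M) :
    polyMul (-p) A = -polyMul p A := by
  simp only [← polyMulHom_apply, map_neg, LinearMap.neg_apply]

theorem polyMul_comm (p q : MvPolynomial (Fin r) ℂ) (A : FormalSeries r M) :
    polyMul p (polyMul q A) = polyMul q (polyMul p A) := by
  rw [← polyMul_mul, mul_comm, polyMul_mul]

theorem polyMul_eq_of_dvd {p q : MvPolynomial (Fin r) ℂ} {A B : FormalSeries r M} (h : p ∣ q)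
    (hp : polyMul p A = polyMul p B) : polyMul q A = polyMul q B := by
  obtain ⟨q, rfl⟩ := h
  rw [mul_comm, polyMul_mul, polyMul_mul, hp]

/-- A linear relation between formal series that is preserved by `(xᵢ, φᵢ)` is preserved by
`(p, p(φ))` for all polynomials `p`. -/
theorem polyMul_rel {R : FormalSeries r M → FormalSeries s N → Prop}
    (hadd : ∀ A B A' B', R A B → R A' B' → R (A + A') (B + B'))
    (hsmul : ∀ (c : ℂ) A B, R A B → R (c • A) (c • B)) (φ : Fin r → MvPolynomial (Fin s) ℂ)
    (hX : ∀ i A B, R A B → R (polyMul (X i) A) (polyMul (φ i) B))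
    (p : MvPolynomial (Fin r) ℂ) : ∀ {A B}, R A B →
      R (polyMul p A) (polyMul (MvPolynomial.aeval φ p) B) := by
  induction p using MvPolynomial.induction_on with
  | C c =>
    intro A B h
    rw [← MvPolynomial.algebraMap_eq, AlgHom.commutes, MvPolynomial.algebraMap_eq,
      MvPolynomial.algebraMap_eq, polyMul_C, polyMul_C]
    exact hsmul c A B h
  | add p q hp hq =>
    intro A B h
    rw [map_add, polyMul_add_left, polyMul_add_left]
    exact hadd _ _ _ _ (hp h) (hq h)
  | mul_X p i hp =>
    intro A B h
    rw [map_mul, polyMul_mul, polyMul_mul, MvPolynomial.aeval_X]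
    exact hp (hX i A B h)

/-- A linear operator on formal series that intertwines `xᵢ` and `φᵢ` intertwines `p` and `p(φ)`. -/
theorem polyMul_intertwine (S : FormalSeries r M →ₗ[ℂ] FormalSeries s N)
    (φ : Fin r → MvPolynomial (Fin s) ℂ)
    (hX : ∀ i A, S (polyMul (X i) A) = polyMul (φ i) (S A))
    (p : MvPolynomial (Fin r) ℂ) (A : FormalSeries r M) :
    S (polyMul p A) = polyMul (MvPolynomial.aeval φ p) (S A) :=
  (polyMul_rel (R := fun A B => B = S A) (by rintro A _ A' _ rfl rfl; simp)
    (by rintro c A _ rfl; simp) φ (by rintro i A _ rfl; exact (hX i A).symm) p rfl).symm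

theorem aeval_X_comp (σ : Fin r → Fin s) (p : MvPolynomial (Fin r) ℂ) :
    MvPolynomial.aeval (fun i => X (σ i) : Fin r → MvPolynomial (Fin s) ℂ) p =
      MvPolynomial.rename σ p :=
  AlgHom.congr_fun (MvPolynomial.algHom_ext (by simp)) p

/-- Injectivity of σ is what makes a shift of the exponent at σ(i) shift the exponent of exactly one
variable of A. -/
theorem polyMul_rename (σ : Fin r → Fin s) (hσ : Function.Injective σ) (p : MvPolynomial (Fin r) ℂ)
    (A : FormalSeries r M) :
    polyMul (MvPolynomial.rename σ p) (fun n => A (fun i => n (σ i)) : FormalSeries s M) =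
      fun n => polyMul p A (fun i => n (σ i)) := by
  rw [← aeval_X_comp]
  exact (polyMul_intertwine
    { toFun := fun A => (fun n => A (fun i => n (σ i)) : FormalSeries s M)
      map_add' := fun _ _ => rfl
      map_smul' := fun _ _ => rfl } (fun i => X (σ i)) (fun i A => by
      funext n
      simp only [LinearMap.coe_mk, AddHom.coe_mk, polyMul_X]
      congr 1
      funext j
      by_cases hj : j = i
      · subst hj; simp
      · simp [hj, hσ.ne hj]) p A).symm

end PolyMul

/-! ### Hahn modules over Laurent series with coefficients in a field -/

section HahnModuleGeneric

variable {F E : Type*} [Field F] [AddCommGroup E] [Module F E]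

theorem hahnModule_coeff_C_smul (f : F) (Z : HahnModule ℤ F E) (k : ℤ) :
    ((HahnModule.of F).symm ((HahnSeries.C f : HahnSeries ℤ F) • Z)).coeff k =
      f • ((HahnModule.of F).symm Z).coeff k :=
  HahnModule.coeff_single_zero_smul

theorem hahnModule_coeff_single_smul (Z : HahnModule ℤ F E) (k : ℤ) :
    ((HahnModule.of F).symm ((HahnSeries.single (1 : ℤ) 1 : HahnSeries ℤ F) • Z)).coeff k =
      ((HahnModule.of F).symm Z).coeff (k - 1) := by
  have := HahnModule.coeff_single_smul_vadd (r := (1 : F)) (x := Z)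
    (a := k - 1) (b := (1 : ℤ))
  rw [one_smul, vadd_eq_add, add_sub_cancel] at this
  exact this

theorem hahnModule_add_smul (f g : HahnSeries ℤ F) (Z : HahnModule ℤ F E) :
    (f + g) • Z = f • Z + g • Z := add_smul f g Z

theorem hahnModule_smul_add (f : HahnSeries ℤ F) (Z Z' : HahnModule ℤ F E) :
    f • (Z + Z') = f • Z + f • Z' := smul_add f Z Z'

theorem hahnModule_mul_smul (f g : HahnSeries ℤ F) (Z : HahnModule ℤ F E) :
    (f * g) • Z = f • g • Z := mul_smul f g Z

theorem hahnModule_one_smul (Z : HahnModule ℤ F E) : (1 : HahnSeries ℤ F) • Z = Z := one_smul _ Z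

theorem hahnModule_smul_cancel {f : HahnSeries ℤ F} (hf : f ≠ 0) {Z Z' : HahnModule ℤ F E}
    (h : f • Z = f • Z') : Z = Z' := by
  rw [← one_smul (HahnSeries ℤ F) Z, ← one_smul (HahnSeries ℤ F) Z', ← inv_mul_cancel₀ hf, mul_smul,
    mul_smul, h]

theorem hahnModule_smul_inv {f : HahnSeries ℤ F} (hf : f ≠ 0) (Z : HahnModule ℤ F E) :
    f • f⁻¹ • Z = Z := by
  rw [← mul_smul, mul_inv_cancel₀ hf, one_smul]

end HahnModuleGeneric

section FieldCoeff

variable {W : Type*} [AddCommGroup W] [Module ℂ W]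

/-! ### Coefficients of fields -/

theorem field_ext {a b : FieldInf W} (h : ∀ n, coeffAt a n = coeffAt b n) : a = b :=
  HVertexOperator.coeff_inj (funext fun n => h (OrderDual.ofDual n))

theorem coeffAt_add (a b : FieldInf W) (n : ℤ) : coeffAt (a + b) n = coeffAt a n + coeffAt b n := by
  simp [coeffAt]

theorem coeffAt_smul (c : ℂ) (a : FieldInf W) (n : ℤ) : coeffAt (c • a) n = c • coeffAt a n := by
  simp [coeffAt]

/-- `coeffAt` as a linear map. -/
noncomputable def coeffAtHom (W : Type*) [AddCommGroup W] [Module ℂ W] (n : ℤ) :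
    FieldInf W →ₗ[ℂ] Module.End ℂ W where
  toFun a := coeffAt a n
  map_add' a b := coeffAt_add a b n
  map_smul' c a := coeffAt_smul c a n

@[simp]
theorem coeffAt_zero (n : ℤ) : coeffAt (0 : FieldInf W) n = 0 := (coeffAtHom W n).map_zero

theorem coeffAt_sub (a b : FieldInf W) (n : ℤ) : coeffAt (a - b) n = coeffAt a n - coeffAt b n :=
  (coeffAtHom W n).map_sub a b

theorem coeffAt_bounded (a : FieldInf W) (w : W) : ∃ N : ℤ, ∀ n, N < n → coeffAt a n w = 0 := by
  have h := (HVertexOperator.coeff_isPWOsupport a w).isWF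
  by_cases hne : ((HahnModule.of ℂ).symm (a w)).coeff.support.Nonempty
  · refine ⟨OrderDual.ofDual (h.min hne), fun n hn => ?_⟩
    by_contra h0
    exact h.not_lt_min hne (a := OrderDual.toDual n) h0 hn
  · rw [Set.not_nonempty_iff_eq_empty, Function.support_eq_empty_iff] at hne
    exact ⟨0, fun n _ => congrFun hne (OrderDual.toDual n)⟩

/-- The field with given coefficients. -/
noncomputable def mkField (f : ℤ → Module.End ℂ W) (hf : ∀ w, ∃ N : ℤ, ∀ n, N < n → f n w = 0) :
    FieldInf W :=
  HVertexOperator.of_coeff (fun s => f (OrderDual.ofDual s)) fun w => by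
    obtain ⟨N, hN⟩ := hf w
    have hb : BddAbove (OrderDual.toDual ⁻¹'
        (Function.support fun s => f (OrderDual.ofDual s) w)) := by
      refine ⟨N, fun s hs => ?_⟩
      by_contra h
      exact hs (hN _ (not_le.1 h))
    exact (BddBelow.isWF hb.dual).isPWO

theorem coeffAt_oneField (n : ℤ) :
    coeffAt (oneField W) n = if n = 0 then LinearMap.id else 0 := rfl

theorem coeffAt_xInf_smul (a : FieldInf W) (n : ℤ) : coeffAt (xInf • a) n = coeffAt a (n - 1) := by
  ext w
  have := HahnModule.coeff_single_smul_vadd (r := (1 : ℂ)) (x := a w)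
    (a := OrderDual.toDual (n - 1)) (b := OrderDual.toDual (1 : ℤ))
  rw [one_smul] at this
  have e : OrderDual.toDual (1 : ℤ) +ᵥ OrderDual.toDual (n - 1) = OrderDual.toDual n :=
    congrArg OrderDual.toDual (add_sub_cancel 1 n)
  rw [e] at this
  exact this

theorem coeffAt_C_smul (c : ℂ) (a : FieldInf W) (n : ℤ) :
    coeffAt ((HahnSeries.C c : LaurentInf) • a) n = c • coeffAt a n := by
  ext w
  exact HahnModule.coeff_single_zero_smul (r := c) (x := a w) (a := OrderDual.toDual n)

theorem substField_coeffAt {A : FormalSeries 2 (Module.End ℂ W)} (hA : IsTruncated A) (i : ℕ)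
    (s : ℤ) (w : W) :
    coeffAt (substField A hA i) s w = ∑ᶠ m : ℤ, (Ring.choose m i : ℤ) • A ![m, s + i - m] w := rfl

/-! ### Coefficients of elements of `𝓔ᵒ(W)((x₀))` -/

/-- The coefficient of `x₀ᵏ`. -/
noncomputable def fcoeff (Z : FieldInfLaurent W) (k : ℤ) : FieldInf W :=
  ((HahnModule.of LaurentInf).symm Z).coeff k

theorem fcoeff_ext {Z Z' : FieldInfLaurent W} (h : ∀ k, fcoeff Z k = fcoeff Z' k) : Z = Z' :=
  HahnModule.ext _ _ (funext h)

@[simp]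
theorem fcoeff_add (Z Z' : FieldInfLaurent W) (k : ℤ) :
    fcoeff (Z + Z') k = fcoeff Z k + fcoeff Z' k := rfl

@[simp]
theorem fcoeff_zero (k : ℤ) : fcoeff (0 : FieldInfLaurent W) k = 0 := rfl

theorem fcoeff_bounded (Z : FieldInfLaurent W) : ∃ N : ℤ, ∀ k, k < N → fcoeff Z k = 0 := by
  have h := (HahnSeries.isPWO_support ((HahnModule.of LaurentInf).symm Z)).isWF
  by_cases hne : ((HahnModule.of LaurentInf).symm Z).support.Nonempty
  · refine ⟨h.min hne, fun n hn => ?_⟩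
    by_contra h0
    exact h.not_lt_min hne (a := n) h0 hn
  · exact ⟨0, fun n _ => not_not.1 fun h0 => hne ⟨n, h0⟩⟩

theorem add_smul_laurent (f g : LaurentInfZero) (Z : FieldInfLaurent W) :
    (f + g) • Z = f • Z + g • Z := hahnModule_add_smul f g Z

theorem smul_add_laurent (f : LaurentInfZero) (Z Z' : FieldInfLaurent W) :
    f • (Z + Z') = f • Z + f • Z' := hahnModule_smul_add f Z Z'

theorem mul_smul_laurent (f g : LaurentInfZero) (Z : FieldInfLaurent W) :
    (f * g) • Z = f • g • Z := hahnModule_mul_smul f g Z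

theorem one_smul_laurent (Z : FieldInfLaurent W) : (1 : LaurentInfZero) • Z = Z :=
  hahnModule_one_smul Z

theorem smul_cancel_laurent {f : LaurentInfZero} (hf : f ≠ 0) {Z Z' : FieldInfLaurent W}
    (h : f • Z = f • Z') : Z = Z' := hahnModule_smul_cancel hf h

theorem smul_inv_laurent {f : LaurentInfZero} (hf : f ≠ 0) (Z : FieldInfLaurent W) :
    f • f⁻¹ • Z = Z := hahnModule_smul_inv hf Z

theorem fcoeff_C_smul (f : LaurentInf) (Z : FieldInfLaurent W) (k : ℤ) :
    fcoeff ((HahnSeries.C f : LaurentInfZero) • Z) k = f • fcoeff Z k :=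
  hahnModule_coeff_C_smul f Z k

theorem fcoeff_single_smul (Z : FieldInfLaurent W) (k : ℤ) :
    fcoeff ((HahnSeries.single (1 : ℤ) 1 : LaurentInfZero) • Z) k = fcoeff Z (k - 1) :=
  hahnModule_coeff_single_smul Z k

theorem fcoeff_substAdd {A : FormalSeries 2 (Module.End ℂ W)} (hA : IsTruncated A) (k : ℤ) :
    fcoeff (substAdd A hA) k = if 0 ≤ k then substField A hA k.toNat else 0 := rfl

/-- The element of `𝓔ᵒ(W)((x₀))` with given coefficients. -/
noncomputable def mkLaurent (f : ℤ → FieldInf W) (hf : ∃ N : ℤ, ∀ k, k < N → f k = 0) :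
    FieldInfLaurent W :=
  HahnModule.of LaurentInf
    { coeff := f
      isPWO_support' := by
        obtain ⟨N, hN⟩ := hf
        have hb : BddBelow (Function.support f) :=
          ⟨N, fun k hk => not_lt.1 fun h => hk (hN k h)⟩
        exact hb.isWF.isPWO }

@[simp]
theorem shiftPoly_X_zero :
    shiftPoly (X 0) = HahnSeries.C xInf + HahnSeries.single (1 : ℤ) 1 := by
  simp [shiftPoly]

@[simp]
theorem shiftPoly_X_one : shiftPoly (X 1) = HahnSeries.C xInf := by
  simp [shiftPoly]

theorem shiftPoly_C (c : ℂ) : shiftPoly (C c) = HahnSeries.C (HahnSeries.C c) := by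
  simp [shiftPoly]

theorem shiftPoly_mul (p q : MvPolynomial (Fin 2) ℂ) :
    shiftPoly (p * q) = shiftPoly p * shiftPoly q := MvPolynomial.eval₂_mul _ _

theorem shiftPoly_add (p q : MvPolynomial (Fin 2) ℂ) :
    shiftPoly (p + q) = shiftPoly p + shiftPoly q := MvPolynomial.eval₂_add _ _

@[simp]
theorem shiftPoly_one : shiftPoly 1 = 1 := MvPolynomial.eval₂_one _ _

/-! ### Truncated series -/

theorem IsTruncated.add {r : ℕ} {A B : FormalSeries r (Module.End ℂ W)} (hA : IsTruncated A)
    (hB : IsTruncated B) : IsTruncated (A + B) := fun w => by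
  obtain ⟨N, hN⟩ := hA w
  obtain ⟨N', hN'⟩ := hB w
  refine ⟨max N N', fun n ⟨i, hi⟩ => ?_⟩
  rw [Pi.add_apply, LinearMap.add_apply, hN n ⟨i, lt_of_le_of_lt (le_max_left _ _) hi⟩,
    hN' n ⟨i, lt_of_le_of_lt (le_max_right _ _) hi⟩, add_zero]

theorem IsTruncated.zero {r : ℕ} : IsTruncated (0 : FormalSeries r (Module.End ℂ W)) :=
  fun _ => ⟨0, fun _ _ => rfl⟩

theorem IsTruncated.smul {r : ℕ} {A : FormalSeries r (Module.End ℂ W)} (hA : IsTruncated A)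
    (c : ℂ) : IsTruncated (c • A) := fun w => by
  obtain ⟨N, hN⟩ := hA w
  exact ⟨N, fun n hn => by rw [Pi.smul_apply, LinearMap.smul_apply, hN n hn, smul_zero]⟩

theorem IsTruncated.polyMul_X {r : ℕ} {A : FormalSeries r (Module.End ℂ W)} (hA : IsTruncated A)
    (i : Fin r) : IsTruncated (polyMul (X i) A) := fun w => by
  obtain ⟨N, hN⟩ := hA w
  refine ⟨N + 1, fun n ⟨j, hj⟩ => ?_⟩
  rw [VertexAtInfinity.polyMul_X]
  refine hN _ ⟨j, ?_⟩
  by_cases h : j = i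
  · subst h; simp; omega
  · simp [h]; omega

/-- A property stable under sums, scalars and multiplication by variables is stable under
polynomials. `polyMul_rel` is used with a dummy second component; several closure properties below
follow this pattern. -/
theorem IsTruncated.polyMul {r : ℕ} {A : FormalSeries r (Module.End ℂ W)} (hA : IsTruncated A)
    (p : MvPolynomial (Fin r) ℂ) : IsTruncated (polyMul p A) :=
  polyMul_rel (R := fun A (_ : FormalSeries r (Module.End ℂ W)) => IsTruncated A)
    (fun _ _ _ _ h h' => h.add h') (fun c _ _ h => h.smul c) X (fun i _ _ h => h.polyMul_X i) p
    (B := 0) hA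

theorem IsTruncated.of_dvd {r : ℕ} {A : FormalSeries r (Module.End ℂ W)}
    {p q : MvPolynomial (Fin r) ℂ} (h : p ∣ q) (hA : IsTruncated (VertexAtInfinity.polyMul p A)) :
    IsTruncated (VertexAtInfinity.polyMul q A) := by
  obtain ⟨q, rfl⟩ := h
  rw [mul_comm, polyMul_mul]
  exact hA.polyMul q

/-! ### Substitution and polynomials -/

theorem substAdd_congr {A B : FormalSeries 2 (Module.End ℂ W)} (h : A = B) (hA : IsTruncated A)
    (hB : IsTruncated B) : substAdd A hA = substAdd B hB := by
  subst h; rfl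

theorem substAdd_add {A B : FormalSeries 2 (Module.End ℂ W)} (hA : IsTruncated A)
    (hB : IsTruncated B) : substAdd (A + B) (hA.add hB) = substAdd A hA + substAdd B hB := by
  refine fcoeff_ext fun k => ?_
  rw [fcoeff_add, fcoeff_substAdd, fcoeff_substAdd, fcoeff_substAdd]
  split_ifs
  · refine field_ext fun n => LinearMap.ext fun w => ?_
    rw [coeffAt_add, LinearMap.add_apply, substField_coeffAt, substField_coeffAt,
      substField_coeffAt,
      ← finsum_add_distrib (hA.finite_antidiagonal _ _ w) (hB.finite_antidiagonal _ _ w)]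
    exact finsum_congr fun m => smul_add _ _ _
  · simp

theorem substAdd_zero (h : IsTruncated (0 : FormalSeries 2 (Module.End ℂ W))) :
    substAdd 0 h = 0 := by
  refine fcoeff_ext fun k => ?_
  rw [fcoeff_substAdd]
  split_ifs
  · refine field_ext fun n => LinearMap.ext fun w => ?_
    rw [substField_coeffAt]
    simp
  · simp

theorem substAdd_smul {A : FormalSeries 2 (Module.End ℂ W)} (hA : IsTruncated A) (c : ℂ) :
    substAdd (c • A) (hA.smul c) = shiftPoly (C c) • substAdd A hA := by
  refine fcoeff_ext fun k => ?_
  rw [shiftPoly_C, fcoeff_C_smul, fcoeff_substAdd, fcoeff_substAdd]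
  split_ifs
  · refine field_ext fun n => LinearMap.ext fun w => ?_
    rw [coeffAt_C_smul, LinearMap.smul_apply, substField_coeffAt, substField_coeffAt,
      smul_finsum' c (hA.finite_antidiagonal _ _ w)]
    exact finsum_congr fun m => smul_comm _ _ _
  · simp

theorem substAdd_X_one {A : FormalSeries 2 (Module.End ℂ W)} (hA : IsTruncated A) :
    substAdd (polyMul (X 1) A) (hA.polyMul_X 1) = shiftPoly (X 1) • substAdd A hA := by
  refine fcoeff_ext fun k => ?_
  rw [shiftPoly_X_one, fcoeff_C_smul, fcoeff_substAdd, fcoeff_substAdd]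
  split_ifs
  · refine field_ext fun n => LinearMap.ext fun w => ?_
    rw [coeffAt_xInf_smul, substField_coeffAt, substField_coeffAt]
    refine finsum_congr fun m => ?_
    rw [polyMul_X]
    congr 3
    funext i
    fin_cases i <;> simp
    ring
  · simp

/-- This is Pascal's rule. Multiplication by x₁ shifts the summation index and turns (m choose i)
into (m+1 choose i); its two parts (m choose i) and (m choose i-1) account for multiplication by x
and by x₀. -/
theorem substAdd_X_zero {A : FormalSeries 2 (Module.End ℂ W)} (hA : IsTruncated A) :
    substAdd (polyMul (X 0) A) (hA.polyMul_X 0) = shiftPoly (X 0) • substAdd A hA := by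
  have key : ∀ (i : ℕ) (n : ℤ) (w : W),
      ∑ᶠ m : ℤ, (Ring.choose m i : ℤ) • polyMul (X 0) A ![m, n + i - m] w =
        ∑ᶠ m : ℤ, (Ring.choose (m + 1) i : ℤ) • A ![m, n - 1 + i - m] w := by
    intro i n w
    rw [← finsum_comp_equiv (Equiv.addRight (1 : ℤ))]
    refine finsum_congr fun m => ?_
    rw [polyMul_X]
    simp only [Equiv.coe_addRight]
    congr 3
    funext i
    fin_cases i <;> simp
    ring
  refine fcoeff_ext fun k => ?_
  rw [shiftPoly_X_zero, add_smul_laurent, fcoeff_add, fcoeff_C_smul, fcoeff_single_smul, fcoeff_substAdd,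
    fcoeff_substAdd, fcoeff_substAdd]
  refine field_ext fun n => LinearMap.ext fun w => ?_
  rw [coeffAt_add, coeffAt_xInf_smul, LinearMap.add_apply]
  rcases lt_trichotomy k 0 with hk | rfl | hk
  · simp [not_le.2 hk, show ¬ (1 : ℤ) ≤ k by omega]
  · simp [substField_coeffAt]
    have := key 0 n w
    simpa using this
  · obtain ⟨k, rfl⟩ : ∃ j : ℕ, k = j + 1 := ⟨(k - 1).toNat, by omega⟩
    rw [if_pos hk.le, if_pos hk.le, if_pos (by omega), show ((k : ℤ) + 1).toNat = k + 1 by omega,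
      show ((k : ℤ) + 1 - 1).toNat = k by omega, substField_coeffAt, key, substField_coeffAt,
      substField_coeffAt]
    have e : ∀ m : ℤ, n - 1 + ((k + 1 : ℕ) : ℤ) - m = n + k - m := fun m => by push_cast; ring
    simp only [e]
    rw [← finsum_add_distrib (hA.finite_antidiagonal _ _ w) (hA.finite_antidiagonal _ _ w)]
    refine finsum_congr fun m => ?_
    rw [← add_smul, Ring.choose_succ_succ, add_comm]

/-- Substitution is linear over polynomials, which act on the target through p(x+x₀,x). The
independence of Y from the chosen polynomial rests on this. -/
theorem substAdd_polyMul (p : MvPolynomial (Fin 2) ℂ) {A : FormalSeries 2 (Module.End ℂ W)}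
    (hA : IsTruncated A) : substAdd (polyMul p A) (hA.polyMul p) = shiftPoly p • substAdd A hA := by
  induction p using MvPolynomial.induction_on generalizing A with
  | C c =>
    rw [← substAdd_smul]
    exact substAdd_congr (polyMul_C c A) _ _
  | add p q hp hq =>
    rw [shiftPoly_add, add_smul_laurent, ← hp, ← hq, ← substAdd_add]
    exact substAdd_congr (polyMul_add_left p q A) _ _
  | mul_X p i hp =>
    rw [substAdd_congr (polyMul_mul p (X i) A) _ ((hA.polyMul (X i)).polyMul p), hp (hA.polyMul (X i)), shiftPoly_mul,
      mul_smul_laurent]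
    congr 1
    fin_cases i
    · exact substAdd_X_zero hA
    · exact substAdd_X_one hA

end FieldCoeff

/-! ### Restriction of polynomials to the diagonal -/

/-- `p(x, x)`. -/
noncomputable def diag {r : ℕ} : MvPolynomial (Fin r) ℂ →ₐ[ℂ] Polynomial ℂ :=
  MvPolynomial.aeval fun _ => Polynomial.X

@[simp]
theorem diag_X {r : ℕ} (i : Fin r) : diag (X i : MvPolynomial (Fin r) ℂ) = Polynomial.X := by
  simp [diag]

/-- Modulo x₁-x₂ every p is congruent to p(x₂,x₂). -/
theorem X_sub_X_dvd_of_diag_eq_zero {h : MvPolynomial (Fin 2) ℂ} (hh : diag h = 0) :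
    (X 0 - X 1 : MvPolynomial (Fin 2) ℂ) ∣ h := by
  have key : ∀ p : MvPolynomial (Fin 2) ℂ, (X 0 - X 1 : MvPolynomial (Fin 2) ℂ) ∣
      p - Polynomial.aeval (X 1 : MvPolynomial (Fin 2) ℂ) (diag p) := by
    intro p
    induction p using MvPolynomial.induction_on with
    | C c =>
      rw [← MvPolynomial.algebraMap_eq, AlgHom.commutes, AlgHom.commutes, sub_self]
      exact dvd_zero _
    | add p q hp hq =>
      rw [map_add, map_add, add_sub_add_comm]
      exact dvd_add hp hq
    | mul_X p i hp =>
      rw [map_mul, map_mul, diag_X, Polynomial.aeval_X]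
      have : p * X i - Polynomial.aeval (X 1) (diag p) * X 1 =
          (p - Polynomial.aeval (X 1) (diag p)) * X i +
            Polynomial.aeval (X 1) (diag p) * (X i - X 1) := by ring
      rw [this]
      refine dvd_add (hp.mul_right _) (Dvd.dvd.mul_left ?_ _)
      fin_cases i <;> simp
  simpa [hh] using key h

/-- Split off the largest power of x₁-x₂. The cofactor h is the part that can be cancelled after the
substitutions below, so only the exponent l matters for the vertex algebra. -/
theorem exists_eq_X_sub_X_pow_mul {p : MvPolynomial (Fin 2) ℂ} (hp : p ≠ 0) :
    ∃ (l : ℕ) (h : MvPolynomial (Fin 2) ℂ), p = (X 0 - X 1) ^ l * h ∧ diag h ≠ 0 := by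
  have hnu : ¬ IsUnit (X 0 - X 1 : MvPolynomial (Fin 2) ℂ) := fun hu => by
    simpa using hu.map diag
  obtain ⟨h, hh, hd⟩ :=
    (FiniteMultiplicity.of_not_isUnit hnu hp).exists_eq_pow_mul_and_not_dvd
  exact ⟨_, h, hh, fun h0 => hd (X_sub_X_dvd_of_diag_eq_zero h0)⟩

/-- The element x is transcendental over ℂ: its powers are distinct monomials, so the coefficients
of q can be read off from q(x). -/
theorem aeval_xInf_ne_zero {q : Polynomial ℂ} (hq : q ≠ 0) : Polynomial.aeval xInf q ≠ 0 := by
  intro h0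
  refine hq (Polynomial.ext fun n => ?_)
  have h := congrArg (fun f : LaurentInf => f.coeff (OrderDual.toDual (n : ℤ))) h0
  have hpow : ∀ i : ℕ, xInf ^ i = HahnSeries.single (OrderDual.toDual (i : ℤ)) (1 : ℂ) := by
    intro i
    rw [xInf, HahnSeries.single_pow, one_pow]
    have e : i • OrderDual.toDual (1 : ℤ) = OrderDual.toDual (i : ℤ) :=
      congrArg OrderDual.toDual (nsmul_one i)
    rw [e]
  have hcoeff : ∀ i : ℕ, (HahnSeries.single (OrderDual.toDual (i : ℤ)) (1 : ℂ)).coeff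
      (OrderDual.toDual (n : ℤ)) = if n = i then 1 else 0 := by
    intro i
    rw [HahnSeries.coeff_single]
    by_cases e : n = i
    · rw [if_pos e, if_pos (by rw [e])]
    · rw [if_neg e, if_neg fun h => e (Nat.cast_inj.1 (OrderDual.toDual_inj.1 h))]
  simp only [Polynomial.aeval_eq_sum_range, hpow, HahnSeries.coeff_sum, HahnSeries.coeff_smul,
    hcoeff, HahnSeries.coeff_zero] at h
  rw [Polynomial.coeff_zero]
  by_contra hn
  have hle : n ≤ q.natDegree := Polynomial.le_natDegree_of_ne_zero hn
  rw [Finset.sum_eq_single n] at h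
  · simp at h; exact hn h
  · intro i _ hi
    simp [Ne.symm hi]
  · intro hm
    exact absurd (Finset.mem_range.2 (Nat.lt_succ_of_le hle)) hm

/-- With p = (x₁-x₂)ˡ h, the value is x₀ˡ h(x+x₀,x), and the second factor has constant term h(x,x)
≠ 0 in x₀. -/
theorem shiftPoly_ne_zero {p : MvPolynomial (Fin 2) ℂ} (hp : p ≠ 0) : shiftPoly p ≠ 0 := by
  obtain ⟨l, h, rfl, hd⟩ := exists_eq_X_sub_X_pow_mul hp
  -- The same evaluation with values in power series in x₀, where a constant term is available.
  let g : MvPolynomial (Fin 2) ℂ →+* PowerSeries LaurentInf :=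
    MvPolynomial.eval₂Hom ((PowerSeries.C : LaurentInf →+* _).comp HahnSeries.C)
      ![PowerSeries.C xInf + PowerSeries.X, PowerSeries.C xInf]
  have hg : ∀ p, shiftPoly p = HahnSeries.ofPowerSeries ℤ LaurentInf (g p) := by
    intro p
    induction p using MvPolynomial.induction_on with
    | C c => rw [shiftPoly_C]; simp [g]
    | add p q hp hq => rw [shiftPoly_add, map_add, map_add, hp, hq]
    | mul_X p i hp =>
      rw [shiftPoly_mul, map_mul, map_mul, hp]
      congr 1
      fin_cases i
      · simp [g]
      · simp [g]
  have hc : ∀ p, PowerSeries.constantCoeff (g p) = Polynomial.aeval xInf (diag p) := by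
    intro p
    induction p using MvPolynomial.induction_on with
    | C c =>
      rw [← MvPolynomial.algebraMap_eq, AlgHom.commutes, AlgHom.commutes,
        MvPolynomial.algebraMap_eq]
      simp [g]
      rfl
    | add p q hp hq => simp only [map_add, hp, hq]
    | mul_X p i hp =>
      simp only [map_mul, hp]
      congr 1
      fin_cases i <;> simp [g]
  rw [hg, Ne, map_eq_zero_iff _ HahnSeries.ofPowerSeries_injective, map_mul, map_pow, map_sub]
  refine mul_ne_zero (pow_ne_zero _ ?_) fun h0 => aeval_xInf_ne_zero hd ?_
  · simp [g, PowerSeries.X_ne_zero]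
  · rw [← hc, h0, map_zero]

section Expansion

variable {W : Type*} [AddCommGroup W] [Module ℂ W]

/-! ### The expansion of `H(x + x₀, x)` -/

/-- `Z` is the expansion of `H(x + x₀, x)` in `𝓔ᵒ(W)((x₀))`, where `H(x₁,x₂)` becomes truncated
after multiplication by a nonzero polynomial. -/
def IsExpansion (H : FormalSeries 2 (Module.End ℂ W)) (Z : FieldInfLaurent W) : Prop :=
  ∃ p : MvPolynomial (Fin 2) ℂ, p ≠ 0 ∧ ∃ h : IsTruncated (polyMul p H),
    shiftPoly p • Z = substAdd (polyMul p H) h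

theorem substAdd_mul_eq {p q : MvPolynomial (Fin 2) ℂ} {H : FormalSeries 2 (Module.End ℂ W)}
    (h : IsTruncated (polyMul p H)) (h' : IsTruncated (polyMul (q * p) H)) :
    substAdd (polyMul (q * p) H) h' = shiftPoly q • substAdd (polyMul p H) h := by
  rw [← substAdd_polyMul]
  exact substAdd_congr (polyMul_mul q p H) _ _

/-- If p witnesses the expansion, both sides become the substitution in pqH after multiplication by
p(x+x₀,x), which is nonzero in a field and cancels. Hence the defining relation holds for every
polynomial that truncates H. -/
theorem IsExpansion.eq_substAdd {H : FormalSeries 2 (Module.End ℂ W)} {Z : FieldInfLaurent W}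
    (hZ : IsExpansion H Z) (q : MvPolynomial (Fin 2) ℂ) (h : IsTruncated (polyMul q H)) :
    shiftPoly q • Z = substAdd (polyMul q H) h := by
  obtain ⟨p, hp, hpt, hpZ⟩ := hZ
  refine smul_cancel_laurent (shiftPoly_ne_zero hp) ?_
  have hqp : IsTruncated (polyMul (q * p) H) := hpt.of_dvd (dvd_mul_left _ _)
  have hpq : IsTruncated (polyMul (p * q) H) := h.of_dvd (dvd_mul_left _ _)
  rw [← mul_smul_laurent, ← shiftPoly_mul, mul_comm, shiftPoly_mul, mul_smul_laurent, hpZ,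
    ← substAdd_mul_eq hpt hqp, ← substAdd_mul_eq h hpq]
  exact substAdd_congr (by rw [mul_comm]) _ _

theorem IsExpansion.unique {H : FormalSeries 2 (Module.End ℂ W)} {Z Z' : FieldInfLaurent W}
    (hZ : IsExpansion H Z) (hZ' : IsExpansion H Z') : Z = Z' := by
  obtain ⟨p, hp, hpt, hpZ⟩ := hZ
  exact smul_cancel_laurent (shiftPoly_ne_zero hp) (hpZ.trans (hZ'.eq_substAdd p hpt).symm)

theorem IsTruncated.isExpansion {H : FormalSeries 2 (Module.End ℂ W)} (h : IsTruncated H) :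
    IsExpansion H (substAdd H h) :=
  ⟨1, one_ne_zero, by rwa [polyMul_one], by
    rw [shiftPoly_one, one_smul_laurent]; exact substAdd_congr (polyMul_one H).symm _ _⟩

theorem IsExpansion.add {H H' : FormalSeries 2 (Module.End ℂ W)} {Z Z' : FieldInfLaurent W}
    (hZ : IsExpansion H Z) (hZ' : IsExpansion H' Z') : IsExpansion (H + H') (Z + Z') := by
  obtain ⟨p, hp, hpt, -⟩ := id hZ
  obtain ⟨q, hq, hqt, -⟩ := id hZ'
  have h1 : IsTruncated (polyMul (p * q) H) := hpt.of_dvd (dvd_mul_right _ _)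
  have h2 : IsTruncated (polyMul (p * q) H') := hqt.of_dvd (dvd_mul_left _ _)
  refine ⟨p * q, mul_ne_zero hp hq, by rw [polyMul_add]; exact h1.add h2, ?_⟩
  rw [smul_add_laurent, hZ.eq_substAdd _ h1, hZ'.eq_substAdd _ h2, ← substAdd_add]
  exact substAdd_congr (polyMul_add _ _ _).symm _ _

theorem IsExpansion.polyMul {H : FormalSeries 2 (Module.End ℂ W)} {Z : FieldInfLaurent W}
    (hZ : IsExpansion H Z) (q : MvPolynomial (Fin 2) ℂ) :
    IsExpansion (polyMul q H) (shiftPoly q • Z) := by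
  obtain ⟨p, hp, hpt, hpZ⟩ := hZ
  refine ⟨p, hp, by rw [polyMul_comm]; exact hpt.polyMul q, ?_⟩
  rw [← mul_smul_laurent, mul_comm (shiftPoly p), mul_smul_laurent, hpZ, ← substAdd_polyMul]
  exact substAdd_congr (polyMul_comm _ _ _) _ _

theorem IsExpansion.smul {H : FormalSeries 2 (Module.End ℂ W)} {Z : FieldInfLaurent W}
    (hZ : IsExpansion H Z) (c : ℂ) : IsExpansion (c • H) (shiftPoly (C c) • Z) := by
  rw [← polyMul_C]
  exact hZ.polyMul (C c)

theorem isExpansion_zero : IsExpansion (0 : FormalSeries 2 (Module.End ℂ W)) 0 := by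
  have := (IsTruncated.zero (W := W) (r := 2)).isExpansion
  rwa [substAdd_zero] at this

theorem IsExpansion.sub {H H' : FormalSeries 2 (Module.End ℂ W)} {Z Z' : FieldInfLaurent W}
    (hZ : IsExpansion H Z) (hZ' : IsExpansion H' Z') : IsExpansion (H - H') (Z - Z') := by
  have h := hZ'.smul (-1)
  have e : shiftPoly (C (-1)) • Z' = -Z' := by
    refine fcoeff_ext fun k => field_ext fun n => ?_
    rw [shiftPoly_C, fcoeff_C_smul, coeffAt_C_smul, neg_one_smul]
    rfl
  rw [e, neg_one_smul] at h
  rw [sub_eq_add_neg, sub_eq_add_neg]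
  exact hZ.add h

/-- `a(x₁) b(x₂)` becomes truncated after multiplication by a nonzero polynomial. -/
def CompatiblePair (a b : FieldInf W) : Prop :=
  ∃ p : MvPolynomial (Fin 2) ℂ, p ≠ 0 ∧ IsTruncated (polyMul p (pairProd a b))

/-- For compatible pairs this replaces the definition of `fieldY` by its characterisation; with
`IsExpansion.unique`, the chosen polynomial plays no further role. -/
theorem CompatiblePair.isExpansion {a b : FieldInf W} (h : CompatiblePair a b) :
    IsExpansion (pairProd a b) (fieldY a b) := by
  have h' : ∃ p : MvPolynomial (Fin 2) ℂ, p ≠ 0 ∧ IsTruncated (VertexAtInfinity.polyMul p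
    (pairProd a b)) := h
  rw [fieldY, dif_pos h']
  exact ⟨h'.choose, h'.choose_spec.1, h'.choose_spec.2,
    smul_inv_laurent (shiftPoly_ne_zero h'.choose_spec.1) _⟩

/-- The coefficient of `x₀ᵏ` in `Y(a(x), x₀) b(x)`. -/
noncomputable def fieldCoeff (a b : FieldInf W) (k : ℤ) : FieldInf W := fcoeff (fieldY a b) k

theorem fieldMode_eq (a b : FieldInf W) (n : ℤ) : fieldMode a n b = fieldCoeff a b (-n - 1) := rfl

end Expansion

/-! ### Series in two and three variables in coordinates -/

section Vectors

theorem vec3_eta (n : Fin 3 → ℤ) : ![n 0, n 1, n 2] = n := by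
  funext i; fin_cases i <;> rfl

theorem vec2_eta (n : Fin 2 → ℤ) : ![n 0, n 1] = n := by
  funext i; fin_cases i <;> rfl

theorem series3_ext {M : Type*} {A B : FormalSeries 3 M}
    (h : ∀ a b c, A ![a, b, c] = B ![a, b, c]) : A = B := by
  funext n
  rw [← vec3_eta n, h]

theorem series2_ext {M : Type*} {A B : FormalSeries 2 M} (h : ∀ a b, A ![a, b] = B ![a, b]) :
    A = B := by
  funext n
  rw [← vec2_eta n, h]

variable {M : Type*} [AddCommGroup M] [Module ℂ M]

theorem polyMul_X_zero_vec3 (A : FormalSeries 3 M) (a b c : ℤ) :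
    polyMul (X 0) A ![a, b, c] = A ![a - 1, b, c] := by
  rw [polyMul_X]; congr 1; funext i; fin_cases i <;> simp

theorem polyMul_X_one_vec3 (A : FormalSeries 3 M) (a b c : ℤ) :
    polyMul (X 1) A ![a, b, c] = A ![a, b - 1, c] := by
  rw [polyMul_X]; congr 1; funext i; fin_cases i <;> simp

theorem polyMul_X_two_vec3 (A : FormalSeries 3 M) (a b c : ℤ) :
    polyMul (X 2) A ![a, b, c] = A ![a, b, c - 1] := by
  rw [polyMul_X]; congr 1; funext i; fin_cases i <;> simp

theorem polyMul_X_zero_vec2 (A : FormalSeries 2 M) (a b : ℤ) :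
    polyMul (X 0) A ![a, b] = A ![a - 1, b] := by
  rw [polyMul_X]; congr 1; funext i; fin_cases i <;> simp

theorem polyMul_X_one_vec2 (A : FormalSeries 2 M) (a b : ℤ) :
    polyMul (X 1) A ![a, b] = A ![a, b - 1] := by
  rw [polyMul_X]; congr 1; funext i; fin_cases i <;> simp

end Vectors

/-- Polynomials in two of the variables act on the corresponding factor of a product. -/
theorem polyMul_sandwich {r : ℕ} {E : Type*} [Ring E] [Algebra ℂ E] {i j : Fin r} (hij : i ≠ j)
    (L R : FormalSeries r E)
    (hL : ∀ n n', (∀ k, k ≠ i → k ≠ j → n k = n' k) → L n = L n')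
    (hR : ∀ n n', (∀ k, k ≠ i → k ≠ j → n k = n' k) → R n = R n')
    (p : MvPolynomial (Fin 2) ℂ) (A : FormalSeries 2 E) :
    polyMul (MvPolynomial.aeval ![X i, X j] p)
        (fun n => L n * A ![n i, n j] * R n : FormalSeries r E) =
      fun n => L n * polyMul p A ![n i, n j] * R n := by
  refine (polyMul_intertwine
    { toFun := fun A => (fun n => L n * A ![n i, n j] * R n : FormalSeries r E)
      map_add' := fun A B => by funext n; simp [mul_add, add_mul]
      map_smul' := fun c A => by funext n; simp } ![X i, X j] (fun k A => ?_) p A).symm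
  fin_cases k
  · funext n
    simp only [LinearMap.coe_mk, AddHom.coe_mk, Fin.zero_eta, Matrix.cons_val_zero]
    rw [polyMul_X_zero_vec2, polyMul_X]
    simp only [Pi.sub_apply, Pi.single_eq_same, Pi.single_eq_of_ne hij.symm, sub_zero]
    rw [hL n (n - Pi.single i 1) fun k hk _ => by simp [hk],
      hR n (n - Pi.single i 1) fun k hk _ => by simp [hk]]
  · funext n
    simp only [LinearMap.coe_mk, AddHom.coe_mk, Fin.mk_one, Matrix.cons_val_one, Matrix.cons_val_fin_one]
    rw [polyMul_X_one_vec2, polyMul_X]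
    simp only [Pi.sub_apply, Pi.single_eq_same, Pi.single_eq_of_ne hij, sub_zero]
    rw [hL n (n - Pi.single j 1) fun k _ hk => by simp [hk],
      hR n (n - Pi.single j 1) fun k _ hk => by simp [hk]]

section Family

variable {W : Type*} [AddCommGroup W] [Module ℂ W]

/-! ### Composition with fixed operators -/

/-- `L a(x) R`. -/
noncomputable def sandwichField (L R : Module.End ℂ W) (a : FieldInf W) : FieldInf W :=
  mkField (fun n => L * coeffAt a n * R) fun w => by
    obtain ⟨N, hN⟩ := coeffAt_bounded a (R w)
    exact ⟨N, fun n hn => by simp [hN n hn]⟩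

theorem coeffAt_sandwichField (L R : Module.End ℂ W) (a : FieldInf W) (n : ℤ) :
    coeffAt (sandwichField L R a) n = L * coeffAt a n * R := rfl

/-- `L Z(x, x₀) R`. -/
noncomputable def sandwichLaurent (L R : Module.End ℂ W) (Z : FieldInfLaurent W) :
    FieldInfLaurent W :=
  mkLaurent (fun k => sandwichField L R (fcoeff Z k)) <| by
    obtain ⟨N, hN⟩ := fcoeff_bounded Z
    exact ⟨N, fun n hn => field_ext fun k => by simp [hN n hn, coeffAt_sandwichField]⟩

theorem fcoeff_sandwichLaurent (L R : Module.End ℂ W) (Z : FieldInfLaurent W) (k : ℤ) :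
    fcoeff (sandwichLaurent L R Z) k = sandwichField L R (fcoeff Z k) := rfl

/-- The operators L and R involve neither x nor x₀, so they commute with multiplication by both. -/
theorem shiftPoly_smul_sandwichLaurent (L R : Module.End ℂ W) (p : MvPolynomial (Fin 2) ℂ)
    (Z : FieldInfLaurent W) :
    shiftPoly p • sandwichLaurent L R Z = sandwichLaurent L R (shiftPoly p • Z) := by
  induction p using MvPolynomial.induction_on generalizing Z with
  | C c =>
    refine fcoeff_ext fun k => field_ext fun n => ?_
    rw [shiftPoly_C, fcoeff_sandwichLaurent, fcoeff_C_smul, fcoeff_C_smul, coeffAt_C_smul,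
      fcoeff_sandwichLaurent, coeffAt_sandwichField, coeffAt_sandwichField, coeffAt_C_smul]
    simp
  | add p q hp hq =>
    rw [shiftPoly_add, add_smul_laurent, add_smul_laurent, hp, hq]
    refine fcoeff_ext fun k => field_ext fun n => ?_
    simp only [fcoeff_sandwichLaurent, fcoeff_add, coeffAt_add, coeffAt_sandwichField, mul_add,
      add_mul]
  | mul_X p i hp =>
    rw [shiftPoly_mul, mul_smul_laurent, mul_smul_laurent, ← hp]
    congr 1
    refine fcoeff_ext fun k => field_ext fun n => ?_
    fin_cases i
    · simp only [Fin.zero_eta, shiftPoly_X_zero, add_smul_laurent, fcoeff_add, fcoeff_C_smul,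
        fcoeff_single_smul, coeffAt_add, fcoeff_sandwichLaurent, coeffAt_xInf_smul,
        coeffAt_sandwichField, mul_add, add_mul]
    · simp only [Fin.mk_one, shiftPoly_X_one, fcoeff_C_smul, fcoeff_sandwichLaurent,
        coeffAt_xInf_smul, coeffAt_sandwichField]

theorem IsTruncated.sandwich {r : ℕ} {A : FormalSeries r (Module.End ℂ W)} (hA : IsTruncated A)
    (L R : Module.End ℂ W) : IsTruncated (fun n => L * A n * R : FormalSeries r _) := fun w => by
  obtain ⟨N, hN⟩ := hA (R w)
  exact ⟨N, fun n hn => by simp [hN n hn]⟩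

theorem substAdd_sandwich {A : FormalSeries 2 (Module.End ℂ W)} (hA : IsTruncated A)
    (L R : Module.End ℂ W) :
    substAdd _ (hA.sandwich L R) = sandwichLaurent L R (substAdd A hA) := by
  refine fcoeff_ext fun k => field_ext fun n => LinearMap.ext fun w => ?_
  rw [fcoeff_sandwichLaurent, coeffAt_sandwichField, fcoeff_substAdd, fcoeff_substAdd]
  split_ifs
  · rw [Module.End.mul_apply, Module.End.mul_apply, substField_coeffAt, substField_coeffAt]
    erw [AddMonoidHom.map_finsum (L : W →+ W) (hA.finite_antidiagonal _ _ (R w))]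
    exact finsum_congr fun m => (map_zsmul L _ _).symm
  · simp

theorem IsExpansion.sandwich {H : FormalSeries 2 (Module.End ℂ W)} {Z : FieldInfLaurent W}
    (hZ : IsExpansion H Z) (L R : Module.End ℂ W) :
    IsExpansion (fun n => L * H n * R) (sandwichLaurent L R Z) := by
  obtain ⟨p, hp, hpt, hpZ⟩ := hZ
  have e : VertexAtInfinity.polyMul p (fun n => L * H n * R : FormalSeries 2 (Module.End ℂ W)) =
      fun n => L * VertexAtInfinity.polyMul p H n * R := by
    funext n
    simp [VertexAtInfinity.polyMul, Finset.mul_sum, Finset.sum_mul]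
  refine ⟨p, hp, by rw [e]; exact hpt.sandwich L R, ?_⟩
  rw [shiftPoly_smul_sandwichLaurent, hpZ, ← substAdd_sandwich]
  exact substAdd_congr e.symm _ _

/-! ### Expansions of families -/

/-- The series in the last two variables that multiplies `x₁ᵐ`. -/
def slice (m : ℤ) (H : FormalSeries 3 (Module.End ℂ W)) : FormalSeries 2 (Module.End ℂ W) :=
  fun n => H ![m, n 0, n 1]

/-- The series in three variables with slices `Z m`. -/
noncomputable def flatten (Z : ℤ → FieldInfLaurent W) : FormalSeries 3 (Module.End ℂ W) :=
  fun n => coeffAt (fcoeff (Z (n 0)) (n 1)) (n 2)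

/-- `z(t, x₀, x)` is the expansion of `H(t, x + x₀, x)`. -/
def IsExpansionFam (H z : FormalSeries 3 (Module.End ℂ W)) : Prop :=
  ∃ Z : ℤ → FieldInfLaurent W, (∀ m, IsExpansion (slice m H) (Z m)) ∧ z = flatten Z

theorem IsExpansionFam.unique {H z z' : FormalSeries 3 (Module.End ℂ W)}
    (h : IsExpansionFam H z) (h' : IsExpansionFam H z') : z = z' := by
  obtain ⟨Z, hZ, rfl⟩ := h
  obtain ⟨Z', hZ', rfl⟩ := h'
  exact congrArg flatten (funext fun m => (hZ m).unique (hZ' m))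

theorem IsExpansionFam.add {H H' z z' : FormalSeries 3 (Module.End ℂ W)}
    (h : IsExpansionFam H z) (h' : IsExpansionFam H' z') : IsExpansionFam (H + H') (z + z') := by
  obtain ⟨Z, hZ, rfl⟩ := h
  obtain ⟨Z', hZ', rfl⟩ := h'
  exact ⟨fun m => Z m + Z' m, fun m => (hZ m).add (hZ' m), funext fun n => (coeffAt_add _ _ _).symm⟩

theorem IsExpansionFam.sub {H H' z z' : FormalSeries 3 (Module.End ℂ W)}
    (h : IsExpansionFam H z) (h' : IsExpansionFam H' z') : IsExpansionFam (H - H') (z - z') := by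
  obtain ⟨Z, hZ, rfl⟩ := h
  obtain ⟨Z', hZ', rfl⟩ := h'
  exact ⟨fun m => Z m - Z' m, fun m => (hZ m).sub (hZ' m), funext fun n => (coeffAt_sub _ _ _).symm⟩

theorem isExpansionFam_zero :
    IsExpansionFam (0 : FormalSeries 3 (Module.End ℂ W)) 0 :=
  ⟨fun _ => 0, fun _ => isExpansion_zero, funext fun n => by simp [flatten]⟩

/-- The parameter t merely relabels slices, while x₁ and x₂ act on the expansion as x₀+x and x. -/
theorem IsExpansionFam.polyMul {H z : FormalSeries 3 (Module.End ℂ W)}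
    (h : IsExpansionFam H z) (p : MvPolynomial (Fin 3) ℂ) :
    IsExpansionFam (polyMul p H)
      (polyMul (MvPolynomial.aeval ![X 0, X 1 + X 2, X 2] p) z) := by
  refine polyMul_rel (R := IsExpansionFam) (fun A B A' B' h h' => h.add h') ?_ _ ?_ p h
  · rintro c A B ⟨Z, hZ, rfl⟩
    refine ⟨fun m => shiftPoly (C c) • Z m, fun m => (hZ m).smul c, funext fun n => ?_⟩
    rw [flatten, shiftPoly_C, fcoeff_C_smul, coeffAt_C_smul]
    rfl
  · rintro i A B ⟨Z, hZ, rfl⟩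
    fin_cases i
    · refine ⟨fun m => Z (m - 1), fun m => ?_, series3_ext fun a b c => ?_⟩
      · have : slice m (VertexAtInfinity.polyMul (X 0) A) = slice (m - 1) A :=
          funext fun n => polyMul_X_zero_vec3 A _ _ _
        rw [Fin.zero_eta, this]
        exact hZ _
      · exact polyMul_X_zero_vec3 _ _ _ _
    · refine ⟨fun m => shiftPoly (X 0) • Z m, fun m => ?_, series3_ext fun a b c => ?_⟩
      · have : slice m (VertexAtInfinity.polyMul (X 1) A) =
            VertexAtInfinity.polyMul (X 0) (slice m A) := series2_ext fun a b =>
          (polyMul_X_one_vec3 A _ _ _).trans (polyMul_X_zero_vec2 (slice m A) _ _).symm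
        rw [Fin.mk_one, this]
        exact (hZ m).polyMul (X 0)
      · change VertexAtInfinity.polyMul (X 1 + X 2) (flatten Z) ![a, b, c] = _
        rw [polyMul_add_left, Pi.add_apply, polyMul_X_one_vec3, polyMul_X_two_vec3]
        change _ = coeffAt (fcoeff (shiftPoly (X 0) • Z a) b) c
        rw [shiftPoly_X_zero, add_smul_laurent, fcoeff_add, fcoeff_C_smul, fcoeff_single_smul,
          coeffAt_add, coeffAt_xInf_smul, add_comm]
        rfl
    · refine ⟨fun m => shiftPoly (X 1) • Z m, fun m => ?_, series3_ext fun a b c => ?_⟩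
      · have : slice m (VertexAtInfinity.polyMul (X 2) A) =
            VertexAtInfinity.polyMul (X 1) (slice m A) := series2_ext fun a b =>
          (polyMul_X_two_vec3 A _ _ _).trans (polyMul_X_one_vec2 (slice m A) _ _).symm
        change IsExpansion (slice m (VertexAtInfinity.polyMul (X 2) A)) _
        rw [this]
        exact (hZ m).polyMul (X 1)
      · change VertexAtInfinity.polyMul (X 2) (flatten Z) ![a, b, c] = _
        rw [polyMul_X_two_vec3]
        change _ = coeffAt (fcoeff (shiftPoly (X 1) • Z a) b) c
        rw [shiftPoly_X_one, fcoeff_C_smul, coeffAt_xInf_smul]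
        rfl

/-- A family of products `Lₘ a(x + x₀) b(x) Rₘ`. -/
theorem CompatiblePair.isExpansionFam {a b : FieldInf W} (h : CompatiblePair a b)
    (L R : ℤ → Module.End ℂ W) :
    IsExpansionFam (fun n => L (n 0) * (coeffAt a (n 1) * coeffAt b (n 2)) * R (n 0))
      (fun n => L (n 0) * coeffAt (fieldCoeff a b (n 1)) (n 2) * R (n 0)) :=
  ⟨fun m => sandwichLaurent (L m) (R m) (fieldY a b), fun m => h.isExpansion.sandwich (L m) (R m),
    rfl⟩

/-! ### Locality of the modes -/

/-- Congruent arguments modulo d give congruent values. It is applied to p(x,t) and p(x+x₀,t), with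
d = x₀. -/
theorem dvd_aeval_sub_aeval {r : ℕ} {A : Type*} [CommRing A] [Algebra ℂ A] {d : A}
    {φ ψ : Fin r → A} (h : ∀ i, d ∣ φ i - ψ i) (p : MvPolynomial (Fin r) ℂ) :
    d ∣ MvPolynomial.aeval φ p - MvPolynomial.aeval ψ p := by
  induction p using MvPolynomial.induction_on with
  | C c =>
    rw [← MvPolynomial.algebraMap_eq, AlgHom.commutes, AlgHom.commutes, sub_self]
    exact dvd_zero _
  | add p q hp hq =>
    rw [map_add, map_add, add_sub_add_comm]
    exact dvd_add hp hq
  | mul_X p i hp =>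
    rw [map_mul, map_mul, MvPolynomial.aeval_X, MvPolynomial.aeval_X]
    have : MvPolynomial.aeval φ p * φ i - MvPolynomial.aeval ψ p * ψ i =
        (MvPolynomial.aeval φ p - MvPolynomial.aeval ψ p) * φ i +
          MvPolynomial.aeval ψ p * (φ i - ψ i) := by ring
    rw [this]
    exact dvd_add (hp.mul_right _) (Dvd.dvd.mul_left (h i) _)

theorem polyMul_eq_zero_of_lt {r : ℕ} {M : Type*} [AddCommGroup M] [Module ℂ M] (i : Fin r) {k : ℤ}
    (p : MvPolynomial (Fin r) ℂ) {D : FormalSeries r M} (hD : ∀ n, n i < k → D n = 0) :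
    ∀ n, n i < k → polyMul p D n = 0 := by
  refine polyMul_rel (R := fun A (_ : FormalSeries r M) => ∀ n, n i < k → A n = 0)
    (fun A _ A' _ h h' n hn => by simp [h n hn, h' n hn]) (fun c A _ h n hn => by simp [h n hn]) X
    (fun j A _ h n hn => ?_) p (B := 0) hD
  rw [polyMul_X]
  refine h _ ?_
  by_cases hj : i = j
  · subst hj; simp; omega
  · simpa [hj] using hn

/-- If the commutators of `a(x)` and `b(x)` with `c(x)` are annihilated by `p` and `q`, then that of
`a(x)ⱼ b(x)` is annihilated by `pᴺ q`. -/
theorem exists_pow_mul_locality {a b c : FieldInf W} (hab : CompatiblePair a b)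
    {p q : MvPolynomial (Fin 2) ℂ} (hp : polyMul p (pairProd a c) = polyMul p (pairProdSwap a c))
    (hq : polyMul q (pairProd b c) = polyMul q (pairProdSwap b c)) (j : ℤ) :
    ∃ N : ℕ, polyMul (p ^ N * q) (pairProd (fieldCoeff a b j) c) =
      polyMul (p ^ N * q) (pairProdSwap (fieldCoeff a b j) c) := by
  -- The variables are t, x₁, x₂ before the expansion and t, x₀, x after it, where t belongs to c.
  -- `D` is the commutator of Y(a,x₀)b with c(t).
  have h1 := hab.isExpansionFam (fun _ => 1) (coeffAt c)
  have h2 := hab.isExpansionFam (coeffAt c) (fun _ => 1)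
  simp only [one_mul, mul_one] at h1 h2
  set H1 : FormalSeries 3 (Module.End ℂ W) :=
    fun n => coeffAt a (n 1) * coeffAt b (n 2) * coeffAt c (n 0)
  set H2 : FormalSeries 3 (Module.End ℂ W) :=
    fun n => coeffAt c (n 0) * (coeffAt a (n 1) * coeffAt b (n 2))
  set D : FormalSeries 3 (Module.End ℂ W) := fun n =>
    coeffAt (fieldCoeff a b (n 1)) (n 2) * coeffAt c (n 0) -
      coeffAt c (n 0) * coeffAt (fieldCoeff a b (n 1)) (n 2) with hD
  let P3 : MvPolynomial (Fin 3) ℂ := MvPolynomial.aeval ![X 1, X 0] p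
  let Q3 : MvPolynomial (Fin 3) ℂ := MvPolynomial.aeval ![X 2, X 0] q
  let H' : FormalSeries 3 (Module.End ℂ W) :=
    fun n => coeffAt a (n 1) * coeffAt c (n 0) * coeffAt b (n 2)
  -- The factor q(x₂,t) moves c past b; then p(x₁,t) moves it past a.
  have e1 : polyMul Q3 H1 = polyMul Q3 H' := by
    have s := polyMul_sandwich (i := (2 : Fin 3)) (j := 0) (by decide) (fun n => coeffAt a (n 1))
      (fun _ => 1) (fun n n' h => by rw [h 1 (by decide) (by decide)]) (fun _ _ _ => rfl) q
    have s1 := s (pairProd b c)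
    have s2 := s (pairProdSwap b c)
    rw [hq, ← s2] at s1
    simp only [pairProd, pairProdSwap, ← mul_assoc, mul_one, Matrix.cons_val_zero,
      Matrix.cons_val_one, Matrix.cons_val_fin_one] at s1
    simpa only [H1, H2, H', ← mul_assoc] using s1
  have e2 : polyMul P3 H' = polyMul P3 H2 := by
    have s := polyMul_sandwich (i := (1 : Fin 3)) (j := 0) (by decide) (fun _ => 1)
      (fun n => coeffAt b (n 2)) (fun _ _ _ => rfl)
      (fun n n' h => by rw [h 2 (by decide) (by decide)]) p
    have s1 := s (pairProd a c)
    have s2 := s (pairProdSwap a c)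
    rw [hp, ← s2] at s1
    simp only [pairProd, pairProdSwap, ← mul_assoc, one_mul, Matrix.cons_val_zero,
      Matrix.cons_val_one, Matrix.cons_val_fin_one] at s1
    simpa only [H1, H2, H', ← mul_assoc] using s1
  have e3 : polyMul (P3 * Q3) (H1 - H2) = 0 := by
    rw [polyMul_sub, polyMul_mul, e1, polyMul_comm, e2, polyMul_comm, ← polyMul_mul, sub_self]
  have h3 := (h1.sub h2).polyMul (P3 * Q3)
  rw [e3] at h3
  have h4 := h3.unique isExpansionFam_zero
  let P' : MvPolynomial (Fin 3) ℂ := MvPolynomial.aeval ![X 1 + X 2, X 0] p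
  let P : MvPolynomial (Fin 3) ℂ := MvPolynomial.aeval ![X 2, X 0] p
  have comp : ∀ (φ : Fin 3 → MvPolynomial (Fin 3) ℂ) (i j : Fin 3) (p : MvPolynomial (Fin 2) ℂ),
      MvPolynomial.aeval φ (MvPolynomial.aeval ![X i, X j] p : MvPolynomial (Fin 3) ℂ) =
        MvPolynomial.aeval ![φ i, φ j] p := fun φ i j p =>
    AlgHom.congr_fun (φ₁ := (MvPolynomial.aeval φ).comp (MvPolynomial.aeval ![X i, X j]))
      (MvPolynomial.algHom_ext fun k => by fin_cases k <;> simp) p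
  -- After the substitution, D is annihilated by p(x+x₀,t) q(x,t). It remains to trade p(x+x₀,t) for
  -- a polynomial free of x₀.
  have h5 : polyMul (P' * Q3) D = 0 := by
    rw [map_mul, comp, comp] at h4
    exact h4
  obtain ⟨k, hk⟩ := fcoeff_bounded (fieldY a b)
  have hDk : ∀ n, n 1 < k → D n = 0 := fun n hn => by
    have : fieldCoeff a b (n 1) = 0 := hk _ hn
    simp [hD, this]
  obtain ⟨g, hg⟩ : (X 1 : MvPolynomial (Fin 3) ℂ) ∣ P - P' := by
    refine dvd_aeval_sub_aeval (fun i => ?_) p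
    fin_cases i <;> simp
  -- Since p(x+x₀,t) kills q D, the polynomial p(x,t) acts there as x₀ g. Each further factor p(x,t)
  -- therefore raises the lower bound on the powers of x₀ by one.
  have main : ∀ N : ℕ, polyMul P' (polyMul (P ^ N * Q3) D) = 0 ∧
      ∀ n, n 1 < k + N → polyMul (P ^ N * Q3) D n = 0 := by
    intro N
    have hz : polyMul P' (polyMul (P ^ N * Q3) D) = 0 := by
      rw [← polyMul_mul, show P' * (P ^ N * Q3) = P ^ N * (P' * Q3) by ring, polyMul_mul, h5,
        polyMul_zero]
    refine ⟨hz, ?_⟩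
    induction N with
    | zero => simpa using polyMul_eq_zero_of_lt 1 Q3 hDk
    | succ N ih =>
      have hz' : polyMul P' (polyMul (P ^ N * Q3) D) = 0 := by
        rw [← polyMul_mul, show P' * (P ^ N * Q3) = P ^ N * (P' * Q3) by ring, polyMul_mul, h5,
          polyMul_zero]
      have e : polyMul (P ^ (N + 1) * Q3) D = polyMul (X 1) (polyMul g (polyMul (P ^ N * Q3) D)) := by
        rw [← polyMul_mul (X 1), ← hg, polyMul_sub_left, hz', sub_zero, ← polyMul_mul]
        congr 1
        ring
      intro n hn
      rw [e, polyMul_X]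
      refine polyMul_eq_zero_of_lt 1 g (ih hz') _ ?_
      push_cast at hn
      simp
      omega
  -- Enough factors to push the lower bound k + N beyond x₀ʲ.
  obtain ⟨N, hN⟩ : ∃ N : ℕ, j < k + N := ⟨(j - k + 1).toNat, by omega⟩
  refine ⟨N, ?_⟩
  have hs : ∀ r : MvPolynomial (Fin 2) ℂ, ∀ n : Fin 2 → ℤ,
      polyMul r (pairProd (fieldCoeff a b j) c - pairProdSwap (fieldCoeff a b j) c) n =
        polyMul (MvPolynomial.aeval ![X 2, X 0] r : MvPolynomial (Fin 3) ℂ) D ![n 1, j, n 0] := by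
    intro r
    refine polyMul_rel (R := fun (A : FormalSeries 2 (Module.End ℂ W))
      (B : FormalSeries 3 (Module.End ℂ W)) => ∀ n, A n = B ![n 1, j, n 0])
      (fun _ _ _ _ h h' n => by simp [h, h']) (fun c _ _ h n => by simp [h]) _ (fun i A B h n => ?_)
      r fun n => ?_
    · rw [← vec2_eta n]
      fin_cases i
      · exact ((polyMul_X_zero_vec2 _ _ _).trans (h _)).trans (polyMul_X_two_vec3 _ _ _ _).symm
      · exact ((polyMul_X_one_vec2 _ _ _).trans (h _)).trans (polyMul_X_zero_vec3 _ _ _ _).symm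
    · rfl
  rw [← sub_eq_zero, ← polyMul_sub]
  funext n
  rw [hs, map_mul, map_pow]
  exact (main N).2 _ hN

end Family

section Locality

variable {W : Type*} [AddCommGroup W] [Module ℂ W]

/-! ### Quasi-compatibility of mutually quasi-local sequences -/

theorem aeval_vec2_X {r : ℕ} (i j : Fin r) (p : MvPolynomial (Fin 2) ℂ) :
    (MvPolynomial.aeval ![X i, X j] p : MvPolynomial (Fin r) ℂ) =
      MvPolynomial.rename ![i, j] p := by
  rw [← aeval_X_comp]
  congr 2
  funext k
  fin_cases k <;> rfl

theorem aeval_vec2_X_self (p : MvPolynomial (Fin 2) ℂ) :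
    (MvPolynomial.aeval ![X 0, X 1] p : MvPolynomial (Fin 2) ℂ) = p := by
  conv_rhs => rw [← MvPolynomial.aeval_X_left_apply p]
  congr 2
  funext k
  fin_cases k <;> rfl

/-- The product of the `aᵢ(xᵢ)` in the order of the list `l`. -/
noncomputable def listProd {r : ℕ} (a : Fin r → FieldInf W) (l : List (Fin r)) :
    FormalSeries r (Module.End ℂ W) :=
  fun n => (l.map fun i => coeffAt (a i) (n i)).prod

theorem listProd_congr {r : ℕ} (a : Fin r → FieldInf W) {l : List (Fin r)} {n n' : Fin r → ℤ}
    (h : ∀ i ∈ l, n i = n' i) : listProd a l n = listProd a l n' := by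
  rw [listProd, listProd, List.map_congr_left fun i hi => by rw [h i hi]]

theorem seqProd_eq_listProd {r : ℕ} (a : Fin r → FieldInf W) :
    seqProd a = listProd a (List.finRange r) := by
  funext n
  rw [seqProd, listProd, List.ofFn_eq_map]

/-- Each step is an adjacent transposition, permitted because p(xₖ,xⱼ) divides P. The list has no
repetitions, so the factors around the transposed pair involve neither xₖ nor xⱼ, as
`polyMul_sandwich` requires. No factor of P is used up, since both sides keep it. -/
theorem polyMul_listProd_move {r : ℕ} {a : Fin r → FieldInf W} {P : MvPolynomial (Fin r) ℂ}
    {p : Fin r → Fin r → MvPolynomial (Fin 2) ℂ}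
    (h : ∀ i j, i < j →
      polyMul (p i j) (pairProd (a i) (a j)) = polyMul (p i j) (pairProdSwap (a i) (a j)))
    (hP : ∀ i j, i < j → MvPolynomial.rename ![i, j] (p i j) ∣ P) (k : Fin r) :
    ∀ l₂ l₁ : List (Fin r), (l₁ ++ k :: l₂).Nodup → (∀ j ∈ l₂, k < j) →
      polyMul P (listProd a (l₁ ++ k :: l₂)) = polyMul P (listProd a (l₁ ++ l₂ ++ [k]))
  | [], l₁, _, _ => by simp
  | j :: l₂, l₁, hn, hlt => by
    have hkj : k < j := hlt j (by simp)
    have ih := polyMul_listProd_move h hP k l₂ (l₁ ++ [j])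
      (by rw [List.append_assoc]
          exact (List.Perm.nodup_iff (List.Perm.append_left l₁ (List.Perm.swap j k l₂))).1 hn)
      fun i hi => hlt i (by simp [hi])
    have hne : k ∉ l₁ ∧ j ∉ l₁ ∧ k ∉ l₂ ∧ j ∉ l₂ := by
      simp only [List.nodup_append, List.nodup_cons, List.mem_cons] at hn
      refine ⟨fun hk => hn.2.2 k hk k (by simp) rfl, fun hk => hn.2.2 j hk j (by simp) rfl,
        fun hk => hn.2.1.1 (Or.inr hk), hn.2.1.2.1⟩
    have hL : ∀ n n' : Fin r → ℤ, (∀ i, i ≠ k → i ≠ j → n i = n' i) →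
        listProd a l₁ n = listProd a l₁ n' := fun n n' hnn =>
      listProd_congr a fun i hi => hnn i (fun e => hne.1 (e ▸ hi)) fun e => hne.2.1 (e ▸ hi)
    have hR : ∀ n n' : Fin r → ℤ, (∀ i, i ≠ k → i ≠ j → n i = n' i) →
        listProd a l₂ n = listProd a l₂ n' := fun n n' hnn =>
      listProd_congr a fun i hi => hnn i (fun e => hne.2.2.1 (e ▸ hi)) fun e => hne.2.2.2 (e ▸ hi)
    have s := polyMul_sandwich hkj.ne _ _ hL hR (p k j)
    have s1 := s (pairProd (a k) (a j))
    have s2 := s (pairProdSwap (a k) (a j))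
    rw [h k j hkj, ← s2] at s1
    have e1 : listProd a (l₁ ++ k :: j :: l₂) = fun n =>
        listProd a l₁ n * pairProd (a k) (a j) ![n k, n j] * listProd a l₂ n := by
      funext n
      simp [listProd, pairProd, mul_assoc]
    have e2 : listProd a (l₁ ++ j :: k :: l₂) = fun n =>
        listProd a l₁ n * pairProdSwap (a k) (a j) ![n k, n j] * listProd a l₂ n := by
      funext n
      simp [listProd, pairProdSwap, mul_assoc]
    rw [← e1, ← e2, aeval_vec2_X] at s1
    rw [polyMul_eq_of_dvd (hP k j hkj) s1]
    simpa using ih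

theorem polyMul_bounded {r : ℕ} (i : Fin r) (p : MvPolynomial (Fin r) ℂ)
    {A : FormalSeries r (Module.End ℂ W)} {w : W} (hA : ∃ N : ℤ, ∀ n, N < n i → A n w = 0) :
    ∃ N : ℤ, ∀ n, N < n i → polyMul p A n w = 0 := by
  refine polyMul_rel (R := fun (A _ : FormalSeries r (Module.End ℂ W)) =>
    ∃ N : ℤ, ∀ n, N < n i → A n w = 0) (fun A _ A' _ h h' => ?_) (fun c A _ h => ?_) X
    (fun j A _ h => ?_) p (B := 0) hA
  · obtain ⟨N, hN⟩ := h
    obtain ⟨N', hN'⟩ := h'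
    exact ⟨max N N', fun n hn => by
      rw [Pi.add_apply, LinearMap.add_apply, hN n (lt_of_le_of_lt (le_max_left _ _) hn),
        hN' n (lt_of_le_of_lt (le_max_right _ _) hn), add_zero]⟩
  · obtain ⟨N, hN⟩ := h
    exact ⟨N, fun n hn => by rw [Pi.smul_apply, LinearMap.smul_apply, hN n hn, smul_zero]⟩
  · obtain ⟨N, hN⟩ := h
    refine ⟨N + 1, fun n hn => ?_⟩
    rw [polyMul_X]
    refine hN _ ?_
    by_cases hj : i = j
    · subst hj; simp; omega
    · simp [hj]; omega

/-- To bound the powers of xₖ, move aₖ to the right end, where aₖ(xₖ)w has powers bounded above. The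
factors to be passed all have index greater than k, so the relations for i < j suffice. -/
theorem isTruncated_polyMul_seqProd {r : ℕ} {a : Fin r → FieldInf W} {P : MvPolynomial (Fin r) ℂ}
    {p : Fin r → Fin r → MvPolynomial (Fin 2) ℂ}
    (h : ∀ i j, i < j →
      polyMul (p i j) (pairProd (a i) (a j)) = polyMul (p i j) (pairProdSwap (a i) (a j)))
    (hP : ∀ i j, i < j → MvPolynomial.rename ![i, j] (p i j) ∣ P) :
    IsTruncated (polyMul P (seqProd a)) := by
  intro w
  have hk : ∀ k : Fin r, ∃ N : ℤ, ∀ n, N < n k → polyMul P (seqProd a) n w = 0 := by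
    intro k
    obtain ⟨s, t, hst⟩ := List.append_of_mem (List.mem_finRange k)
    have hnd := List.nodup_finRange r
    have hpw := List.pairwise_lt_finRange r
    rw [hst] at hnd hpw
    rw [seqProd_eq_listProd, hst, polyMul_listProd_move h hP k t s hnd
      (List.pairwise_cons.1 (List.pairwise_append.1 hpw).2.1).1]
    refine polyMul_bounded k P ?_
    obtain ⟨N, hN⟩ := coeffAt_bounded (a k) w
    exact ⟨N, fun n hn => by simp [listProd, hN _ hn]⟩
  choose N hN using hk
  by_cases hr : Nonempty (Fin r)
  · refine ⟨Finset.univ.sup' Finset.univ_nonempty N, fun n ⟨i, hi⟩ => hN i n ?_⟩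
    exact lt_of_le_of_lt (Finset.le_sup' N (Finset.mem_univ i)) hi
  · exact ⟨0, fun n ⟨i, _⟩ => (hr ⟨i⟩).elim⟩

theorem isTruncated_pairProd {a b : FieldInf W} {p : MvPolynomial (Fin 2) ℂ}
    (h : polyMul p (pairProd a b) = polyMul p (pairProdSwap a b)) :
    IsTruncated (polyMul p (pairProd a b)) := by
  have cases : ∀ i j : Fin 2, i < j → i = 0 ∧ j = 1 := by decide
  have := isTruncated_polyMul_seqProd (a := ![a, b]) (P := p) (p := fun _ _ => p)
    (fun i j hij => by
      obtain ⟨rfl, rfl⟩ := cases i j hij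
      exact h)
    (fun i j hij => by
      obtain ⟨rfl, rfl⟩ := cases i j hij
      rw [← aeval_vec2_X, aeval_vec2_X_self])
  convert this using 2
  funext n
  simp [pairProd, seqProd]

/-- The series `a(x₁) b(x₂) c(x₃)`. -/
noncomputable def tripleProd (a b c : FieldInf W) : FormalSeries 3 (Module.End ℂ W) :=
  fun n => coeffAt a (n 0) * coeffAt b (n 1) * coeffAt c (n 2)

theorem isTruncated_tripleProd {a b c : FieldInf W} {p q s : MvPolynomial (Fin 2) ℂ}
    (hp : polyMul p (pairProd a b) = polyMul p (pairProdSwap a b))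
    (hq : polyMul q (pairProd a c) = polyMul q (pairProdSwap a c))
    (hs : polyMul s (pairProd b c) = polyMul s (pairProdSwap b c)) :
    IsTruncated (polyMul (MvPolynomial.aeval ![X 0, X 1] p * MvPolynomial.aeval ![X 0, X 2] q *
      MvPolynomial.aeval ![X 1, X 2] s) (tripleProd a b c)) := by
  have cases : ∀ i j : Fin 3, i < j → (i = 0 ∧ j = 1) ∨ (i = 0 ∧ j = 2) ∨ (i = 1 ∧ j = 2) := by
    decide
  have := isTruncated_polyMul_seqProd (a := ![a, b, c])
    (P := MvPolynomial.aeval ![X 0, X 1] p * MvPolynomial.aeval ![X 0, X 2] q *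
      MvPolynomial.aeval ![X 1, X 2] s) (p := ![![1, p, q], ![1, 1, s], ![1, 1, 1]])
    (fun i j hij => by
      rcases cases i j hij with ⟨rfl, rfl⟩ | ⟨rfl, rfl⟩ | ⟨rfl, rfl⟩
      · exact hp
      · exact hq
      · exact hs)
    (fun i j hij => by
      rcases cases i j hij with ⟨rfl, rfl⟩ | ⟨rfl, rfl⟩ | ⟨rfl, rfl⟩ <;> rw [← aeval_vec2_X]
      · exact Dvd.intro _ (mul_assoc _ _ _).symm
      · exact Dvd.intro_left _ rfl |>.mul_right _
      · exact Dvd.intro_left _ rfl)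
  convert this using 2
  funext n
  simp [tripleProd, seqProd, List.ofFn_succ, mul_assoc]

/-! ### Mutual locality -/

/-- `p(x₁,x₂) a(x₁) c(x₂) = p(x₁,x₂) c(x₂) a(x₁)` for some `p` in `S`. -/
def MutuallyLocal (S : Submonoid (MvPolynomial (Fin 2) ℂ)) (a c : FieldInf W) : Prop :=
  ∃ p ∈ S, polyMul p (pairProd a c) = polyMul p (pairProdSwap a c)

variable {S : Submonoid (MvPolynomial (Fin 2) ℂ)}

/-- Exchange the two variables, which turns p(x₁,x₂) into p(x₂,x₁); hence the stability condition on
S. -/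
theorem MutuallyLocal.symm (hS : ∀ p ∈ S, MvPolynomial.rename ![1, 0] p ∈ S) {a c : FieldInf W}
    (h : MutuallyLocal S a c) : MutuallyLocal S c a := by
  obtain ⟨p, hp, h⟩ := h
  have hinj : Function.Injective (![1, 0] : Fin 2 → Fin 2) := by decide
  refine ⟨_, hS p hp, ?_⟩
  have h1 := polyMul_rename _ hinj p (pairProdSwap a c)
  have h2 := polyMul_rename _ hinj p (pairProd a c)
  rw [h, ← h1] at h2
  exact h2.symm

theorem pairProd_add (a b c : FieldInf W) : pairProd (a + b) c = pairProd a c + pairProd b c := by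
  funext n; simp [pairProd, coeffAt_add, add_mul]

theorem pairProdSwap_add (a b c : FieldInf W) :
    pairProdSwap (a + b) c = pairProdSwap a c + pairProdSwap b c := by
  funext n; simp [pairProdSwap, coeffAt_add, mul_add]

theorem pairProd_smul (t : ℂ) (a c : FieldInf W) : pairProd (t • a) c = t • pairProd a c := by
  funext n; simp [pairProd, coeffAt_smul]

theorem pairProdSwap_smul (t : ℂ) (a c : FieldInf W) :
    pairProdSwap (t • a) c = t • pairProdSwap a c := by
  funext n; simp [pairProdSwap, coeffAt_smul]

theorem mutuallyLocal_zero (c : FieldInf W) : MutuallyLocal S 0 c :=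
  ⟨1, S.one_mem, by congr 1; funext n; simp [pairProd, pairProdSwap]⟩

theorem mutuallyLocal_oneField (c : FieldInf W) : MutuallyLocal S (oneField W) c := by
  refine ⟨1, S.one_mem, congrArg _ (funext fun n => ?_)⟩
  rw [pairProd, pairProdSwap, coeffAt_oneField]
  split_ifs
  · rfl
  · simp

/-- The fields that are mutually local with every member of `T`. -/
def localCommutant (S : Submonoid (MvPolynomial (Fin 2) ℂ)) (T : Set (FieldInf W)) :
    Submodule ℂ (FieldInf W) where
  carrier := {a | ∀ c ∈ T, MutuallyLocal S a c}
  zero_mem' c _ := mutuallyLocal_zero c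
  add_mem' {a b} ha hb c hc := by
    obtain ⟨p, hp, h⟩ := ha c hc
    obtain ⟨q, hq, h'⟩ := hb c hc
    refine ⟨p * q, S.mul_mem hp hq, ?_⟩
    rw [pairProd_add, pairProdSwap_add, polyMul_add, polyMul_add,
      polyMul_eq_of_dvd (dvd_mul_right p q) h, polyMul_eq_of_dvd (dvd_mul_left q p) h']
  smul_mem' t a ha c hc := by
    obtain ⟨p, hp, h⟩ := ha c hc
    exact ⟨p, hp, by rw [pairProd_smul, pairProdSwap_smul, polyMul_smul, polyMul_smul, h]⟩

/-- The polynomial pᴺq stays in S. For an incompatible pair the default value 0 of `fieldY` is local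
with everything, so compatibility need not be known beforehand. -/
theorem fieldMode_mem_localCommutant {T : Set (FieldInf W)} {a b : FieldInf W}
    (ha : a ∈ localCommutant S T) (hb : b ∈ localCommutant S T) (n : ℤ) :
    fieldMode a n b ∈ localCommutant S T := by
  intro c hc
  rw [fieldMode_eq]
  by_cases hab : CompatiblePair a b
  · obtain ⟨p, hp, h⟩ := ha c hc
    obtain ⟨q, hq, h'⟩ := hb c hc
    obtain ⟨N, hN⟩ := exists_pow_mul_locality hab h h' (-n - 1)
    exact ⟨_, S.mul_mem (S.pow_mem hp N) hq, hN⟩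
  · have : fieldCoeff a b (-n - 1) = 0 := by
      have h0 : fieldY a b = 0 := dif_neg hab
      rw [fieldCoeff, h0, fcoeff_zero]
    rw [this]
    exact mutuallyLocal_zero c

/-- The smallest subspace that contains `U` and `1_W` and is closed under the products
`a(x)ₙ b(x)`. -/
noncomputable def modeClosure (U : Set (FieldInf W)) : Submodule ℂ (FieldInf W) :=
  sInf {L | U ⊆ L ∧ oneField W ∈ L ∧ ∀ a ∈ L, ∀ b ∈ L, ∀ n, fieldMode a n b ∈ L}

theorem modeClosure_le {U : Set (FieldInf W)} {L : Submodule ℂ (FieldInf W)}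
    (hU : U ⊆ L) (h1 : oneField W ∈ L) (hL : ∀ a ∈ L, ∀ b ∈ L, ∀ n, fieldMode a n b ∈ L) :
    modeClosure U ≤ L := sInf_le ⟨hU, h1, hL⟩

theorem subset_modeClosure (U : Set (FieldInf W)) : U ⊆ modeClosure U := fun _ ha =>
  Submodule.mem_sInf.2 fun _ hL => hL.1 ha

theorem oneField_mem_modeClosure (U : Set (FieldInf W)) : oneField W ∈ modeClosure U :=
  Submodule.mem_sInf.2 fun _ hL => hL.2.1

theorem fieldMode_mem_modeClosure {U : Set (FieldInf W)} {a b : FieldInf W}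
    (ha : a ∈ modeClosure U) (hb : b ∈ modeClosure U) (n : ℤ) :
    fieldMode a n b ∈ modeClosure U :=
  Submodule.mem_sInf.2 fun L hL =>
    hL.2.2 a (Submodule.mem_sInf.1 ha L hL) b (Submodule.mem_sInf.1 hb L hL) n

/-- Minimality of the closure is used twice. The commutant of U contains the closure; by symmetry U
lies in the commutant of the closure, which then contains the closure as well. -/
theorem modeClosure_mutuallyLocal (hS : ∀ p ∈ S, MvPolynomial.rename ![1, 0] p ∈ S)
    {U : Set (FieldInf W)} (hU : ∀ a ∈ U, ∀ b ∈ U, MutuallyLocal S a b) :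
    ∀ a ∈ modeClosure U, ∀ b ∈ modeClosure U, MutuallyLocal S a b := by
  have h1 : modeClosure U ≤ localCommutant S U :=
    modeClosure_le hU (fun c _ => mutuallyLocal_oneField c)
      fun a ha b hb => fieldMode_mem_localCommutant ha hb
  have h2 : modeClosure U ≤ localCommutant S (modeClosure U) :=
    modeClosure_le (fun a ha b hb => (h1 hb a ha).symm hS) (fun c _ => mutuallyLocal_oneField c)
      fun a ha b hb => fieldMode_mem_localCommutant ha hb
  exact h2

/-- Nonzero polynomials. -/
def nonzeroPolys : Submonoid (MvPolynomial (Fin 2) ℂ) where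
  carrier := {p | p ≠ 0}
  one_mem' := one_ne_zero
  mul_mem' := mul_ne_zero

theorem rename_mem_nonzeroPolys {p : MvPolynomial (Fin 2) ℂ} (hp : p ∈ nonzeroPolys) :
    MvPolynomial.rename ![1, 0] p ∈ nonzeroPolys := fun h =>
  hp (MvPolynomial.rename_injective (R := ℂ) (![1, 0] : Fin 2 → Fin 2) (by decide)
    (h.trans (map_zero _).symm))

/-- The polynomials `±(x₁ - x₂)ᵏ`. -/
def diffPowers : Submonoid (MvPolynomial (Fin 2) ℂ) where
  carrier := {p | ∃ k : ℕ, p = (X 0 - X 1) ^ k ∨ p = -(X 0 - X 1) ^ k}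
  one_mem' := ⟨0, Or.inl (pow_zero _).symm⟩
  mul_mem' := by
    rintro p q ⟨k, hk⟩ ⟨l, hl⟩
    refine ⟨k + l, ?_⟩
    rcases hk with rfl | rfl <;> rcases hl with rfl | rfl <;> simp [pow_add]

/-- The exchange of variables multiplies (x₁-x₂)ᵏ by (-1)ᵏ, which is why `diffPowers` admits signs.
-/
theorem rename_mem_diffPowers {p : MvPolynomial (Fin 2) ℂ} (hp : p ∈ diffPowers) :
    MvPolynomial.rename ![1, 0] p ∈ diffPowers := by
  obtain ⟨k, hk⟩ := hp
  have e : MvPolynomial.rename (![1, 0] : Fin 2 → Fin 2) ((X 0 - X 1 : MvPolynomial (Fin 2) ℂ) ^ k) =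
      (-(X 0 - X 1)) ^ k := by simp
  refine ⟨k, ?_⟩
  rcases hk with rfl | rfl
  · rw [e]
    exact (Nat.even_or_odd k).imp (fun h => h.neg_pow _) fun h => h.neg_pow _
  · rw [map_neg, e]
    exact (Nat.even_or_odd k).symm.imp (fun h => by rw [h.neg_pow, neg_neg])
      fun h => by rw [h.neg_pow]

theorem isQuasiLocal_iff {U : Set (FieldInf W)} :
    IsQuasiLocal U ↔ ∀ a ∈ U, ∀ b ∈ U, MutuallyLocal nonzeroPolys a b := Iff.rfl

theorem isLocal_iff {U : Set (FieldInf W)} :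
    IsLocal U ↔ ∀ a ∈ U, ∀ b ∈ U, MutuallyLocal diffPowers a b := by
  refine forall₂_congr fun a _ => forall₂_congr fun b _ => ⟨fun ⟨k, hk⟩ => ?_, ?_⟩
  · exact ⟨_, ⟨k, Or.inl rfl⟩, hk⟩
  · rintro ⟨p, ⟨k, rfl | rfl⟩, h⟩
    · exact ⟨k, h⟩
    · rw [polyMul_neg_left, polyMul_neg_left] at h
      exact ⟨k, neg_injective h⟩

theorem MutuallyLocal.compatiblePair {a b : FieldInf W} (h : MutuallyLocal nonzeroPolys a b) :
    CompatiblePair a b := by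
  obtain ⟨p, hp, h⟩ := h
  exact ⟨p, hp, isTruncated_pairProd h⟩

theorem IsQuasiLocal.isQuasiCompatible {U : Set (FieldInf W)} (hU : IsQuasiLocal U) :
    IsQuasiCompatible U := by
  intro r a ha
  choose p hp h using fun i j => hU (a i) (ha i) (a j) (ha j)
  -- One polynomial must serve all pairs, so take the product of those that serve single pairs.
  obtain ⟨q, hq, hpq⟩ : ∃ q : MvPolynomial (Fin 2) ℂ, q ≠ 0 ∧ ∀ i j, p i j ∣ q :=
    ⟨∏ i, ∏ j, p i j, Finset.prod_ne_zero_iff.2 fun i _ =>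
      Finset.prod_ne_zero_iff.2 fun j _ => hp i j, fun i j =>
      (Finset.dvd_prod_of_mem _ (Finset.mem_univ j)).trans
        (Finset.dvd_prod_of_mem (fun i => ∏ j, p i j) (Finset.mem_univ i))⟩
  refine ⟨q, hq, ?_⟩
  have hdvd : ∀ i j, i < j → MvPolynomial.rename ![i, j] (p i j) ∣
      ∏ ij : Fin r × Fin r with ij.1 < ij.2, MvPolynomial.rename ![ij.1, ij.2] q := by
    intro i j hij
    have h1 : MvPolynomial.rename ![i, j] (p i j) ∣ MvPolynomial.rename ![i, j] q :=
      map_dvd _ (hpq i j)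
    have h2 : (i, j) ∈ Finset.univ.filter fun ij : Fin r × Fin r => ij.1 < ij.2 :=
      Finset.mem_filter.2 ⟨Finset.mem_univ (i, j), hij⟩
    generalize hf : (fun ij : Fin r × Fin r => MvPolynomial.rename (R := ℂ) ![ij.1, ij.2] q) = f
    have h3 : MvPolynomial.rename ![i, j] q = f (i, j) := by rw [← hf]
    rw [h3] at h1
    exact h1.trans (Finset.dvd_prod_of_mem f h2)
  exact isTruncated_polyMul_seqProd (fun i j _ => h i j) hdvd

theorem IsQuasiLocal.modeClosure {U : Set (FieldInf W)} (hU : IsQuasiLocal U) :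
    IsQuasiLocal (modeClosure U : Set (FieldInf W)) :=
  modeClosure_mutuallyLocal (fun _ => rename_mem_nonzeroPolys) hU

theorem IsLocal.modeClosure {U : Set (FieldInf W)} (hU : IsLocal U) :
    IsLocal (modeClosure U : Set (FieldInf W)) :=
  isLocal_iff.2 (modeClosure_mutuallyLocal (fun _ => rename_mem_diffPowers) (isLocal_iff.1 hU))

theorem IsQuasiLocal.isGeneratedBy {U : Set (FieldInf W)} (hU : IsQuasiLocal U) :
    IsGeneratedBy (VertexAtInfinity.modeClosure U) U :=
  ⟨⟨⟨hU.modeClosure.isQuasiCompatible, fun _ ha _ hb n => fieldMode_mem_modeClosure ha hb n⟩,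
    subset_modeClosure U, oneField_mem_modeClosure U⟩,
    fun _ hL => modeClosure_le hL.2.1 hL.2.2 hL.1.2⟩

end Locality

section Iterates

variable {W : Type*} [AddCommGroup W] [Module ℂ W]

/-! ### Iterated vertex operators on fields -/

/-- The coefficients of `Y(a, x₁) Y(b, x₂) c`, the variables being `x₂, x₁, x` in this order. -/
noncomputable def fieldProd (a b c : FieldInf W) : FormalSeries 3 (Module.End ℂ W) :=
  fun n => coeffAt (fieldCoeff a (fieldCoeff b c (n 0)) (n 1)) (n 2)

/-- The coefficients of `Y(Y(a, x₀) b, x₂) c`, the variables being `x₀, x₂, x` in this order. -/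
noncomputable def fieldIter (a b c : FieldInf W) : FormalSeries 3 (Module.End ℂ W) :=
  fun n => coeffAt (fieldCoeff (fieldCoeff a b (n 0)) c (n 1)) (n 2)

/-- If the slices are already truncated, uniqueness identifies the expansion with the plain
substitution; hence there are no negative powers of x₀, and the coefficients are explicit. -/
theorem IsExpansionFam.apply {H z : FormalSeries 3 (Module.End ℂ W)} (h : IsExpansionFam H z)
    (ht : ∀ m, IsTruncated (slice m H)) (m k n : ℤ) (w : W) :
    z ![m, k, n] w =
      if 0 ≤ k then ∑ᶠ t : ℤ, (Ring.choose t k.toNat : ℤ) • H ![m, t, n + k - t] w else 0 := by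
  obtain ⟨Z, hZ, rfl⟩ := h
  have e : Z m = substAdd (slice m H) (ht m) := (hZ m).unique (ht m).isExpansion
  change coeffAt (fcoeff (Z m) k) n w = _
  rw [e, fcoeff_substAdd]
  split_ifs with hk
  · rw [substField_coeffAt]
    refine finsum_congr fun t => ?_
    rw [Int.toNat_of_nonneg hk]
    rfl
  · simp

theorem IsTruncated.finite_plane {G : FormalSeries 3 (Module.End ℂ W)} (hG : IsTruncated G)
    (t : ℤ) (c : ℤ × ℤ → ℤ) (w : W) :
    (Function.support fun p : ℤ × ℤ => c p • G ![p.1, p.2, t - p.1 - p.2] w).Finite := by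
  obtain ⟨N, hN⟩ := hG w
  refine ((Set.finite_Icc (t - 2 * N) N).prod (Set.finite_Icc (t - 2 * N) N)).subset fun p hp => ?_
  have h0 : G ![p.1, p.2, t - p.1 - p.2] w ≠ 0 := fun h => hp (by simp [h])
  have h1 : p.1 ≤ N := not_lt.1 fun h => h0 (hN _ ⟨0, by simpa using h⟩)
  have h2 : p.2 ≤ N := not_lt.1 fun h => h0 (hN _ ⟨1, by simpa using h⟩)
  have h3 : t - p.1 - p.2 ≤ N := not_lt.1 fun h => h0 (hN _ ⟨2, by simpa using h⟩)
  simp only [Set.mem_prod, Set.mem_Icc]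
  omega

/-- The coefficient of `x₁ⁱ x₂ʲ xˢ` in `G(x + x₁, x + x₂, x) w`. -/
noncomputable def substPair (G : FormalSeries 3 (Module.End ℂ W)) (w : W) (i j : ℕ) (s : ℤ) : W :=
  ∑ᶠ p : ℤ × ℤ, ((Ring.choose p.1 i : ℤ) * (Ring.choose p.2 j : ℤ)) •
    G ![p.1, p.2, s + i + j - p.1 - p.2] w

theorem substPair_swap (G : FormalSeries 3 (Module.End ℂ W)) (w : W) (i j : ℕ) (s : ℤ) :
    substPair (fun n => G ![n 1, n 0, n 2]) w j i s = substPair G w i j s := by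
  rw [substPair, substPair, ← finsum_comp_equiv (Equiv.prodComm ℤ ℤ)]
  refine finsum_congr fun p => ?_
  simp only [Equiv.prodComm_apply, Prod.fst_swap, Prod.snd_swap, Matrix.cons_val_zero,
    Matrix.cons_val_one, Matrix.cons_val]
  rw [mul_comm, show s + (j : ℤ) + i - p.2 - p.1 = s + i + j - p.1 - p.2 by ring]

theorem isExpansionFam_fieldProd {a b c : FieldInf W}
    (h : ∀ j, CompatiblePair a (fieldCoeff b c j)) :
    IsExpansionFam (fun n => coeffAt a (n 1) * coeffAt (fieldCoeff b c (n 0)) (n 2))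
      (fieldProd a b c) :=
  ⟨fun j => fieldY a (fieldCoeff b c j), fun j => (h j).isExpansion, rfl⟩

theorem isExpansionFam_fieldIter {a b c : FieldInf W}
    (h : ∀ i, CompatiblePair (fieldCoeff a b i) c) :
    IsExpansionFam (fun n => coeffAt (fieldCoeff a b (n 0)) (n 1) * coeffAt c (n 2))
      (fieldIter a b c) :=
  ⟨fun i => fieldY (fieldCoeff a b i) c, fun i => (h i).isExpansion, rfl⟩

theorem IsTruncated.slice {G : FormalSeries 3 (Module.End ℂ W)} (hG : IsTruncated G) (m : ℤ) :
    IsTruncated (slice m G) := fun w => by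
  obtain ⟨N, hN⟩ := hG w
  refine ⟨N, fun n ⟨i, hi⟩ => hN _ ⟨i.succ, ?_⟩⟩
  fin_cases i <;> simpa using hi

theorem polyMul_rename_vec3 {M : Type*} [AddCommGroup M] [Module ℂ M] {i j k : Fin 3}
    (h : Function.Injective ![i, j, k]) (p : MvPolynomial (Fin 3) ℂ) {A B D E : FormalSeries 3 M}
    (hA : polyMul p A = D) (hB : ∀ n, B n = A ![n i, n j, n k])
    (hE : ∀ n, E n = D ![n i, n j, n k]) :
    polyMul (MvPolynomial.rename ![i, j, k] p) B = E := by
  have e : ∀ n : Fin 3 → ℤ, ![n i, n j, n k] = fun l => n (![i, j, k] l) := fun n => by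
    funext l; fin_cases l <;> rfl
  have hB' : B = fun n => A (fun l => n (![i, j, k] l)) := funext fun n => by rw [hB, e]
  rw [hB', polyMul_rename _ h, hA]
  exact funext fun n => by rw [hE, e]

/-- The iterated product arises from two substitutions, first x₂ → x+x₂ and then x₁ → x+x₁, with the
variables reordered in between. This computes their combined effect on polynomials. -/
theorem aeval_rename_fieldProd (Q : MvPolynomial (Fin 3) ℂ) :
    MvPolynomial.aeval ![X 0, X 1 + X 2, X 2] (MvPolynomial.rename ![1, 0, 2]
      (MvPolynomial.aeval ![X 0, X 1 + X 2, X 2] Q : MvPolynomial (Fin 3) ℂ)) =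
      (MvPolynomial.aeval ![X 1 + X 2, X 0 + X 2, X 2] Q : MvPolynomial (Fin 3) ℂ) := by
  induction Q using MvPolynomial.induction_on with
  | C c => simp
  | add p q hp hq => simp only [map_add, hp, hq]
  | mul_X p i hp =>
    simp only [map_mul, hp, MvPolynomial.aeval_X]
    congr 1
    fin_cases i <;> simp

theorem aeval_rename_fieldIter (Q : MvPolynomial (Fin 3) ℂ) :
    MvPolynomial.aeval ![X 0, X 1 + X 2, X 2] (MvPolynomial.rename ![2, 0, 1]
      (MvPolynomial.aeval ![X 0, X 1 + X 2, X 2] (MvPolynomial.rename ![1, 2, 0] Q) :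
        MvPolynomial (Fin 3) ℂ)) =
      (MvPolynomial.aeval ![X 0 + X 1 + X 2, X 1 + X 2, X 2] Q : MvPolynomial (Fin 3) ℂ) := by
  induction Q using MvPolynomial.induction_on with
  | C c => simp
  | add p q hp hq => simp only [map_add, hp, hq]
  | mul_X p i hp =>
    simp only [map_mul, hp, MvPolynomial.aeval_X, MvPolynomial.rename_X]
    congr 1
    fin_cases i <;> simp [add_assoc]

/-- `Q(x + x₁, x + x₂, x) Y(a, x₁) Y(b, x₂) c` is the result of the substitution `x₁ → x + x₁`,
`x₂ → x + x₂`, `x₃ → x` in `Q(x₁,x₂,x₃) a(x₁) b(x₂) c(x₃)`. -/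
theorem polyMul_fieldProd {a b c : FieldInf W} (hbc : CompatiblePair b c)
    (h : ∀ j, CompatiblePair a (fieldCoeff b c j)) {Q : MvPolynomial (Fin 3) ℂ}
    {G : FormalSeries 3 (Module.End ℂ W)} (hQ : polyMul Q (tripleProd a b c) = G)
    (hG : IsTruncated G) (i j s : ℤ) (w : W) :
    polyMul (MvPolynomial.aeval ![X 1 + X 2, X 0 + X 2, X 2] Q) (fieldProd a b c) ![j, i, s] w =
      if 0 ≤ i ∧ 0 ≤ j then substPair G w i.toNat j.toNat s else 0 := by
  have h1 := (hbc.isExpansionFam (coeffAt a) (fun _ => 1)).polyMul Q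
  simp only [mul_one, ← mul_assoc] at h1
  rw [show (fun n => coeffAt a (n 0) * coeffAt b (n 1) * coeffAt c (n 2) :
    FormalSeries 3 (Module.End ℂ W)) = tripleProd a b c from rfl, hQ] at h1
  obtain ⟨z, hzdef⟩ : ∃ z, polyMul (MvPolynomial.aeval ![X 0, X 1 + X 2, X 2] Q)
    (fun n => coeffAt a (n 0) * coeffAt (fieldCoeff b c (n 1)) (n 2) :
      FormalSeries 3 (Module.End ℂ W)) = z := ⟨_, rfl⟩
  rw [hzdef] at h1
  have hz := h1.apply hG.slice
  have h2 := (isExpansionFam_fieldProd h).polyMul (MvPolynomial.rename ![1, 0, 2]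
    (MvPolynomial.aeval ![X 0, X 1 + X 2, X 2] Q : MvPolynomial (Fin 3) ℂ))
  rw [polyMul_rename_vec3 (B := fun n => coeffAt a (n 1) * coeffAt (fieldCoeff b c (n 0)) (n 2))
    (E := fun n => z ![n 1, n 0, n 2]) (by decide) _ hzdef (fun n => rfl)
    fun n => rfl, aeval_rename_fieldProd] at h2
  -- If a term has x-exponent s and x₂-exponent m, then s+m = t+(s+m-t) is a sum of two exponents of
  -- G, each at most N; hence the bound 2N-m.
  have ht : ∀ m, IsTruncated (VertexAtInfinity.slice m
      (fun n => z ![n 1, n 0, n 2] : FormalSeries 3 (Module.End ℂ W))) := by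
    intro m w
    obtain ⟨N, hN⟩ := hG w
    refine ⟨max N (2 * N - m), fun n hn => ?_⟩
    refine (hz _ _ _ w).trans ?_
    split_ifs
    · refine finsum_eq_zero_of_forall_eq_zero fun t => ?_
      rw [hN, smul_zero]
      by_cases h0 : N < n 0
      · exact ⟨0, by simpa using h0⟩
      by_cases h1 : N < t
      · exact ⟨1, by simpa using h1⟩
      refine ⟨2, ?_⟩
      obtain ⟨k, hk⟩ := hn
      have : n 0 ≤ N := not_lt.1 h0
      fin_cases k
      · exact absurd (lt_of_le_of_lt (le_max_left _ _) hk) h0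
      · have := lt_of_le_of_lt (le_max_right _ _) hk
        simp at this ⊢
        omega
    · rfl
  rw [h2.apply ht]
  by_cases hi : 0 ≤ i
  · by_cases hj : 0 ≤ j
    · rw [if_pos hi, if_pos ⟨hi, hj⟩, substPair, finsum_curry _ (hG.finite_plane _ _ w)]
      refine finsum_congr fun t => ?_
      have := hz t j (s + i - t) w
      rw [if_pos hj] at this
      change (Ring.choose t i.toNat : ℤ) • z ![t, j, s + i - t] w = _
      have hf : (Function.support fun u : ℤ =>
          (Ring.choose u j.toNat : ℤ) • G ![t, u, s + i - t + j - u] w).Finite :=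
        (hG.slice t).finite_antidiagonal _ _ w
      rw [this, smul_finsum' _ hf]
      refine finsum_congr fun u => ?_
      rw [smul_smul, Int.toNat_of_nonneg hi, Int.toNat_of_nonneg hj,
        show s + i - t + j - u = s + i + j - t - u by ring]
    · rw [if_pos hi, if_neg fun h => hj h.2]
      refine finsum_eq_zero_of_forall_eq_zero fun t => ?_
      have := hz t j (s + i - t) w
      rw [if_neg hj] at this
      change (Ring.choose t i.toNat : ℤ) • z ![t, j, s + i - t] w = _
      rw [this, smul_zero]
  · rw [if_neg hi, if_neg fun h => hi h.1]

/-- `Q(x + x₂ + x₀, x + x₂, x) Y(Y(a, x₀) b, x₂) c` is the result of the substitution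
`x₁ → x + x₂ + x₀`, `x₂ → x + x₂`, `x₃ → x` in `Q(x₁,x₂,x₃) a(x₁) b(x₂) c(x₃)`. -/
theorem polyMul_fieldIter {a b c : FieldInf W} (hab : CompatiblePair a b)
    (h : ∀ i, CompatiblePair (fieldCoeff a b i) c) {Q : MvPolynomial (Fin 3) ℂ}
    {G : FormalSeries 3 (Module.End ℂ W)} (hQ : polyMul Q (tripleProd a b c) = G)
    (hG : IsTruncated G) (i j s : ℤ) (w : W) :
    polyMul (MvPolynomial.aeval ![X 0 + X 1 + X 2, X 1 + X 2, X 2] Q) (fieldIter a b c)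
        ![i, j, s] w =
      if 0 ≤ i ∧ 0 ≤ j then ∑ᶠ p : ℤ × ℤ,
        ((Ring.choose p.1 i.toNat : ℤ) * (Ring.choose (p.1 - i + p.2) j.toNat : ℤ)) •
          G ![p.1, p.2, s + i + j - p.1 - p.2] w else 0 := by
  have h1 := (hab.isExpansionFam (fun _ => 1) (coeffAt c)).polyMul
    (MvPolynomial.rename ![1, 2, 0] Q)
  simp only [one_mul] at h1
  rw [polyMul_rename_vec3 (B := fun n => coeffAt a (n 1) * coeffAt b (n 2) * coeffAt c (n 0))
    (E := fun n => G ![n 1, n 2, n 0]) (by decide) _ hQ (fun n => rfl)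
    fun n => rfl] at h1
  have hsl : ∀ m, IsTruncated (VertexAtInfinity.slice m
      (fun n => G ![n 1, n 2, n 0] : FormalSeries 3 (Module.End ℂ W))) := by
    intro m w
    obtain ⟨N, hN⟩ := hG w
    refine ⟨N, fun n ⟨k, hk⟩ => hN _ ⟨k.castSucc, ?_⟩⟩
    fin_cases k <;> simpa using hk
  obtain ⟨z, hzdef⟩ : ∃ z, polyMul (MvPolynomial.aeval ![X 0, X 1 + X 2, X 2]
    (MvPolynomial.rename ![1, 2, 0] Q)) (fun n => coeffAt (fieldCoeff a b (n 1)) (n 2) *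
      coeffAt c (n 0) : FormalSeries 3 (Module.End ℂ W)) = z := ⟨_, rfl⟩
  rw [hzdef] at h1
  have hz := h1.apply hsl
  have h2 := (isExpansionFam_fieldIter h).polyMul (MvPolynomial.rename ![2, 0, 1]
    (MvPolynomial.aeval ![X 0, X 1 + X 2, X 2] (MvPolynomial.rename ![1, 2, 0] Q) :
      MvPolynomial (Fin 3) ℂ))
  rw [polyMul_rename_vec3 (B := fun n => coeffAt (fieldCoeff a b (n 0)) (n 1) * coeffAt c (n 2))
    (E := fun n => z ![n 2, n 0, n 1]) (by decide) _ hzdef (fun n => rfl)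
    fun n => rfl, aeval_rename_fieldIter] at h2
  have ht : ∀ m, IsTruncated (VertexAtInfinity.slice m
      (fun n => z ![n 2, n 0, n 1] : FormalSeries 3 (Module.End ℂ W))) := by
    intro m w
    obtain ⟨N, hN⟩ := hG w
    refine ⟨max N (2 * N - m), fun n hn => ?_⟩
    refine (hz _ _ _ w).trans ?_
    split_ifs
    · refine finsum_eq_zero_of_forall_eq_zero fun t => ?_
      rw [hN, smul_zero]
      by_cases h0 : N < n 1
      · exact ⟨2, by simpa using h0⟩
      by_cases h1 : N < t
      · exact ⟨0, by simpa using h1⟩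
      refine ⟨1, ?_⟩
      obtain ⟨k, hk⟩ := hn
      fin_cases k
      · have := lt_of_le_of_lt (le_max_right _ _) hk
        simp at this ⊢
        omega
      · exact absurd (lt_of_le_of_lt (le_max_left _ _) hk) h0
    · rfl
  rw [h2.apply ht]
  by_cases hj : 0 ≤ j
  · by_cases hi : 0 ≤ i
    · let e : ℤ × ℤ ≃ ℤ × ℤ :=
        { toFun := fun q => (q.2, q.1 + i - q.2)
          invFun := fun p => (p.1 + p.2 - i, p.1)
          left_inv := fun q => by ext <;> simp
          right_inv := fun p => by ext <;> simp }
      have hfin := hG.finite_plane (s + i + j)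
        (fun p => (Ring.choose p.1 i.toNat : ℤ) * (Ring.choose (p.1 - i + p.2) j.toNat : ℤ)) w
      rw [if_pos hj, if_pos ⟨hi, hj⟩, ← finsum_comp_equiv e, finsum_curry]
      · refine finsum_congr fun t => ?_
        have := hz (s + j - t) i t w
        rw [if_pos hi] at this
        change (Ring.choose t j.toNat : ℤ) • z ![s + j - t, i, t] w = _
        have hf : (Function.support fun u : ℤ =>
            (Ring.choose u i.toNat : ℤ) • G ![u, t + i - u, s + j - t] w).Finite :=
          (hsl (s + j - t)).finite_antidiagonal _ _ w
        change z ![s + j - t, i, t] w = ∑ᶠ u : ℤ,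
          (Ring.choose u i.toNat : ℤ) • G ![u, t + i - u, s + j - t] w at this
        rw [this, smul_finsum' _ hf]
        refine finsum_congr fun u => ?_
        change (Ring.choose t j.toNat : ℤ) • (Ring.choose u i.toNat : ℤ) •
          G ![u, t + i - u, s + j - t] w =
          ((Ring.choose u i.toNat : ℤ) * (Ring.choose (u - i + (t + i - u)) j.toNat : ℤ)) •
            G ![u, t + i - u, s + i + j - u - (t + i - u)] w
        rw [smul_smul, mul_comm, show u - i + (t + i - u) = t by ring,
          show s + i + j - u - (t + i - u) = s + j - t by ring]
      · exact hfin.preimage e.injective.injOn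
    · rw [if_pos hj, if_neg fun h => hi h.1]
      refine finsum_eq_zero_of_forall_eq_zero fun t => ?_
      have := hz (s + j - t) i t w
      rw [if_neg hi] at this
      change (Ring.choose t j.toNat : ℤ) • z ![s + j - t, i, t] w = _
      rw [this, smul_zero]
  · rw [if_neg hj, if_neg fun h => hj h.2]

/-! ### The expansion of `A(x₀ + x₂, x₂)` in nonnegative powers of `x₂` -/

/-- The coefficients of `A(x₂, x₀ + x₂, x)`, where `A` is a series in `x₂, x₁, x`, as a series in
`x₀, x₂, x`. -/
noncomputable def assocSubst {M : Type*} [AddCommGroup M] (A : FormalSeries 3 M) :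
    FormalSeries 3 M :=
  fun n => ∑ᶠ k : ℕ, (Ring.choose (n 0 + k) k : ℤ) • A ![n 1 - k, n 0 + k, n 2]

theorem finite_support_assocSubst {M : Type*} [AddCommGroup M] {A : FormalSeries 3 M} {N : ℤ}
    (hA : ∀ n, n 0 < N → A n = 0) (j : ℤ) (c : ℕ → ℤ) (i : ℕ → ℤ) (s : ℤ) :
    (Function.support fun k : ℕ => c k • A ![j - k, i k, s]).Finite := by
  refine (Set.finite_Iic (j - N).toNat).subset fun k hk => ?_
  by_contra h
  refine hk ?_
  have : A ![j - k, i k, s] = 0 := hA _ (by simp at h ⊢; omega)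
  simp [this]

theorem finsum_eq_sum_range {M : Type*} [AddCommMonoid M] {f : ℕ → M} {n : ℕ}
    (h : ∀ k, n ≤ k → f k = 0) : ∑ᶠ k, f k = ∑ k ∈ Finset.range n, f k :=
  finsum_eq_sum_of_support_subset f fun k hk => by
    rw [Finset.coe_range, Set.mem_Iio]
    exact not_le.1 fun h' => hk (h k h')

/-- For x₁ ↦ x₀+x₂ this is again Pascal's rule. The relation carries the lower bound in x₂ along,
because `assocSubst` is additive only when its sums are finite. -/
theorem polyMul_assocSubst {M : Type*} [AddCommGroup M] [Module ℂ M] {A : FormalSeries 3 M} {N : ℤ}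
    (hA : ∀ n, n 0 < N → A n = 0) (p : MvPolynomial (Fin 3) ℂ) :
    polyMul (MvPolynomial.aeval ![X 1, X 0 + X 1, X 2] p) (assocSubst A) =
      assocSubst (polyMul p A) := by
  refine (polyMul_rel (R := fun A B => (∃ N : ℤ, ∀ n : Fin 3 → ℤ, n 0 < N → A n = 0) ∧
    B = assocSubst A) ?_ ?_ _ ?_ p ⟨⟨N, hA⟩, rfl⟩).2
  · rintro A _ A' _ ⟨⟨N, hN⟩, rfl⟩ ⟨⟨N', hN'⟩, rfl⟩
    refine ⟨⟨min N N', fun n hn => ?_⟩, funext fun n => ?_⟩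
    · rw [Pi.add_apply, hN n (lt_of_lt_of_le hn (min_le_left _ _)),
        hN' n (lt_of_lt_of_le hn (min_le_right _ _)), add_zero]
    · simp only [assocSubst, Pi.add_apply, smul_add]
      exact (finsum_add_distrib (finite_support_assocSubst hN _ _ _ _)
        (finite_support_assocSubst hN' _ _ _ _)).symm
  · rintro c A _ ⟨⟨N, hN⟩, rfl⟩
    refine ⟨⟨N, fun n hn => by rw [Pi.smul_apply, hN n hn, smul_zero]⟩, funext fun n => ?_⟩
    simp only [assocSubst, Pi.smul_apply]
    rw [smul_finsum' c (finite_support_assocSubst hN _ _ _ _)]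
    exact finsum_congr fun k => smul_comm _ _ _
  · rintro i A _ ⟨⟨N, hN⟩, rfl⟩
    refine ⟨⟨N, fun n hn => ?_⟩, series3_ext fun a b c => ?_⟩
    · exact polyMul_eq_zero_of_lt 0 (X i) hN n hn
    · fin_cases i
      · change polyMul (X 1) (assocSubst A) _ = _
        rw [polyMul_X_one_vec3]
        refine finsum_congr fun k => ?_
        change _ = _ • polyMul (X 0) A ![b - k, a + k, c]
        rw [polyMul_X_zero_vec3, sub_right_comm]
        rfl
      · change polyMul (X 0 + X 1) (assocSubst A) _ = _
        rw [polyMul_add_left, Pi.add_apply, polyMul_X_zero_vec3, polyMul_X_one_vec3]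
        have hA0 : ∀ u v : ℤ, u < N → A ![u, v, c] = 0 := fun u v h => hN _ h
        -- All terms with k ≥ n vanish. Two of the sums get one extra term, so that they align with
        -- the third once k = 0 is split off.
        set n := (b - N).toNat + 1 with hn
        have h1 : assocSubst A ![a - 1, b, c] = ∑ k ∈ Finset.range (n + 1),
            (Ring.choose (a - 1 + k) k : ℤ) • A ![b - k, a - 1 + k, c] :=
          finsum_eq_sum_range fun k hk => by
            change (Ring.choose (a - 1 + k) k : ℤ) • A ![b - k, a - 1 + k, c] = 0
            rw [hA0 _ _ (by omega), smul_zero]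
        have h2 : assocSubst A ![a, b - 1, c] = ∑ k ∈ Finset.range n,
            (Ring.choose (a + k) k : ℤ) • A ![b - 1 - k, a + k, c] :=
          finsum_eq_sum_range fun k hk => by
            change (Ring.choose (a + k) k : ℤ) • A ![b - 1 - k, a + k, c] = 0
            rw [hA0 _ _ (by omega), smul_zero]
        have h3 : assocSubst (polyMul (X 1) A) ![a, b, c] = ∑ k ∈ Finset.range (n + 1),
            (Ring.choose (a + k) k : ℤ) • A ![b - k, a + k - 1, c] :=
          (finsum_congr fun k => congrArg _ (polyMul_X_one_vec3 A _ _ _)).trans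
            (finsum_eq_sum_range fun k hk => by
              change (Ring.choose (a + k) k : ℤ) • A ![b - k, a + k - 1, c] = 0
              rw [hA0 _ _ (by omega), smul_zero])
        change _ = assocSubst (polyMul (X 1) A) ![a, b, c]
        rw [h1, h2, h3, Finset.sum_range_succ', Finset.sum_range_succ' _ n, add_right_comm,
          ← Finset.sum_add_distrib]
        congr 1
        · refine Finset.sum_congr rfl fun k _ => ?_
          have e1 : a + ((k + 1 : ℕ) : ℤ) - 1 = a + k := by push_cast; ring
          have e2 : a - 1 + ((k + 1 : ℕ) : ℤ) = a + k := by push_cast; ring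
          have e3 : a + ((k + 1 : ℕ) : ℤ) = a + k + 1 := by push_cast; ring
          have e4 : b - ((k + 1 : ℕ) : ℤ) = b - 1 - k := by push_cast; ring
          rw [e1, e2, e3, e4, ← add_smul, Ring.choose_succ_succ, add_comm]
        · simp
      · change polyMul (X 2) (assocSubst A) _ = _
        rw [polyMul_X_two_vec3]
        refine finsum_congr fun k => ?_
        change _ = _ • polyMul (X 2) A ![b - k, a + k, c]
        rw [polyMul_X_two_vec3]
        rfl

end Iterates

section Cancellation

variable {W : Type*} [AddCommGroup W] [Module ℂ W]

/-! ### Cancellation of polynomials in iterated Laurent series -/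

/-- `h(0, 0, x)` as an element of `C((x⁻¹))`. -/
noncomputable def cornerEval : MvPolynomial (Fin 3) ℂ →+* LaurentInf :=
  MvPolynomial.eval₂Hom HahnSeries.C ![0, 0, xInf]

@[simp]
theorem cornerEval_C (c : ℂ) : cornerEval (C c) = HahnSeries.C c := by simp [cornerEval]

@[simp]
theorem cornerEval_X_zero : cornerEval (X 0) = 0 := by simp [cornerEval]

@[simp]
theorem cornerEval_X_one : cornerEval (X 1) = 0 := by simp [cornerEval]

@[simp]
theorem cornerEval_X_two : cornerEval (X 2) = xInf := by simp [cornerEval]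

theorem cornerEval_aeval {r : ℕ} {φ : Fin r → MvPolynomial (Fin 3) ℂ}
    (hφ : ∀ i, cornerEval (φ i) = xInf) (p : MvPolynomial (Fin r) ℂ) :
    cornerEval (MvPolynomial.aeval φ p) = Polynomial.aeval xInf (diag p) := by
  induction p using MvPolynomial.induction_on with
  | C c =>
    rw [← MvPolynomial.algebraMap_eq, AlgHom.commutes, AlgHom.commutes, AlgHom.commutes,
      MvPolynomial.algebraMap_eq, cornerEval_C]
    rfl
  | add p q hp hq => simp only [map_add, hp, hq]
  | mul_X p i hp => simp only [map_mul, hp, MvPolynomial.aeval_X, hφ, diag_X, Polynomial.aeval_X]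

theorem add_smul_field (f g : LaurentInf) (a : FieldInf W) : (f + g) • a = f • a + g • a :=
  LinearMap.ext fun w => add_smul f g (a w)

theorem mul_smul_field (f g : LaurentInf) (a : FieldInf W) : (f * g) • a = f • g • a :=
  LinearMap.ext fun w => mul_smul f g (a w)

theorem smul_zero_field (f : LaurentInf) : f • (0 : FieldInf W) = 0 :=
  LinearMap.ext fun _ => smul_zero f

theorem zero_smul_field (a : FieldInf W) : (0 : LaurentInf) • a = 0 :=
  LinearMap.ext fun w => zero_smul LaurentInf (a w)

theorem eq_zero_of_smul_field {f : LaurentInf} (hf : f ≠ 0) {a : FieldInf W} (h : f • a = 0) :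
    a = 0 := by
  have : f⁻¹ • f • a = a := by
    rw [← mul_smul_field, inv_mul_cancel₀ hf]
    exact LinearMap.ext fun w => one_smul LaurentInf (a w)
  rw [← this, h, smul_zero_field]

/-- The series in the last variable are elements of `𝓔ᵒ(W)`. -/
def IsFieldSeries (A : FormalSeries 3 (Module.End ℂ W)) : Prop :=
  ∀ i j, ∃ d : FieldInf W, ∀ n, coeffAt d n = A ![i, j, n]

/-- `A` belongs to `M((x_v))((x_u))`. -/
def IsIteratedLaurent {M : Type*} [Zero M] (u v : Fin 3) (A : FormalSeries 3 M) : Prop :=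
  (∃ N : ℤ, ∀ n, n u < N → A n = 0) ∧ ∀ t : ℤ, ∃ N : ℤ, ∀ n, n u = t → n v < N → A n = 0

theorem IsFieldSeries.polyMul {A : FormalSeries 3 (Module.End ℂ W)} (hA : IsFieldSeries A)
    (p : MvPolynomial (Fin 3) ℂ) : IsFieldSeries (polyMul p A) := by
  refine polyMul_rel (R := fun (A _ : FormalSeries 3 (Module.End ℂ W)) => IsFieldSeries A)
    (fun A _ A' _ h h' i j => ?_) (fun c A _ h i j => ?_) X (fun k A _ h i j => ?_) p (B := 0) hA
  · obtain ⟨d, hd⟩ := h i j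
    obtain ⟨d', hd'⟩ := h' i j
    exact ⟨d + d', fun n => by rw [coeffAt_add, hd, hd', Pi.add_apply]⟩
  · obtain ⟨d, hd⟩ := h i j
    exact ⟨c • d, fun n => by rw [coeffAt_smul, hd, Pi.smul_apply]⟩
  · fin_cases k
    · obtain ⟨d, hd⟩ := h (i - 1) j
      exact ⟨d, fun n => (hd n).trans (polyMul_X_zero_vec3 A _ _ _).symm⟩
    · obtain ⟨d, hd⟩ := h i (j - 1)
      exact ⟨d, fun n => (hd n).trans (polyMul_X_one_vec3 A _ _ _).symm⟩
    · obtain ⟨d, hd⟩ := h i j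
      exact ⟨xInf • d, fun n => by
        rw [coeffAt_xInf_smul, hd]
        exact (polyMul_X_two_vec3 A _ _ _).symm⟩

theorem IsIteratedLaurent.add {M : Type*} [AddCommGroup M] {u v : Fin 3} {A B : FormalSeries 3 M}
    (hA : IsIteratedLaurent u v A) (hB : IsIteratedLaurent u v B) :
    IsIteratedLaurent u v (A + B) := by
  obtain ⟨⟨N, hN⟩, h⟩ := hA
  obtain ⟨⟨N', hN'⟩, h'⟩ := hB
  refine ⟨⟨min N N', fun n hn => ?_⟩, fun t => ?_⟩
  · rw [Pi.add_apply, hN n (lt_of_lt_of_le hn (min_le_left _ _)),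
      hN' n (lt_of_lt_of_le hn (min_le_right _ _)), add_zero]
  · obtain ⟨L, hL⟩ := h t
    obtain ⟨L', hL'⟩ := h' t
    refine ⟨min L L', fun n ht hn => ?_⟩
    rw [Pi.add_apply, hL n ht (lt_of_lt_of_le hn (min_le_left _ _)),
      hL' n ht (lt_of_lt_of_le hn (min_le_right _ _)), add_zero]

theorem IsIteratedLaurent.polyMul {M : Type*} [AddCommGroup M] [Module ℂ M] {u v : Fin 3}
    {A : FormalSeries 3 M} (hA : IsIteratedLaurent u v A) (p : MvPolynomial (Fin 3) ℂ) :
    IsIteratedLaurent u v (polyMul p A) := by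
  refine polyMul_rel (R := fun (A _ : FormalSeries 3 M) => IsIteratedLaurent u v A)
    (fun A _ A' _ h h' => h.add h') (fun c A _ h => ?_) X (fun k A _ h => ?_) p (B := 0) hA
  · obtain ⟨⟨N, hN⟩, h⟩ := h
    refine ⟨⟨N, fun n hn => by rw [Pi.smul_apply, hN n hn, smul_zero]⟩, fun t => ?_⟩
    obtain ⟨L, hL⟩ := h t
    exact ⟨L, fun n ht hn => by rw [Pi.smul_apply, hL n ht hn, smul_zero]⟩
  · obtain ⟨⟨N, hN⟩, h⟩ := h
    have hle : ∀ (n : Fin 3 → ℤ) (i : Fin 3), (n - Pi.single k 1 : Fin 3 → ℤ) i ≤ n i := by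
      intro n i
      by_cases hi : i = k
      · subst hi; simp
      · simp [hi]
    refine ⟨⟨N, fun n hn => ?_⟩, fun t => ?_⟩
    · rw [polyMul_X]
      exact hN _ (lt_of_le_of_lt (hle n u) hn)
    · obtain ⟨L, hL⟩ := h (t - (Pi.single k 1 : Fin 3 → ℤ) u)
      refine ⟨L, fun n ht hn => ?_⟩
      rw [polyMul_X]
      exact hL _ (by rw [Pi.sub_apply, ht]) (lt_of_le_of_lt (hle n v) hn)

/-- Terms of h containing the first or second variable reach (i,j) only from smaller exponents,
where D vanishes; only h(0,0,x) contributes. -/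
theorem polyMul_corner (h : MvPolynomial (Fin 3) ℂ) :
    ∀ (D : FormalSeries 3 (Module.End ℂ W)) (i j : ℤ) (d : FieldInf W),
      (∀ n, coeffAt d n = D ![i, j, n]) →
      (∀ i' j' n, i' ≤ i → j' ≤ j → ¬ (i' = i ∧ j' = j) → D ![i', j', n] = 0) →
      ∀ n, polyMul h D ![i, j, n] = coeffAt (cornerEval h • d) n := by
  induction h using MvPolynomial.induction_on with
  | C c =>
    intro D i j d hd _ n
    rw [polyMul_C, cornerEval_C, coeffAt_C_smul, hd, Pi.smul_apply]
  | add p q hp hq =>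
    intro D i j d hd hz n
    rw [polyMul_add_left, map_add, add_smul_field, coeffAt_add, Pi.add_apply, hp D i j d hd hz,
      hq D i j d hd hz]
  | mul_X p k hp =>
    intro D i j d hd hz n
    rw [polyMul_mul, map_mul, mul_smul_field]
    refine hp _ i j _ (fun m => ?_) (fun i' j' m hi hj hij => ?_) n
    · fin_cases k
      · change coeffAt (cornerEval (X 0) • d) m = polyMul (X 0) D _
        rw [cornerEval_X_zero, zero_smul_field, coeffAt_zero, polyMul_X_zero_vec3,
          hz _ _ _ (by omega) le_rfl (by omega)]
      · change coeffAt (cornerEval (X 1) • d) m = polyMul (X 1) D _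
        rw [cornerEval_X_one, zero_smul_field, coeffAt_zero, polyMul_X_one_vec3,
          hz _ _ _ le_rfl (by omega) (by omega)]
      · change coeffAt (cornerEval (X 2) • d) m = polyMul (X 2) D _
        rw [cornerEval_X_two, coeffAt_xInf_smul, polyMul_X_two_vec3, hd]
    · fin_cases k
      · exact (polyMul_X_zero_vec3 _ _ _ _).trans (hz _ _ _ (by omega) hj (by omega))
      · exact (polyMul_X_one_vec3 _ _ _ _).trans (hz _ _ _ hi (by omega) (by omega))
      · exact (polyMul_X_two_vec3 _ _ _ _).trans (hz _ _ _ hi hj hij)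

theorem eq_zero_of_corner {h : MvPolynomial (Fin 3) ℂ} (hh : cornerEval h ≠ 0)
    {D : FormalSeries 3 (Module.End ℂ W)} (hD : IsFieldSeries D) {i j : ℤ}
    (hz : ∀ i' j' n, i' ≤ i → j' ≤ j → ¬ (i' = i ∧ j' = j) → D ![i', j', n] = 0)
    (h0 : ∀ n, polyMul h D ![i, j, n] = 0) (n : ℤ) : D ![i, j, n] = 0 := by
  obtain ⟨d, hd⟩ := hD i j
  have : d = 0 := eq_zero_of_smul_field hh (field_ext fun n => by
    rw [← polyMul_corner h D i j d hd hz, h0, coeffAt_zero])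
  rw [← hd, this, coeffAt_zero]

/-- Lexicographic induction on (i,j), starting at the lower bounds N and L(i): when (i,j) is
reached, every other pair below it is already known to vanish, so `eq_zero_of_corner` applies. The
restriction to exponents below K lets a lower bound on hD descend to D. -/
theorem eq_zero_of_polyMul_eq_zero_left {h : MvPolynomial (Fin 3) ℂ} (hh : cornerEval h ≠ 0)
    {D : FormalSeries 3 (Module.End ℂ W)} (hD : IsFieldSeries D) (hI : IsIteratedLaurent 0 1 D)
    {K : ℤ} (h0 : ∀ n, n 1 < K → polyMul h D n = 0) : ∀ n, n 1 < K → D n = 0 := by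
  obtain ⟨⟨N, hN⟩, hI⟩ := hI
  choose L hL using hI
  have main : ∀ (a b : ℕ) (i j n : ℤ), i < N + a → j < L i + b → j < K → D ![i, j, n] = 0 := by
    intro a
    induction a with
    | zero => exact fun b i j n hi _ _ => hN _ (by simpa using hi)
    | succ a iha =>
      intro b
      induction b with
      | zero => exact fun i j n _ hj _ => hL i _ rfl (by simpa using hj)
      | succ b ihb =>
        intro i j n hi hj hjK
        push_cast at hi hj
        refine eq_zero_of_corner hh hD (fun i' j' m hi' hj' hij => ?_)
          (fun m => h0 _ (by simpa using hjK)) n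
        by_cases e : i' = i
        · subst e
          exact ihb i' j' m (by push_cast; omega) (by omega) (by omega)
        · exact iha (j' - L i' + 1).toNat i' j' m (by omega) (by omega) (by omega)
  intro n hn
  rw [← vec3_eta n]
  exact main (n 0 - N + 1).toNat (n 1 - L (n 0) + 1).toNat _ _ _ (by omega) (by omega) hn

/-- The same induction with the roles of the first two variables exchanged. -/
theorem eq_zero_of_polyMul_eq_zero_right {h : MvPolynomial (Fin 3) ℂ} (hh : cornerEval h ≠ 0)
    {D : FormalSeries 3 (Module.End ℂ W)} (hD : IsFieldSeries D) (hI : IsIteratedLaurent 1 0 D)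
    {K : ℤ} (h0 : ∀ n, n 0 < K → polyMul h D n = 0) : ∀ n, n 0 < K → D n = 0 := by
  obtain ⟨⟨N, hN⟩, hI⟩ := hI
  choose L hL using hI
  have main : ∀ (a b : ℕ) (i j n : ℤ), j < N + a → i < L j + b → i < K → D ![i, j, n] = 0 := by
    intro a
    induction a with
    | zero => exact fun b i j n hi _ _ => hN _ (by simpa using hi)
    | succ a iha =>
      intro b
      induction b with
      | zero => exact fun i j n _ hj _ => hL j _ rfl (by simpa using hj)
      | succ b ihb =>
        intro i j n hi hj hjK
        push_cast at hi hj
        refine eq_zero_of_corner hh hD (fun i' j' m hi' hj' hij => ?_)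
          (fun m => h0 _ (by simpa using hjK)) n
        by_cases e : j' = j
        · subst e
          exact ihb i' j' m (by push_cast; omega) (by omega) (by omega)
        · exact iha (i' - L j' + 1).toNat i' j' m (by omega) (by omega) (by omega)
  intro n hn
  rw [← vec3_eta n]
  exact main (n 1 - N + 1).toNat (n 0 - L (n 1) + 1).toNat _ _ _ (by omega) (by omega) hn

theorem polyMul_X_pow_injective {r : ℕ} {M : Type*} [AddCommGroup M] [Module ℂ M] (i : Fin r)
    (k : ℕ) : Function.Injective (polyMul (X i ^ k) : FormalSeries r M → FormalSeries r M) := by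
  induction k with
  | zero => exact fun A B h => by simpa using h
  | succ k ih =>
    intro A B h
    rw [pow_succ, polyMul_mul, polyMul_mul] at h
    funext n
    have := congrFun (ih h) (n + Pi.single i 1)
    rwa [polyMul_X, polyMul_X, add_sub_cancel_right] at this

/-- A polynomial `x₀ᵃ x₁ᵇ h` with `h(0,0,x) ≠ 0` can be cancelled from an equality between an element
of `𝓔ᵒ(W)((x₁))((x₀))` and an element of `𝓔ᵒ(W)((x₀))((x₁))`. -/
theorem polyMul_cancel {h : MvPolynomial (Fin 3) ℂ} (hh : cornerEval h ≠ 0) {a b : ℕ}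
    {A B : FormalSeries 3 (Module.End ℂ W)} (hA : IsFieldSeries A) (hB : IsFieldSeries B)
    (hA' : IsIteratedLaurent 0 1 A) (hB' : IsIteratedLaurent 1 0 B)
    (heq : polyMul (X 0 ^ a * X 1 ^ b * h) A = polyMul (X 0 ^ a * X 1 ^ b * h) B) : A = B := by
  rw [mul_assoc, polyMul_mul, polyMul_mul _ _ B] at heq
  replace heq := polyMul_X_pow_injective _ _ heq
  rw [polyMul_mul, polyMul_mul _ _ B] at heq
  replace heq := polyMul_X_pow_injective _ _ heq
  obtain ⟨⟨N, hN⟩, -⟩ := id hA'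
  obtain ⟨⟨N', hN'⟩, -⟩ := id hB'
  -- Since hA = hB, the bound of B in x₁ passes to A and that of A in x₀ passes to B. Both then lie
  -- in one common space of Laurent series, where h cancels.
  have h1 : ∀ n, n 1 < N' → A n = 0 := eq_zero_of_polyMul_eq_zero_left hh hA hA'
    (by rw [heq]; exact polyMul_eq_zero_of_lt 1 h hN')
  have h2 : ∀ n, n 0 < N → B n = 0 := eq_zero_of_polyMul_eq_zero_right hh hB hB'
    (by rw [← heq]; exact polyMul_eq_zero_of_lt 0 h hN)
  have hI : IsIteratedLaurent 0 1 (A - B) :=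
    ⟨⟨N, fun n hn => by rw [Pi.sub_apply, hN n hn, h2 n hn, sub_zero]⟩, fun t =>
      ⟨N', fun n _ hn => by rw [Pi.sub_apply, h1 n hn, hN' n hn, sub_zero]⟩⟩
  have hF : IsFieldSeries (A - B) := fun i j => by
    obtain ⟨d, hd⟩ := hA i j
    obtain ⟨d', hd'⟩ := hB i j
    exact ⟨d - d', fun n => by rw [coeffAt_sub, hd, hd', Pi.sub_apply]⟩
  refine sub_eq_zero.1 (funext fun n => ?_)
  exact eq_zero_of_polyMul_eq_zero_left hh hF hI (K := n 1 + 1)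
    (fun m _ => by rw [polyMul_sub, heq, sub_self, Pi.zero_apply]) n (lt_add_one _)

/-! ### Iterated products as iterated Laurent series -/

/-- Because `fieldY` involves a choice, its vanishing comes from uniqueness of expansions. -/
theorem fieldCoeff_zero_left (b : FieldInf W) (k : ℤ) : fieldCoeff 0 b k = 0 := by
  have e : pairProd 0 b = 0 := by funext n; simp [pairProd]
  have h : CompatiblePair 0 b := ⟨1, one_ne_zero, by rw [e, polyMul_zero]; exact IsTruncated.zero⟩
  rw [fieldCoeff, h.isExpansion.unique (e ▸ isExpansion_zero), fcoeff_zero]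

theorem fieldCoeff_zero_right (a : FieldInf W) (k : ℤ) : fieldCoeff a 0 k = 0 := by
  have e : pairProd a 0 = 0 := by funext n; simp [pairProd]
  have h : CompatiblePair a 0 := ⟨1, one_ne_zero, by rw [e, polyMul_zero]; exact IsTruncated.zero⟩
  rw [fieldCoeff, h.isExpansion.unique (e ▸ isExpansion_zero), fcoeff_zero]

theorem isFieldSeries_fieldProd (a b c : FieldInf W) : IsFieldSeries (fieldProd a b c) :=
  fun i j => ⟨fieldCoeff a (fieldCoeff b c i) j, fun _ => rfl⟩

theorem isFieldSeries_fieldIter (a b c : FieldInf W) : IsFieldSeries (fieldIter a b c) :=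
  fun i j => ⟨fieldCoeff (fieldCoeff a b i) c j, fun _ => rfl⟩

theorem fieldProd_eq_zero {a b c : FieldInf W} {n : Fin 3 → ℤ} (h : fieldCoeff b c (n 0) = 0) :
    fieldProd a b c n = 0 := by
  rw [fieldProd, h, fieldCoeff_zero_right, coeffAt_zero]

theorem isIteratedLaurent_fieldProd (a b c : FieldInf W) :
    IsIteratedLaurent 0 1 (fieldProd a b c) := by
  refine ⟨?_, fun t => ?_⟩
  · obtain ⟨N, hN⟩ := fcoeff_bounded (fieldY b c)
    exact ⟨N, fun n hn => fieldProd_eq_zero (hN _ hn)⟩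
  · obtain ⟨N, hN⟩ := fcoeff_bounded (fieldY a (fieldCoeff b c t))
    refine ⟨N, fun n ht hn => ?_⟩
    have : fieldCoeff a (fieldCoeff b c (n 0)) (n 1) = 0 := by rw [ht]; exact hN _ hn
    rw [fieldProd, this, coeffAt_zero]

theorem isIteratedLaurent_fieldIter (a b c : FieldInf W) :
    IsIteratedLaurent 0 1 (fieldIter a b c) := by
  refine ⟨?_, fun t => ?_⟩
  · obtain ⟨N, hN⟩ := fcoeff_bounded (fieldY a b)
    refine ⟨N, fun n hn => ?_⟩
    have : fieldCoeff a b (n 0) = 0 := hN _ hn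
    rw [fieldIter, this, fieldCoeff_zero_left, coeffAt_zero]
  · obtain ⟨N, hN⟩ := fcoeff_bounded (fieldY (fieldCoeff a b t) c)
    refine ⟨N, fun n ht hn => ?_⟩
    have : fieldCoeff (fieldCoeff a b (n 0)) c (n 1) = 0 := by rw [ht]; exact hN _ hn
    rw [fieldIter, this, coeffAt_zero]

theorem assocSubst_eq_sum {M : Type*} [AddCommGroup M] {A : FormalSeries 3 M} {N : ℤ}
    (hA : ∀ n, n 0 < N → A n = 0) (i j s : ℤ) :
    assocSubst A ![i, j, s] = ∑ k ∈ Finset.range (j - N + 1).toNat,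
      (Ring.choose (i + k) k : ℤ) • A ![j - k, i + k, s] :=
  finsum_eq_sum_range fun k hk => by
    change (Ring.choose (i + k) k : ℤ) • A ![j - k, i + k, s] = 0
    rw [hA _ (by simp; omega), smul_zero]

theorem IsFieldSeries.assocSubst {A : FormalSeries 3 (Module.End ℂ W)} (hF : IsFieldSeries A)
    (hI : IsIteratedLaurent 0 1 A) : IsFieldSeries (assocSubst A) := by
  obtain ⟨⟨N, hN⟩, -⟩ := hI
  choose d hd using hF
  intro i j
  refine ⟨∑ k ∈ Finset.range (j - N + 1).toNat, (Ring.choose (i + k) k : ℤ) • d (j - k) (i + k),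
    fun n => ?_⟩
  rw [assocSubst_eq_sum hN]
  change coeffAtHom W n _ = _
  rw [map_sum]
  refine Finset.sum_congr rfl fun k _ => ?_
  rw [map_zsmul, ← hd]
  rfl

/-- For a fixed power of x₂ only finitely many powers of the first variable of A contribute, and
each bounds the powers of x₀ from below. The order of the two Laurent variables is thereby reversed.
-/
theorem IsIteratedLaurent.assocSubst {M : Type*} [AddCommGroup M] {A : FormalSeries 3 M}
    (hI : IsIteratedLaurent 0 1 A) : IsIteratedLaurent 1 0 (assocSubst A) := by
  obtain ⟨⟨N, hN⟩, hI⟩ := hI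
  choose L hL using hI
  refine ⟨⟨N, fun n hn => ?_⟩, fun t => ?_⟩
  · rw [← vec3_eta n, assocSubst_eq_sum hN]
    refine Finset.sum_eq_zero fun k hk => ?_
    have := Finset.mem_range.1 hk
    omega
  · obtain ⟨K, hK⟩ : ∃ K : ℤ, ∀ k ∈ Finset.range (t - N + 1).toNat, K ≤ L (t - k) - k := by
      obtain ⟨K, hK⟩ := ((Finset.range (t - N + 1).toNat).image
        fun k : ℕ => L (t - k) - k).bddBelow
      exact ⟨K, fun k hk => hK (Finset.mem_coe.2 (Finset.mem_image_of_mem _ hk))⟩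
    refine ⟨K, fun n ht hn => ?_⟩
    rw [← vec3_eta n, assocSubst_eq_sum hN, ht]
    refine Finset.sum_eq_zero fun k hk => ?_
    rw [hL (t - k) _ rfl (by have := hK k hk; simp; omega), smul_zero]

/-- The two ways to substitute `x₁ → x + x₂ + x₀`, `x₂ → x + x₂` agree. -/
theorem assocSubst_substPair {G A : FormalSeries 3 (Module.End ℂ W)} (hG : IsTruncated G)
    (hA : ∀ i j s w, A ![j, i, s] w =
      if 0 ≤ i ∧ 0 ≤ j then substPair G w i.toNat j.toNat s else 0) (i j s : ℤ) (w : W) :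
    assocSubst A ![i, j, s] w =
      if 0 ≤ i ∧ 0 ≤ j then ∑ᶠ p : ℤ × ℤ,
        ((Ring.choose p.1 i.toNat : ℤ) * (Ring.choose (p.1 - i + p.2) j.toNat : ℤ)) •
          G ![p.1, p.2, s + i + j - p.1 - p.2] w else 0 := by
  have hA0 : ∀ n, n 0 < 0 → A n = 0 := fun n hn => LinearMap.ext fun w => by
    rw [← vec3_eta n, hA, if_neg fun h => absurd hn (not_lt.2 h.2), LinearMap.zero_apply]
  rw [assocSubst_eq_sum hA0, sub_zero, LinearMap.sum_apply]
  split_ifs with hij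
  · obtain ⟨i, rfl⟩ := Int.eq_ofNat_of_zero_le hij.1
    obtain ⟨j, rfl⟩ := Int.eq_ofNat_of_zero_le hij.2
    rw [show ((j : ℤ) + 1).toNat = j + 1 by omega]
    have e1 : ∀ k ∈ Finset.range (j + 1),
        ((Ring.choose ((i : ℤ) + k) k : ℤ) • A ![(j : ℤ) - k, (i : ℤ) + k, s]) w =
          ∑ᶠ p : ℤ × ℤ, ((Ring.choose ((i : ℤ) + k) k : ℤ) *
            ((Ring.choose p.1 (i + k) : ℤ) * (Ring.choose p.2 (j - k) : ℤ))) •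
              G ![p.1, p.2, s + i + j - p.1 - p.2] w := by
      intro k hk
      have hkj : k ≤ j := Nat.lt_succ_iff.1 (Finset.mem_range.1 hk)
      have hs : ∀ p : ℤ × ℤ, s + ((i + k : ℕ) : ℤ) + ((j - k : ℕ) : ℤ) - p.1 - p.2 =
          s + i + j - p.1 - p.2 := fun p => by omega
      rw [LinearMap.smul_apply, hA, if_pos ⟨by omega, by omega⟩, substPair,
        show ((i : ℤ) + k).toNat = i + k by omega, show ((j : ℤ) - k).toNat = j - k by omega,
        smul_finsum' _ (hG.finite_plane _ _ w)]
      exact finsum_congr fun p => by rw [smul_smul, hs]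
    rw [Finset.sum_congr rfl e1, ← finsum_sum_comm _ _ fun k _ => hG.finite_plane _ _ w]
    refine finsum_congr fun p => ?_
    rw [← Finset.sum_smul, Int.toNat_natCast, Int.toNat_natCast]
    congr 1
    -- By Vandermonde, (p₁-i+p₂ choose j) is the sum of (p₁-i choose k)(p₂ choose j-k). The terms
    -- match through (p₁ choose i+k)(i+k choose i) = (p₁ choose i)(p₁-i choose k).
    rw [Ring.add_choose_eq j (Commute.all (p.1 - i) p.2),
      Finset.Nat.sum_antidiagonal_eq_sum_range_succ
        fun k l => (Ring.choose (p.1 - i) k : ℤ) * Ring.choose p.2 l, Finset.mul_sum]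
    refine Finset.sum_congr rfl fun k _ => ?_
    have := Ring.choose_smul_choose p.1 (Nat.le_add_right i k)
    have e2 : (Ring.choose ((i : ℤ) + k) k : ℤ) = ((i + k).choose i : ℤ) := by
      rw [Nat.choose_symm_add, ← Ring.choose_natCast]; push_cast; rfl
    rw [nsmul_eq_mul, Nat.add_sub_cancel_left] at this
    rw [e2, ← mul_assoc, ← mul_assoc, this]
  · refine Finset.sum_eq_zero fun k hk => ?_
    rw [LinearMap.smul_apply, hA]
    have hk' := Finset.mem_range.1 hk
    split_ifs with h
    -- Here i < 0 ≤ i+k < k, so the binomial coefficient vanishes: a nonnegative power of x₀+x₂ has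
    -- no negative powers of x₀.
    · obtain ⟨m, hm⟩ := Int.eq_ofNat_of_zero_le h.1
      rw [hm, Ring.choose_natCast, Nat.choose_eq_zero_of_lt (by omega), Nat.cast_zero, zero_smul]
    · rw [smul_zero]

end Cancellation

section JacobiIdentities

variable {W : Type*} [AddCommGroup W] [Module ℂ W]

/-! ### Locality and associativity of the vertex operators -/

theorem aeval_aeval_vec2 (φ : Fin 3 → MvPolynomial (Fin 3) ℂ) (i j : Fin 3)
    (p : MvPolynomial (Fin 2) ℂ) :
    MvPolynomial.aeval φ (MvPolynomial.aeval ![X i, X j] p : MvPolynomial (Fin 3) ℂ) =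
      (MvPolynomial.aeval ![φ i, φ j] p : MvPolynomial (Fin 3) ℂ) := by
  rw [aeval_vec2_X, MvPolynomial.aeval_rename]
  congr 2
  funext k
  fin_cases k <;> rfl

theorem aeval_X_sub_X_pow_mul {A : Type*} [CommRing A] [Algebra ℂ A] (u v : A) (l : ℕ)
    (h : MvPolynomial (Fin 2) ℂ) :
    MvPolynomial.aeval ![u, v] ((X 0 - X 1) ^ l * h) =
      (u - v) ^ l * MvPolynomial.aeval ![u, v] h := by
  simp only [map_mul, map_pow, map_sub, MvPolynomial.aeval_X, Matrix.cons_val_zero,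
    Matrix.cons_val_one]

theorem cornerEval_aeval_ne_zero {u v : MvPolynomial (Fin 3) ℂ} (hu : cornerEval u = xInf)
    (hv : cornerEval v = xInf) {h : MvPolynomial (Fin 2) ℂ} (hh : diag h ≠ 0) :
    cornerEval (MvPolynomial.aeval ![u, v] h) ≠ 0 := by
  rw [cornerEval_aeval fun i => by fin_cases i; exacts [hu, hv]]
  exact aeval_xInf_ne_zero hh

theorem rename_aeval_rename (Q : MvPolynomial (Fin 3) ℂ) :
    MvPolynomial.rename ![1, 0, 2] (MvPolynomial.aeval ![X 1 + X 2, X 0 + X 2, X 2]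
      (MvPolynomial.rename ![1, 0, 2] Q) : MvPolynomial (Fin 3) ℂ) =
      (MvPolynomial.aeval ![X 1 + X 2, X 0 + X 2, X 2] Q : MvPolynomial (Fin 3) ℂ) := by
  induction Q using MvPolynomial.induction_on with
  | C c => simp
  | add p q hp hq => simp only [map_add, hp, hq]
  | mul_X p i hp =>
    simp only [map_mul, hp, MvPolynomial.aeval_X, MvPolynomial.rename_X]
    congr 1
    fin_cases i <;> simp

/-- As p(x₁,x₂) divides Q, the products abc and bac give the same truncated series. Both iterated
products can then be computed from a single G. -/
theorem polyMul_tripleProd_swap {a b c : FieldInf W} {p : MvPolynomial (Fin 2) ℂ}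
    (hp : polyMul p (pairProd a b) = polyMul p (pairProdSwap a b)) {Q : MvPolynomial (Fin 3) ℂ}
    (hQ : MvPolynomial.aeval ![X 0, X 1] p ∣ Q) :
    polyMul (MvPolynomial.rename ![1, 0, 2] Q) (tripleProd b a c) =
      fun n => polyMul Q (tripleProd a b c) ![n 1, n 0, n 2] := by
  have s := polyMul_sandwich (i := (0 : Fin 3)) (j := 1) (by decide) (fun _ => 1)
    (fun n => coeffAt c (n 2)) (fun _ _ _ => rfl)
    (fun n n' h => by rw [h 2 (by decide) (by decide)]) p
  have h1 := s (pairProd a b)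
  rw [hp, ← s (pairProdSwap a b)] at h1
  have h2 := polyMul_eq_of_dvd hQ h1
  have e : (fun n => 1 * pairProd a b ![n 0, n 1] * coeffAt c (n 2) :
      FormalSeries 3 (Module.End ℂ W)) = tripleProd a b c :=
    funext fun n => by simp [pairProd, tripleProd]
  rw [e] at h2
  exact polyMul_rename_vec3 (B := tripleProd b a c) (by decide) Q h2.symm
    (fun n => by simp [pairProdSwap, tripleProd]) fun _ => rfl

/-- Multiplied by R = Q(x+x₁,x+x₂,x), both orders of the product are the substitution in the same
truncated G. In R the differences become (x₁-x₂)ᵏ, x₁ˡ and x₂ᵐ, while f, g and h become f(x,x),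
g(x,x) and h(x,x) at x₁ = x₂ = 0, all nonzero. Everything cancels except (x₁-x₂)ᵏ, which vanishes at
the corner. The surviving exponent depends only on a and b. -/
theorem polyMul_fieldProd_comm {a b c : FieldInf W} {k l m : ℕ} {f g h : MvPolynomial (Fin 2) ℂ}
    (hf : diag f ≠ 0) (hg : diag g ≠ 0) (hh : diag h ≠ 0)
    (hab : polyMul ((X 0 - X 1) ^ k * f) (pairProd a b) =
      polyMul ((X 0 - X 1) ^ k * f) (pairProdSwap a b))
    (hac : polyMul ((X 0 - X 1) ^ l * g) (pairProd a c) =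
      polyMul ((X 0 - X 1) ^ l * g) (pairProdSwap a c))
    (hbc : polyMul ((X 0 - X 1) ^ m * h) (pairProd b c) =
      polyMul ((X 0 - X 1) ^ m * h) (pairProdSwap b c))
    (hac' : CompatiblePair a c) (hbc' : CompatiblePair b c)
    (ha : ∀ j, CompatiblePair a (fieldCoeff b c j))
    (hb : ∀ j, CompatiblePair b (fieldCoeff a c j)) :
    polyMul ((X 1 - X 0) ^ k) (fieldProd a b c) =
      polyMul ((X 1 - X 0) ^ k) (fun n => fieldProd b a c ![n 1, n 0, n 2]) := by
  obtain ⟨Q, hQ⟩ : ∃ Q : MvPolynomial (Fin 3) ℂ, Q =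
    MvPolynomial.aeval ![X 0, X 1] ((X 0 - X 1) ^ k * f) *
    MvPolynomial.aeval ![X 0, X 2] ((X 0 - X 1) ^ l * g) *
    MvPolynomial.aeval ![X 1, X 2] ((X 0 - X 1) ^ m * h) := ⟨_, rfl⟩
  have hdvd : MvPolynomial.aeval ![X 0, X 1] ((X 0 - X 1) ^ k * f) ∣ Q := by
    rw [hQ, mul_assoc]; exact dvd_mul_right _ _
  obtain ⟨G, hQG⟩ : ∃ G, polyMul Q (tripleProd a b c) = G := ⟨_, rfl⟩
  have hG : IsTruncated G := by
    rw [← hQG, hQ]; exact isTruncated_tripleProd hab hac hbc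
  have hQG' : polyMul (MvPolynomial.rename ![1, 0, 2] Q) (tripleProd b a c) =
      fun n => G ![n 1, n 0, n 2] := by
    rw [polyMul_tripleProd_swap hab hdvd, hQG]
  have hG' : IsTruncated (fun n => G ![n 1, n 0, n 2] : FormalSeries 3 (Module.End ℂ W)) := by
    intro w
    obtain ⟨N, hN⟩ := hG w
    refine ⟨N, fun n ⟨i, hi⟩ => hN _ ?_⟩
    fin_cases i
    exacts [⟨1, hi⟩, ⟨0, hi⟩, ⟨2, hi⟩]
  obtain ⟨R, hR⟩ : ∃ R : MvPolynomial (Fin 3) ℂ,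
    MvPolynomial.aeval ![X 1 + X 2, X 0 + X 2, X 2] Q = R := ⟨_, rfl⟩
  obtain ⟨A, hA⟩ : ∃ A, polyMul R (fieldProd a b c) = A := ⟨_, rfl⟩
  obtain ⟨B, hB⟩ : ∃ B, polyMul (MvPolynomial.aeval ![X 1 + X 2, X 0 + X 2, X 2]
    (MvPolynomial.rename ![1, 0, 2] Q)) (fieldProd b a c) = B := ⟨_, rfl⟩
  have hAB : A = fun n => B ![n 1, n 0, n 2] := by
    refine series3_ext fun j i s => LinearMap.ext fun w => ?_
    change A ![j, i, s] w = B ![i, j, s] w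
    rw [← hA, ← hB, ← hR, polyMul_fieldProd hbc' ha hQG hG,
      polyMul_fieldProd hac' hb hQG' hG', substPair_swap]
    simp only [and_comm]
  have h1 : polyMul R (fun n => fieldProd b a c ![n 1, n 0, n 2]) = A := by
    rw [← hR, ← rename_aeval_rename Q]
    exact polyMul_rename_vec3 (by decide) _ hB (fun _ => rfl) fun n => by rw [hAB]
  have hRfac : R = X 0 ^ m * X 1 ^ l * (MvPolynomial.aeval ![X 1 + X 2, X 0 + X 2] f *
      MvPolynomial.aeval ![X 1 + X 2, X 2] g * MvPolynomial.aeval ![X 0 + X 2, X 2] h) *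
      (X 1 - X 0) ^ k := by
    rw [← hR, hQ, map_mul, map_mul, aeval_aeval_vec2, aeval_aeval_vec2, aeval_aeval_vec2]
    simp only [Matrix.cons_val_zero, Matrix.cons_val_one, Matrix.cons_val]
    rw [aeval_X_sub_X_pow_mul, aeval_X_sub_X_pow_mul, aeval_X_sub_X_pow_mul,
      add_sub_add_right_eq_sub, add_sub_cancel_right, add_sub_cancel_right]
    ring
  rw [hRfac, polyMul_mul] at hA h1
  have hc : cornerEval (MvPolynomial.aeval ![X 1 + X 2, X 0 + X 2] f *
      MvPolynomial.aeval ![X 1 + X 2, X 2] g * MvPolynomial.aeval ![X 0 + X 2, X 2] h) ≠ 0 := by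
    rw [map_mul, map_mul]
    exact mul_ne_zero (mul_ne_zero (cornerEval_aeval_ne_zero (by simp) (by simp) hf)
      (cornerEval_aeval_ne_zero (by simp) (by simp) hg))
      (cornerEval_aeval_ne_zero (by simp) (by simp) hh)
  have hI := isIteratedLaurent_fieldProd b a c
  refine polyMul_cancel hc ((isFieldSeries_fieldProd a b c).polyMul _)
    (IsFieldSeries.polyMul (fun i j => ?_) _) ((isIteratedLaurent_fieldProd a b c).polyMul _)
    (IsIteratedLaurent.polyMul ⟨?_, fun t => ?_⟩ _) (hA.trans h1.symm)
  · exact isFieldSeries_fieldProd b a c j i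
  · obtain ⟨N, hN⟩ := hI.1
    exact ⟨N, fun n hn => hN _ hn⟩
  · obtain ⟨N, hN⟩ := hI.2 t
    exact ⟨N, fun n ht hn => hN _ ht hn⟩

/-- Substituting x₁ → x+x₂+x₀ at once, or x₁ → x+x₁ followed by x₁ → x₀+x₂, gives the same result on
G. The differences in Q become x₀ᵏ, (x₀+x₂)ˡ and x₂ᵐ. The factor (x₀+x₂)ˡ, coming from a and c, is
the only one that `polyMul_cancel` does not remove. -/
theorem polyMul_fieldIter_eq {a b c : FieldInf W} {k l m : ℕ} {f g h : MvPolynomial (Fin 2) ℂ}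
    (hf : diag f ≠ 0) (hg : diag g ≠ 0) (hh : diag h ≠ 0)
    (hab : polyMul ((X 0 - X 1) ^ k * f) (pairProd a b) =
      polyMul ((X 0 - X 1) ^ k * f) (pairProdSwap a b))
    (hac : polyMul ((X 0 - X 1) ^ l * g) (pairProd a c) =
      polyMul ((X 0 - X 1) ^ l * g) (pairProdSwap a c))
    (hbc : polyMul ((X 0 - X 1) ^ m * h) (pairProd b c) =
      polyMul ((X 0 - X 1) ^ m * h) (pairProdSwap b c))
    (hab' : CompatiblePair a b) (hbc' : CompatiblePair b c)
    (ha : ∀ j, CompatiblePair a (fieldCoeff b c j))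
    (hc : ∀ i, CompatiblePair (fieldCoeff a b i) c) :
    polyMul ((X 0 + X 1) ^ l) (fieldIter a b c) =
      polyMul ((X 0 + X 1) ^ l) (assocSubst (fieldProd a b c)) := by
  obtain ⟨Q, hQ⟩ : ∃ Q : MvPolynomial (Fin 3) ℂ, Q =
    MvPolynomial.aeval ![X 0, X 1] ((X 0 - X 1) ^ k * f) *
    MvPolynomial.aeval ![X 0, X 2] ((X 0 - X 1) ^ l * g) *
    MvPolynomial.aeval ![X 1, X 2] ((X 0 - X 1) ^ m * h) := ⟨_, rfl⟩
  obtain ⟨G, hQG⟩ : ∃ G, polyMul Q (tripleProd a b c) = G := ⟨_, rfl⟩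
  have hG : IsTruncated G := by
    rw [← hQG, hQ]; exact isTruncated_tripleProd hab hac hbc
  obtain ⟨R, hR⟩ : ∃ R : MvPolynomial (Fin 3) ℂ,
    MvPolynomial.aeval ![X 0 + X 1 + X 2, X 1 + X 2, X 2] Q = R := ⟨_, rfl⟩
  have hR' : MvPolynomial.aeval ![X 1, X 0 + X 1, X 2]
      (MvPolynomial.aeval ![X 1 + X 2, X 0 + X 2, X 2] Q : MvPolynomial (Fin 3) ℂ) = R := by
    rw [← hR]
    clear hQ hQG hR
    induction Q using MvPolynomial.induction_on with
    | C c => simp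
    | add p q hp hq => simp only [map_add, hp, hq]
    | mul_X p i hp =>
      simp only [map_mul, hp, MvPolynomial.aeval_X]
      congr 1
      fin_cases i <;> simp
  obtain ⟨A, hA⟩ : ∃ A, polyMul (MvPolynomial.aeval ![X 1 + X 2, X 0 + X 2, X 2] Q)
    (fieldProd a b c) = A := ⟨_, rfl⟩
  obtain ⟨N, hN⟩ := (isIteratedLaurent_fieldProd a b c).1
  have h1 : polyMul R (fieldIter a b c) = polyMul R (assocSubst (fieldProd a b c)) := by
    conv_rhs => rw [← hR', polyMul_assocSubst hN, hA]
    refine series3_ext fun i j s => LinearMap.ext fun w => ?_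
    rw [← hR, polyMul_fieldIter hab' hc hQG hG, assocSubst_substPair hG fun i j s w => by
      rw [← hA, polyMul_fieldProd hbc' ha hQG hG]]
  have hRfac : R = X 0 ^ k * X 1 ^ m * (MvPolynomial.aeval ![X 0 + X 1 + X 2, X 1 + X 2] f *
      MvPolynomial.aeval ![X 0 + X 1 + X 2, X 2] g * MvPolynomial.aeval ![X 1 + X 2, X 2] h) *
      (X 0 + X 1) ^ l := by
    rw [← hR, hQ, map_mul, map_mul, aeval_aeval_vec2, aeval_aeval_vec2, aeval_aeval_vec2]
    simp only [Matrix.cons_val_zero, Matrix.cons_val_one, Matrix.cons_val]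
    rw [aeval_X_sub_X_pow_mul, aeval_X_sub_X_pow_mul, aeval_X_sub_X_pow_mul,
      show (X 0 + X 1 + X 2 - (X 1 + X 2) : MvPolynomial (Fin 3) ℂ) = X 0 by ring,
      add_sub_cancel_right, add_sub_cancel_right]
    ring
  rw [hRfac, polyMul_mul, polyMul_mul _ _ (assocSubst _)] at h1
  have hcorner : cornerEval (MvPolynomial.aeval ![X 0 + X 1 + X 2, X 1 + X 2] f *
      MvPolynomial.aeval ![X 0 + X 1 + X 2, X 2] g * MvPolynomial.aeval ![X 1 + X 2, X 2] h) ≠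
      0 := by
    rw [map_mul, map_mul]
    exact mul_ne_zero (mul_ne_zero (cornerEval_aeval_ne_zero (by simp) (by simp) hf)
      (cornerEval_aeval_ne_zero (by simp) (by simp) hg))
      (cornerEval_aeval_ne_zero (by simp) (by simp) hh)
  have hI := isIteratedLaurent_fieldProd a b c
  exact polyMul_cancel hcorner ((isFieldSeries_fieldIter a b c).polyMul _)
    (((isFieldSeries_fieldProd a b c).assocSubst hI).polyMul _)
    ((isIteratedLaurent_fieldIter a b c).polyMul _) (hI.assocSubst.polyMul _) h1

end JacobiIdentities

section VertexAlgebra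

variable {W : Type*} [AddCommGroup W] [Module ℂ W]

/-! ### Linearity, vacuum and creation properties -/

theorem IsExpansion.fieldY_eq {a b : FieldInf W} {Z : FieldInfLaurent W}
    (h : IsExpansion (pairProd a b) Z) : fieldY a b = Z := by
  obtain ⟨p, hp, ht, -⟩ := id h
  exact CompatiblePair.isExpansion ⟨p, hp, ht⟩ |>.unique h

theorem pairProd_add_right (a b c : FieldInf W) :
    pairProd a (b + c) = pairProd a b + pairProd a c := by
  funext n; simp [pairProd, coeffAt_add, mul_add]

theorem pairProd_smul_right (t : ℂ) (a b : FieldInf W) :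
    pairProd a (t • b) = t • pairProd a b := by
  funext n; simp [pairProd, coeffAt_smul]

theorem fieldCoeff_add_left {a b c : FieldInf W} (ha : CompatiblePair a c)
    (hb : CompatiblePair b c) (k : ℤ) :
    fieldCoeff (a + b) c k = fieldCoeff a c k + fieldCoeff b c k := by
  have h := ha.isExpansion.add hb.isExpansion
  rw [← pairProd_add] at h
  rw [fieldCoeff, h.fieldY_eq, fcoeff_add]
  rfl

theorem fieldCoeff_add_right {a b c : FieldInf W} (hb : CompatiblePair a b)
    (hc : CompatiblePair a c) (k : ℤ) :
    fieldCoeff a (b + c) k = fieldCoeff a b k + fieldCoeff a c k := by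
  have h := hb.isExpansion.add hc.isExpansion
  rw [← pairProd_add_right] at h
  rw [fieldCoeff, h.fieldY_eq, fcoeff_add]
  rfl

theorem fcoeff_shiftPoly_C_smul (t : ℂ) (Z : FieldInfLaurent W) (k : ℤ) :
    fcoeff (shiftPoly (C t) • Z) k = t • fcoeff Z k := by
  rw [shiftPoly_C, fcoeff_C_smul]
  exact field_ext fun n => by rw [coeffAt_C_smul, coeffAt_smul]

theorem fieldCoeff_smul_left (t : ℂ) {a b : FieldInf W} (h : CompatiblePair a b) (k : ℤ) :
    fieldCoeff (t • a) b k = t • fieldCoeff a b k := by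
  have h := h.isExpansion.smul t
  rw [← pairProd_smul] at h
  rw [fieldCoeff, h.fieldY_eq, fcoeff_shiftPoly_C_smul]
  rfl

theorem fieldCoeff_smul_right (t : ℂ) {a b : FieldInf W} (h : CompatiblePair a b) (k : ℤ) :
    fieldCoeff a (t • b) k = t • fieldCoeff a b k := by
  have h := h.isExpansion.smul t
  rw [← pairProd_smul_right] at h
  rw [fieldCoeff, h.fieldY_eq, fcoeff_shiftPoly_C_smul]
  rfl

theorem isTruncated_pairProd_oneField_left (b : FieldInf W) :
    IsTruncated (pairProd (oneField W) b) := by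
  intro w
  obtain ⟨N, hN⟩ := coeffAt_bounded b w
  refine ⟨max N 0, fun n ⟨i, hi⟩ => ?_⟩
  rw [pairProd, Module.End.mul_apply, coeffAt_oneField]
  split_ifs with h0
  · have : i = 1 := by
      by_contra h
      have : i = 0 := by omega
      subst this
      exact absurd (lt_of_le_of_lt (le_max_right N 0) hi) (by omega)
    subst this
    exact hN _ (lt_of_le_of_lt (le_max_left _ _) hi)
  · rfl

theorem isTruncated_pairProd_oneField_right (a : FieldInf W) :
    IsTruncated (pairProd a (oneField W)) := by
  intro w
  obtain ⟨N, hN⟩ := coeffAt_bounded a w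
  refine ⟨max N 0, fun n ⟨i, hi⟩ => ?_⟩
  rw [pairProd, Module.End.mul_apply, coeffAt_oneField]
  split_ifs with h0
  · have : i = 0 := by
      by_contra h
      have : i = 1 := by omega
      subst this
      exact absurd (lt_of_le_of_lt (le_max_right N 0) hi) (by omega)
    subst this
    exact hN _ (lt_of_le_of_lt (le_max_left _ _) hi)
  · exact map_zero _

/-- `Y(1_W, x₀) b(x) = b(x)`. -/
theorem fieldCoeff_oneField_left (b : FieldInf W) (k : ℤ) :
    fieldCoeff (oneField W) b k = if k = 0 then b else 0 := by
  rw [fieldCoeff, (isTruncated_pairProd_oneField_left b).isExpansion.fieldY_eq, fcoeff_substAdd]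
  split_ifs with h0 h1 h1
  · subst h1
    refine field_ext fun s => LinearMap.ext fun w => ?_
    rw [substField_coeffAt, finsum_eq_single _ 0]
    · simp [pairProd, coeffAt_oneField]
    · intro m hm
      simp [pairProd, coeffAt_oneField, hm]
  · refine field_ext fun s => LinearMap.ext fun w => ?_
    rw [substField_coeffAt, coeffAt_zero, LinearMap.zero_apply]
    refine finsum_eq_zero_of_forall_eq_zero fun m => ?_
    by_cases hm : m = 0
    · rw [hm, Ring.choose_zero_pos ℤ (by omega), zero_smul]
    · simp [pairProd, coeffAt_oneField, hm]
  · omega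
  · rfl

/-- `Y(a(x), x₀) 1_W` involves no negative powers of `x₀`. -/
theorem fieldCoeff_oneField_right_neg (a : FieldInf W) {k : ℤ} (hk : k < 0) :
    fieldCoeff a (oneField W) k = 0 := by
  rw [fieldCoeff, (isTruncated_pairProd_oneField_right a).isExpansion.fieldY_eq, fcoeff_substAdd,
    if_neg (not_le.2 hk)]

/-- The constant term of `Y(a(x), x₀) 1_W` is `a(x)`. -/
theorem fieldCoeff_oneField_right_zero (a : FieldInf W) : fieldCoeff a (oneField W) 0 = a := by
  rw [fieldCoeff, (isTruncated_pairProd_oneField_right a).isExpansion.fieldY_eq, fcoeff_substAdd,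
    if_pos le_rfl]
  refine field_ext fun s => LinearMap.ext fun w => ?_
  rw [substField_coeffAt, finsum_eq_single _ s]
  · simp [pairProd, coeffAt_oneField]
  · intro m hm
    simp [pairProd, coeffAt_oneField, sub_eq_zero, Ne.symm hm]

/-! ### Series with coefficients in a space of fields -/

/-- The series in three variables obtained from a series in two variables whose coefficients are
mapped to `𝓔ᵒ(W)` by `θ`. -/
noncomputable def fieldSeries {M : Type*} [AddCommGroup M] [Module ℂ M] (θ : M →ₗ[ℂ] FieldInf W)
    (σ : Fin 2 → Fin 3) : FormalSeries 2 M →ₗ[ℂ] FormalSeries 3 (Module.End ℂ W) where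
  toFun B n := coeffAt (θ (B fun l => n (σ l))) (n 2)
  map_add' A B := funext fun n => by simp only [Pi.add_apply, map_add, coeffAt_add]
  map_smul' c A := funext fun n => by
    simp only [Pi.smul_apply, map_smul, coeffAt_smul, RingHom.id_apply]

theorem fieldSeries_apply {M : Type*} [AddCommGroup M] [Module ℂ M] (θ : M →ₗ[ℂ] FieldInf W)
    (σ : Fin 2 → Fin 3) (B : FormalSeries 2 M) (n : Fin 3 → ℤ) :
    fieldSeries θ σ B n = coeffAt (θ (B fun l => n (σ l))) (n 2) := rfl

theorem fieldSeries_polyMul {M : Type*} [AddCommGroup M] [Module ℂ M] (θ : M →ₗ[ℂ] FieldInf W)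
    {σ : Fin 2 → Fin 3} (hσ : Function.Injective σ) (h2 : ∀ l, σ l ≠ 2)
    (p : MvPolynomial (Fin 2) ℂ) (B : FormalSeries 2 M) :
    fieldSeries θ σ (polyMul p B) = polyMul (MvPolynomial.rename σ p) (fieldSeries θ σ B) := by
  rw [← aeval_X_comp]
  refine polyMul_intertwine (fieldSeries θ σ) _ (fun l A => funext fun n => ?_) p B
  rw [polyMul_X]
  change coeffAt (θ (polyMul (X l) A _)) (n 2) = coeffAt (θ (A _)) ((n - Pi.single (σ l) 1 : Fin 3 → ℤ) 2)
  rw [polyMul_X]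
  have e1 : (n - Pi.single (σ l) 1 : Fin 3 → ℤ) 2 = n 2 := by
    rw [Pi.sub_apply, Pi.single_eq_of_ne (h2 l).symm, sub_zero]
  have e2 : ((fun k => n (σ k)) - Pi.single l 1 : Fin 2 → ℤ) =
      fun k => (n - Pi.single (σ l) 1 : Fin 3 → ℤ) (σ k) := by
    funext k
    by_cases hk : k = l
    · subst hk; simp
    · simp [hk, hσ.ne hk]
  rw [e1, e2]

/-- Injectivity of θ brings identities between the three-variable operator series back to identities
between series with coefficients in the space of fields. -/
theorem polyMul_eq_of_fieldSeries_eq {M : Type*} [AddCommGroup M] [Module ℂ M]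
    {θ : M →ₗ[ℂ] FieldInf W} (hθ : Function.Injective θ) {σ : Fin 2 → Fin 3}
    (hσ : Function.Injective σ) (h2 : ∀ l, σ l ≠ 2) {p : MvPolynomial (Fin 2) ℂ}
    {q : MvPolynomial (Fin 3) ℂ} (hpq : MvPolynomial.rename σ p = q) {A B : FormalSeries 2 M}
    (h : polyMul q (fieldSeries θ σ A) = polyMul q (fieldSeries θ σ B)) :
    polyMul p A = polyMul p B := by
  rw [← hpq, ← fieldSeries_polyMul θ hσ h2, ← fieldSeries_polyMul θ hσ h2] at h
  refine funext fun m => hθ (field_ext fun s => ?_)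
  -- An exponent with the prescribed entries m along σ and the prescribed power s of x.
  obtain ⟨n, hn⟩ : ∃ n : Fin 3 → ℤ, n = Function.update (Function.extend σ m 0) 2 s := ⟨_, rfl⟩
  have e1 : n 2 = s := by rw [hn, Function.update_self]
  have e2 : (fun l => n (σ l)) = m := funext fun l => by
    rw [hn, Function.update_of_ne (h2 l), hσ.extend_apply]
  have := congrFun h n
  change coeffAt (θ (polyMul p A fun l => n (σ l))) (n 2) =
    coeffAt (θ (polyMul p B fun l => n (σ l))) (n 2) at this
  rwa [e1, e2] at this

theorem polyMul_apply_vector {r : ℕ} {V : Type*} [AddCommGroup V] [Module ℂ V]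
    (p : MvPolynomial (Fin r) ℂ) (A : FormalSeries r (Module.End ℂ V)) (n : Fin r → ℤ) (v : V) :
    polyMul p A n v = polyMul p (fun n => A n v) n := by
  simp [polyMul, LinearMap.sum_apply]

theorem polyMul_eq_of_fieldSeries_apply_eq {V : Type*} [AddCommGroup V] [Module ℂ V]
    {θ : V →ₗ[ℂ] FieldInf W} (hθ : Function.Injective θ) {σ : Fin 2 → Fin 3}
    (hσ : Function.Injective σ) (h2 : ∀ l, σ l ≠ 2) {p : MvPolynomial (Fin 2) ℂ}
    {q : MvPolynomial (Fin 3) ℂ} (hpq : MvPolynomial.rename σ p = q)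
    {A B : FormalSeries 2 (Module.End ℂ V)}
    (h : ∀ v, polyMul q (fieldSeries θ σ fun n => A n v) =
      polyMul q (fieldSeries θ σ fun n => B n v)) :
    polyMul p A = polyMul p B :=
  funext fun n => LinearMap.ext fun v => by
    rw [polyMul_apply_vector, polyMul_apply_vector,
      polyMul_eq_of_fieldSeries_eq hθ hσ h2 hpq (h v)]

/-! ### The vertex algebra of a closed quasi-local subspace -/

variable {K : Submodule ℂ (FieldInf W)}

theorem compatiblePair_of_isQuasiLocal (hK : IsQuasiLocal (K : Set (FieldInf W))) {a b : FieldInf W}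
    (ha : a ∈ K) (hb : b ∈ K) : CompatiblePair a b :=
  MutuallyLocal.compatiblePair (isQuasiLocal_iff.1 hK a ha b hb)

theorem fieldCoeff_mem (hm : ∀ a ∈ K, ∀ b ∈ K, ∀ n, fieldMode a n b ∈ K) {a b : FieldInf W}
    (ha : a ∈ K) (hb : b ∈ K) (k : ℤ) : fieldCoeff a b k ∈ K := by
  have := hm a ha b hb (-k - 1)
  rwa [fieldMode_eq, neg_sub, sub_neg_eq_add, add_sub_cancel_left] at this

theorem exists_factorization (hK : IsQuasiLocal (K : Set (FieldInf W))) {a b : FieldInf W}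
    (ha : a ∈ K) (hb : b ∈ K) :
    ∃ (k : ℕ) (h : MvPolynomial (Fin 2) ℂ), diag h ≠ 0 ∧
      polyMul ((X 0 - X 1) ^ k * h) (pairProd a b) =
        polyMul ((X 0 - X 1) ^ k * h) (pairProdSwap a b) := by
  obtain ⟨p, hp, hab⟩ := hK a ha b hb
  obtain ⟨k, h, rfl, hd⟩ := exists_eq_X_sub_X_pow_mul hp
  exact ⟨k, h, hd, hab⟩

/-- The exponent k comes from the polynomial for a and b alone and hence serves every c; locality of
operators needs this uniformity. -/
theorem exists_fieldProd_comm (hK : IsQuasiLocal (K : Set (FieldInf W)))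
    (hm : ∀ a ∈ K, ∀ b ∈ K, ∀ n, fieldMode a n b ∈ K) {a b : FieldInf W} (ha : a ∈ K)
    (hb : b ∈ K) : ∃ k : ℕ, ∀ c ∈ K, polyMul ((X 1 - X 0) ^ k) (fieldProd a b c) =
      polyMul ((X 1 - X 0) ^ k) (fun n => fieldProd b a c ![n 1, n 0, n 2]) := by
  obtain ⟨k, f, hf, hab⟩ := exists_factorization hK ha hb
  refine ⟨k, fun c hc => ?_⟩
  obtain ⟨l, g, hg, hac⟩ := exists_factorization hK ha hc
  obtain ⟨m, h, hh, hbc⟩ := exists_factorization hK hb hc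
  exact polyMul_fieldProd_comm hf hg hh hab hac hbc
    (compatiblePair_of_isQuasiLocal hK ha hc) (compatiblePair_of_isQuasiLocal hK hb hc)
    (fun j => compatiblePair_of_isQuasiLocal hK ha (fieldCoeff_mem hm hb hc j))
    (fun j => compatiblePair_of_isQuasiLocal hK hb (fieldCoeff_mem hm ha hc j))

theorem exists_fieldIter_eq (hK : IsQuasiLocal (K : Set (FieldInf W)))
    (hm : ∀ a ∈ K, ∀ b ∈ K, ∀ n, fieldMode a n b ∈ K) {a b c : FieldInf W} (ha : a ∈ K)
    (hb : b ∈ K) (hc : c ∈ K) : ∃ l : ℕ, polyMul ((X 0 + X 1) ^ l) (fieldIter a b c) =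
      polyMul ((X 0 + X 1) ^ l) (assocSubst (fieldProd a b c)) := by
  obtain ⟨k, f, hf, hab⟩ := exists_factorization hK ha hb
  obtain ⟨l, g, hg, hac⟩ := exists_factorization hK ha hc
  obtain ⟨m, h, hh, hbc⟩ := exists_factorization hK hb hc
  exact ⟨l, polyMul_fieldIter_eq hf hg hh hab hac hbc
    (compatiblePair_of_isQuasiLocal hK ha hb) (compatiblePair_of_isQuasiLocal hK hb hc)
    (fun j => compatiblePair_of_isQuasiLocal hK ha (fieldCoeff_mem hm hb hc j))
    (fun j => compatiblePair_of_isQuasiLocal hK (fieldCoeff_mem hm ha hb j) hc)⟩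

/-- The coefficient of `x₀ᵏ` in `Y(a(x), x₀)`, as an operator on a closed quasi-local subspace. -/
noncomputable def coeffEnd (hK : IsQuasiLocal (K : Set (FieldInf W)))
    (hm : ∀ a ∈ K, ∀ b ∈ K, ∀ n, fieldMode a n b ∈ K) (a : K) (k : ℤ) : Module.End ℂ K where
  toFun b := ⟨fieldCoeff a b k, fieldCoeff_mem hm a.2 b.2 k⟩
  map_add' b c := Subtype.ext <| fieldCoeff_add_right
    (compatiblePair_of_isQuasiLocal hK a.2 b.2) (compatiblePair_of_isQuasiLocal hK a.2 c.2) k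
  map_smul' t b := Subtype.ext <| fieldCoeff_smul_right t
    (compatiblePair_of_isQuasiLocal hK a.2 b.2) k

/-- The vertex operator map of a closed quasi-local subspace of `𝓔ᵒ(W)`. -/
noncomputable def vertexMap (hK : IsQuasiLocal (K : Set (FieldInf W)))
    (hm : ∀ a ∈ K, ∀ b ∈ K, ∀ n, fieldMode a n b ∈ K) : K →ₗ[ℂ] VertexOperator ℂ K where
  toFun a := VertexOperator.of_coeff (coeffEnd hK hm a) fun b => by
    obtain ⟨N, hN⟩ := fcoeff_bounded (fieldY (a : FieldInf W) b)
    exact ⟨N, fun k hk => not_lt.1 fun h => hk (Subtype.ext (hN k h))⟩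
  map_add' a a' := HVertexOperator.coeff_inj <| funext fun k => LinearMap.ext fun b => by
    rw [map_add]
    exact Subtype.ext <| fieldCoeff_add_left (compatiblePair_of_isQuasiLocal hK a.2 b.2)
      (compatiblePair_of_isQuasiLocal hK a'.2 b.2) k
  map_smul' t a := HVertexOperator.coeff_inj <| funext fun k => LinearMap.ext fun b => by
    rw [map_smul]
    exact Subtype.ext <| fieldCoeff_smul_left t (compatiblePair_of_isQuasiLocal hK a.2 b.2) k

theorem coe_coeff_vertexMap (hK : IsQuasiLocal (K : Set (FieldInf W)))
    (hm : ∀ a ∈ K, ∀ b ∈ K, ∀ n, fieldMode a n b ∈ K) (a b : K) (k : ℤ) :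
    (HVertexOperator.coeff (vertexMap hK hm a) k b : FieldInf W) = fieldCoeff a b k := rfl

theorem coeffAt_coe_finsum {x : ℕ → K} (c : ℕ → ℤ) {n : ℕ} (h : ∀ k, n ≤ k → x k = 0) (s : ℤ) :
    coeffAt ((∑ᶠ k, c k • x k : K) : FieldInf W) s =
      ∑ k ∈ Finset.range n, c k • coeffAt (x k : FieldInf W) s := by
  rw [finsum_eq_sum_range (n := n) fun k hk => by rw [h k hk, smul_zero]]
  exact (map_sum (coeffAtHom W s ∘ₗ K.subtype) _ _).trans <|
    Finset.sum_congr rfl fun k _ => map_zsmul (coeffAtHom W s ∘ₗ K.subtype) (c k) (x k)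

/-- Y(b,x₂)c has finitely many negative powers of x₂, so the sum is finite and commutes with taking
coefficients. -/
theorem coe_finsum_coeff_vertexMap (hK : IsQuasiLocal (K : Set (FieldInf W)))
    (hm : ∀ a ∈ K, ∀ b ∈ K, ∀ n, fieldMode a n b ∈ K) (a b c : K) (n : Fin 3 → ℤ) :
    coeffAt (K.subtype (∑ᶠ k : ℕ, (Ring.choose (n 0 + k) k : ℤ) •
      HVertexOperator.coeff (vertexMap hK hm a) (n 0 + k)
        (HVertexOperator.coeff (vertexMap hK hm b) (n 1 - k) c))) (n 2) =
      assocSubst (fieldProd (a : FieldInf W) b c) n := by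
  obtain ⟨N, hN⟩ := fcoeff_bounded (fieldY (b : FieldInf W) c)
  have hzero : ∀ k : ℕ, (n 1 - N + 1).toNat ≤ k →
      HVertexOperator.coeff (vertexMap hK hm a) (n 0 + k)
        (HVertexOperator.coeff (vertexMap hK hm b) (n 1 - k) c) = 0 := fun k hk => by
    have : HVertexOperator.coeff (vertexMap hK hm b) (n 1 - k) c = 0 :=
      Subtype.ext (hN _ (by omega))
    rw [this, map_zero]
  conv_rhs => rw [← vec3_eta n,
    assocSubst_eq_sum (N := N) fun n hn => fieldProd_eq_zero (hN _ hn)]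
  exact coeffAt_coe_finsum _ hzero _

theorem vertexMap_weak_assoc (hK : IsQuasiLocal (K : Set (FieldInf W)))
    (hm : ∀ a ∈ K, ∀ b ∈ K, ∀ n, fieldMode a n b ∈ K) (u v w : K) : ∃ l : ℕ,
    polyMul ((MvPolynomial.X 0 + MvPolynomial.X 1) ^ l)
        (fun n : Fin 2 → ℤ => ∑ᶠ i : ℕ, (Ring.choose (n 0 + i) i : ℤ) •
          HVertexOperator.coeff (vertexMap hK hm u) (n 0 + i)
            (HVertexOperator.coeff (vertexMap hK hm v) (n 1 - i) w)) =
      polyMul ((MvPolynomial.X 0 + MvPolynomial.X 1) ^ l)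
        (fun n : Fin 2 → ℤ => HVertexOperator.coeff
          (vertexMap hK hm (HVertexOperator.coeff (vertexMap hK hm u) (n 0) v)) (n 1) w) := by
  obtain ⟨l, key⟩ := exists_fieldIter_eq hK hm u.2 v.2 w.2
  have hσ : Function.Injective (![0, 1] : Fin 2 → Fin 3) := by decide
  have h2 : ∀ l, (![0, 1] : Fin 2 → Fin 3) l ≠ 2 := by decide
  have e : MvPolynomial.rename (![0, 1] : Fin 2 → Fin 3)
      ((X 0 + X 1 : MvPolynomial (Fin 2) ℂ) ^ l) = (X 0 + X 1) ^ l := by simp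
  refine ⟨l, polyMul_eq_of_fieldSeries_eq (M := K) (θ := K.subtype) K.subtype_injective hσ h2 e ?_⟩
  refine (congrArg (polyMul _) ?_).trans key.symm
  funext n
  rw [fieldSeries_apply]
  simp only [Matrix.cons_val_zero, Matrix.cons_val_one]
  exact coe_finsum_coeff_vertexMap hK hm u v w n

/-- The nonlocal vertex algebra of a closed quasi-local subspace of `𝓔ᵒ(W)` that contains `1_W`. -/
noncomputable def fieldAlgebra (hK : IsQuasiLocal (K : Set (FieldInf W))) (h1 : oneField W ∈ K)
    (hm : ∀ a ∈ K, ∀ b ∈ K, ∀ n, fieldMode a n b ∈ K) : NonlocalVertexAlgebra K where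
  Y := vertexMap hK hm
  one := ⟨oneField W, h1⟩
  vacuum n v := Subtype.ext <| by
    rw [coe_coeff_vertexMap, fieldCoeff_oneField_left]
    split_ifs <;> rfl
  creation_neg v _ hn := Subtype.ext (fieldCoeff_oneField_right_neg (v : FieldInf W) hn)
  creation_zero v := Subtype.ext (fieldCoeff_oneField_right_zero (v : FieldInf W))
  weak_assoc := vertexMap_weak_assoc hK hm

theorem fieldAlgebra_isVertexAlgebra (hK : IsQuasiLocal (K : Set (FieldInf W)))
    (h1 : oneField W ∈ K) (hm : ∀ a ∈ K, ∀ b ∈ K, ∀ n, fieldMode a n b ∈ K) :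
    (fieldAlgebra hK h1 hm).IsVertexAlgebra := by
  intro u v
  obtain ⟨k, key⟩ := exists_fieldProd_comm hK hm u.2 v.2
  -- `fieldProd` lists x₂ before x₁, hence the exchange.
  have hσ : Function.Injective (![1, 0] : Fin 2 → Fin 3) := by decide
  have h2 : ∀ l, (![1, 0] : Fin 2 → Fin 3) l ≠ 2 := by decide
  have e : MvPolynomial.rename (![1, 0] : Fin 2 → Fin 3)
      ((X 0 - X 1 : MvPolynomial (Fin 2) ℂ) ^ k) = (X 1 - X 0) ^ k := by simp
  refine ⟨k, polyMul_eq_of_fieldSeries_apply_eq (V := K) (θ := K.subtype) K.subtype_injective hσ h2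
    e fun w => ?_⟩
  exact key w w.2

/-! ### The tautological module -/

theorem applyModuleMap_fieldAlgebra (hK : IsQuasiLocal (K : Set (FieldInf W)))
    (h1 : oneField W ∈ K) (hm : ∀ a ∈ K, ∀ b ∈ K, ∀ n, fieldMode a n b ∈ K) (a b : K) :
    applyModuleMap (fieldAlgebra hK h1 hm) K.subtype a b = fieldY (a : FieldInf W) b :=
  fcoeff_ext fun _ => rfl

/-- A polynomial that makes a and b commute also truncates their product, and the relation defining
Y(a,x₀)b holds for every such polynomial, not only the chosen one. For local K this allows p =
(x₁-x₂)ᵏ. -/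
theorem assocAtInfinity_fieldAlgebra (hK : IsQuasiLocal (K : Set (FieldInf W)))
    (h1 : oneField W ∈ K) (hm : ∀ a ∈ K, ∀ b ∈ K, ∀ n, fieldMode a n b ∈ K) {a b : K}
    {p : MvPolynomial (Fin 2) ℂ} (h : polyMul p (pairProd (a : FieldInf W) b) =
      polyMul p (pairProdSwap (a : FieldInf W) b)) :
    AssocAtInfinity (fieldAlgebra hK h1 hm) K.subtype a b p := by
  refine ⟨isTruncated_pairProd h, ?_⟩
  rw [applyModuleMap_fieldAlgebra]
  exact (compatiblePair_of_isQuasiLocal hK a.2 b.2).isExpansion.eq_substAdd p _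

theorem isQuasiModuleAtInfinity_fieldAlgebra (hK : IsQuasiLocal (K : Set (FieldInf W)))
    (h1 : oneField W ∈ K) (hm : ∀ a ∈ K, ∀ b ∈ K, ∀ n, fieldMode a n b ∈ K) :
    IsQuasiModuleAtInfinity (fieldAlgebra hK h1 hm) K.subtype := by
  refine ⟨rfl, fun a b => ?_⟩
  obtain ⟨p, hp, h⟩ := hK a a.2 b b.2
  exact ⟨p, hp, assocAtInfinity_fieldAlgebra hK h1 hm h⟩

theorem isModuleAtInfinity_fieldAlgebra (hK : IsQuasiLocal (K : Set (FieldInf W)))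
    (hloc : IsLocal (K : Set (FieldInf W))) (h1 : oneField W ∈ K)
    (hm : ∀ a ∈ K, ∀ b ∈ K, ∀ n, fieldMode a n b ∈ K) :
    IsModuleAtInfinity (fieldAlgebra hK h1 hm) K.subtype := by
  refine ⟨isQuasiModuleAtInfinity_fieldAlgebra hK h1 hm, fun a b => ?_⟩
  obtain ⟨k, h⟩ := hloc a a.2 b b.2
  exact ⟨k, assocAtInfinity_fieldAlgebra hK h1 hm h⟩

end VertexAlgebra

end VertexAtInfinity


theorem theorem5p4 {W : Type*} [AddCommGroup W] [Module ℂ W] (U : Set (FieldInf W))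
    (hU : IsQuasiLocal U) :
    IsQuasiCompatible U ∧
      ∃ K : Submodule ℂ (FieldInf W), IsGeneratedBy K U ∧
        ∃ N : NonlocalVertexAlgebra K,
          ((N.one : FieldInf W) = oneField W ∧
            ∀ (a b : K) (n : ℤ),
              (VertexOperator.ncoeff (N.Y a) n b : FieldInf W) = fieldMode a n b) ∧
          N.IsVertexAlgebra ∧
          IsQuasiModuleAtInfinity N K.subtype ∧
          (IsLocal U → IsModuleAtInfinity N K.subtype) := by
  have hK := hU.modeClosure
  have h1 := oneField_mem_modeClosure U
  have hm : ∀ a ∈ modeClosure U, ∀ b ∈ modeClosure U, ∀ n, fieldMode a n b ∈ modeClosure U :=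
    fun _ ha _ hb n => fieldMode_mem_modeClosure ha hb n
  exact ⟨hU.isQuasiCompatible, modeClosure U, hU.isGeneratedBy, fieldAlgebra hK h1 hm,
    ⟨rfl, fun _ _ _ => rfl⟩, fieldAlgebra_isVertexAlgebra hK h1 hm,
    isQuasiModuleAtInfinity_fieldAlgebra hK h1 hm,
    fun hloc => isModuleAtInfinity_fieldAlgebra hK hloc.modeClosure h1 hm⟩
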